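/- Let $k=\mathbb R$ or $\mathbb C$. An NQ-manifold is a smooth manifold with a sheaf of $\mathbb N$-graded, graded commutative $k$-algebras, whose degree $0$ part is the sheaf of smooth functions and which is locally freely generated by finitely many generators of positive degrees, with a derivation $Q$ of degree $1$, $Q^2=0$; $Q_L$ denotes that of $L$. Let $\mathcal E\to\mathcal M$ be a representation of an NQ-manifold $(\mathcal M,Q)$: a locally free sheaf of $\mathbb Z$-graded right $C^\infty(\mathcal M)$-modules of finite rank with $\hat Q$ of degree $1$, $\hat Q^2=0$, $\hat Q(ef)=(\hat Qe)f+(-1)^{|e|}e\,Qf$. In a local trivialization with homogeneous generators $\zeta_\alpha$ of degree (level) $\alpha$ write $$\hat Q\zeta_\alpha=\sum_\beta\zeta_\beta D^\beta{}_\alpha=\sum_\beta(-1)^\beta\zeta_\beta T^\beta{}_\alpha ;$$ for a second trivialization write $\tilde\zeta_{\tilde\alpha}=\sum_\beta\zeta_\beta\Omega^\beta{}_{\tilde\alpha}$, and let $\tilde D$ be the matrix of $\hat Q$ in it. A super-curve is a morphism of NQ-manifolds $C:T[1][0,1]\times L\to\mathcal M$, with coordinates $t,\theta$ on $T[1][0,1]$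 and an arbitrary test NQ-manifold $L$; a super-loop is a morphism $T[1]S^1\times L\to\mathcal M$. Homotopies of these are morphisms $T[1][0,1]_s\times T[1][0,1]\times L\to\mathcal M$, resp. $T[1][0,1]_s\times T[1]S^1\times L\to\mathcal M$; they join their restrictions to $s=0$ and to $s=1$. Write $\boldsymbol T=C^*T$, and let $D(t),\Omega(t)$ be the pull-backs of $D,\Omega$ at the time $t$ and at $\theta=0$. Where a piece $[a,b]$ of $C$ lies, over an open $V\subseteq|L|$, in one trivialization patch, its Wilson line is $$U(b,a)=\mathbb P\exp\Big(-\int_a^b dt\,d\theta\,\boldsymbol T\Big)=\sum_q(-1)^q\int_{b\ge t_1\ge\dots\ge t_q\ge a}\partial_\theta\boldsymbol T(t_1)\cdots\partial_\theta\boldsymbol T(t_q)\,dt_1\cdots dt_q ,$$ a matrix over $C^\infty(L|_V)$. In general the Wilson line over $V$ is the product of those of successive pieces, spliced by the transition matrices at the connecting points. The Wilson loop is the graded supertrace $\sum_\alpha(-1)^\alpha U^\alpha{}_\alpha(1,0)$, with the same trivialization at both ends. 1. (Formation) In one patch the path ordered exponential exists and is unique. For every super-curve, every point $y$ of $|L|$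 and all trivializations around the two end points $C(0,y)$, $C(1,y)$, a Wilson line between these trivializations exists over some neighbourhood of $y$. 2. (Covariance) Let $Q_L=0$. Let $U$, $\tilde U$ be Wilson lines of $C$ over the same $V$, formed with any two choices of subdivisions and trivializations; let $\Omega(0),\Omega(1)$ be the transition matrices between the trivializations at the two end points, and $\Omega^{-1}(0)$ that in the opposite direction. Then there is a matrix $N$ with $N^\alpha{}_{\tilde\beta}$ of degree $\tilde\beta-\alpha-1$ (zero if this is negative) such that $$\Omega(1)\tilde U-U\,\Omega(0)=D(1)N+N\tilde D(0).$$ In particular, on probes of the fibres by $L$ the Wilson line transforms covariantly: if a row $\zeta$ and a column $\zeta'$ over $C^\infty(L|_V)$ are compatible with the differentials (as $Q_L=0$: $\zeta D(1)=0$ and $D(0)\zeta'=0$), then $\zeta U\zeta'=(\zeta\Omega(1))\,\tilde U\,(\Omega^{-1}(0)\zeta')$. 3. (Homotopy invariance of the line) Let $Q_L=0$ and let $C_0,C_1$ be joined by a homotopy. Let $U_0,U_1$ be Wilson lines of $C_0,C_1$, and $P_0,P_1$ Wilson lines of the super-curves traced out in the variable $s$ by the initial and the final end point, all over the same $V$ and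 with matching trivializations at the four corners. Then locally on $V$ there is $N$, with the degrees as in 2, such that $$U_1P_0-P_1U_0=D_{C_1}(1)N+ND_{C_0}(0),$$ where $D_{C_1}(1)$ and $D_{C_0}(0)$ are taken at the final end of $C_1$ and at the initial end of $C_0$. Moreover $\zeta U_1P_0\zeta'=\zeta P_1U_0\zeta'$ over $V$ for all $\zeta,\zeta'$ with $\zeta D_{C_1}(1)=0$ and $D_{C_0}(0)\zeta'=0$. 4. (Wilson loop) For every $L$ (with any $Q_L$) and every super-loop $C$ there is exactly one function of degree $0$ on $L$ which over every $V$ is the graded supertrace of the Wilson line of $C$, for all choices of subdivisions and trivializations with which it can be formed over $V$. It is natural in $L$, i.e. it is a well-defined function on the presheaf $L\mapsto\mathrm{Hom}_{NQ}(T[1]S^1\times L,\mathcal M)$, and homotopic super-loops have the same Wilson loop. -/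

import Mathlib

open scoped Manifold ContDiff Topology
open TopologicalSpace (Opens)

universe u v w k

noncomputable section

/-! ### Graded manifolds -/

/-- A smooth manifold `B` (the body) with a sheaf `O` of `ℕ`-graded, graded commutative
`𝕜`-algebras whose degree zero part is the sheaf of smooth `𝕜`-valued functions on `B`.
`val` is the reduction of a section to a function on the body.  The sheaf condition is imposed in
every degree separately, i.e. `O` is a sheaf of graded algebras. -/
structure GradedSpace (𝕜 : Type k) [RCLike 𝕜] where
  n : ℕ
  B : Type u
  [top : TopologicalSpace B]
  [charted : ChartedSpace (EuclideanSpace ℝ (Fin n)) B]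
  [mfd : IsManifold (𝓡 n) ∞ B]
  [t2 : T2Space B]
  [secondCountable : SecondCountableTopology B]
  O : Opens B → Type u
  [ring : ∀ U, Ring (O U)]
  [alg : ∀ U, Algebra 𝕜 (O U)]
  gr : ∀ U, ℕ → Submodule 𝕜 (O U)
  gradedMonoid : ∀ U, SetLike.GradedMonoid (gr U)
  internal : ∀ U, DirectSum.IsInternal (gr U)
  gradedComm : ∀ (U) (i j : ℕ) (a b : O U), a ∈ gr U i → b ∈ gr U j →
    a * b = (-1 : ℤ) ^ (i * j) • (b * a)
  res : ∀ {U V : Opens B}, V ≤ U → O U →ₐ[𝕜] O V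
  res_refl : ∀ {U : Opens B} (a : O U), res le_rfl a = a
  res_res : ∀ {U V W : Opens B} (h : V ≤ U) (h' : W ≤ V) (a : O U),
    res h' (res h a) = res (h'.trans h) a
  res_mem : ∀ {U V : Opens B} (h : V ≤ U) (i : ℕ) (a : O U), a ∈ gr U i → res h a ∈ gr V i
  glue : ∀ {ι : Type u} (𝒰 : ι → Opens B) (i : ℕ) (s : ∀ j, O (𝒰 j)), (∀ j, s j ∈ gr (𝒰 j) i) →
    (∀ j l, res (inf_le_left : 𝒰 j ⊓ 𝒰 l ≤ 𝒰 j) (s j) =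
      res (inf_le_right : 𝒰 j ⊓ 𝒰 l ≤ 𝒰 l) (s l)) →
    ∃! a : O (iSup 𝒰), a ∈ gr (iSup 𝒰) i ∧ ∀ j, res (le_iSup 𝒰 j) a = s j
  val : ∀ U : Opens B, O U →ₐ[𝕜] (U → 𝕜)
  val_res : ∀ {U V : Opens B} (h : V ≤ U) (a : O U) (x : V), val V (res h a) x = val U a ⟨x, h x.2⟩
  val_pos : ∀ (U) (i : ℕ) (a : O U), 0 < i → a ∈ gr U i → val U a = 0
  val_inj : ∀ (U) (a : O U), a ∈ gr U 0 → val U a = 0 → a = 0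
  val_range : ∀ (U : Opens B) (f : U → 𝕜),
    (∃ a ∈ gr U 0, val U a = f) ↔ ContMDiff (𝓡 n) 𝓘(ℝ, 𝕜) ∞ f

attribute [instance] GradedSpace.top GradedSpace.charted GradedSpace.mfd GradedSpace.t2
  GradedSpace.secondCountable GradedSpace.ring GradedSpace.alg

/-- Exponents of the monomials in graded variables of the degrees `deg`: odd variables occur at
most once. -/
def MonoIdx {r : ℕ} (deg : Fin r → ℕ) : Type :=
  {I : Fin r → ℕ // ∀ j, Odd (deg j) → I j ≤ 1}

namespace GradedSpace

variable {𝕜 : Type k} [RCLike 𝕜]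

/-- Integer-indexed degrees: there is nothing in negative degree. -/
def degZ (X : GradedSpace.{u} 𝕜) (V : Opens X.B) (i : ℤ) : Submodule 𝕜 (X.O V) :=
  if 0 ≤ i then X.gr V i.toNat else ⊥

/-- Free homogeneous generators `ξ` of positive degrees of the sheaf over the open set `V`: over
every smaller open set each section is, uniquely, a polynomial in the `ξ` with coefficients in the
functions of degree zero. -/
structure Coords (X : GradedSpace.{u} 𝕜) where
  V : Opens X.B
  r : ℕ
  deg : Fin r → ℕ
  deg_pos : ∀ j, 0 < deg j
  ξ : Fin r → X.O V
  ξ_mem : ∀ j, ξ j ∈ X.gr V (deg j)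
  free : ∀ (V' : Opens X.B) (h : V' ≤ V) (a : X.O V'),
    ∃! c : MonoIdx deg →₀ X.gr V' 0,
      a = c.sum fun I f => (f : X.O V') * X.res h (List.ofFn fun j => ξ j ^ I.1 j).prod

/-- The value at the point `x` of the coefficient of the monomial `ξ ^ I` in the section `a`
(zero if `x` is not in the common domain). -/
def Coords.coeff {X : GradedSpace.{u} 𝕜} (κ : X.Coords) {W : Opens X.B} (a : X.O W)
    (I : MonoIdx κ.deg) (x : X.B) : 𝕜 :=
  open Classical in
  if h : x ∈ W ⊓ κ.V then
    X.val (W ⊓ κ.V) ((κ.free (W ⊓ κ.V) inf_le_right (X.res inf_le_left a)).choose I) ⟨x, h⟩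
  else 0

/-- A family of sections over `V`, parametrised by `S ⊆ ℝᵈ`, is smooth, i.e. is a function on
`S × X|_V`: its coefficients are jointly smooth. -/
def SmoothFamily (X : GradedSpace.{u} 𝕜) {d : ℕ} (S : Set (Fin d → ℝ)) {V : Opens X.B}
    (s : (Fin d → ℝ) → X.O V) : Prop :=
  ∀ (κ : X.Coords) (I : MonoIdx κ.deg),
    ContMDiffOn (𝓘(ℝ, Fin d → ℝ).prod (𝓡 X.n)) 𝓘(ℝ, 𝕜) ∞
      (fun p : (Fin d → ℝ) × X.B => κ.coeff (s p.1) I p.2)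
      (S ×ˢ ((V ⊓ κ.V : Opens X.B) : Set X.B))

end GradedSpace

/-- An `NQ`-manifold: a non-negatively graded manifold (locally freely generated) with a
homological vector field, i.e. a derivation `Q` of degree `1` and square zero. -/
structure NQManifold (𝕜 : Type k) [RCLike 𝕜] extends GradedSpace.{u} 𝕜 where
  locally_free : ∀ x : B, ∃ κ : toGradedSpace.Coords, x ∈ κ.V
  Q : ∀ U, O U →ₗ[𝕜] O U
  Q_mem : ∀ (U) (i : ℕ) (a : O U), a ∈ gr U i → Q U a ∈ gr U (i + 1)
  Q_mul : ∀ (U) (i : ℕ) (a b : O U), a ∈ gr U i →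
    Q U (a * b) = Q U a * b + (-1 : ℤ) ^ i • (a * Q U b)
  Q_Q : ∀ (U) (a : O U), Q U (Q U a) = 0
  Q_res : ∀ {U V : Opens B} (h : V ≤ U) (a : O U), Q V (res h a) = res h (Q U a)

/-! ### Representations of `NQ`-manifolds -/

section Representations

variable {𝕜 : Type k} [RCLike 𝕜]

/-- A sheaf of `ℤ`-graded right modules over the structure sheaf of an `NQ`-manifold. -/
structure GradedModuleSheaf (M : NQManifold.{u} 𝕜) where
  Γ : Opens M.B → Type w
  [addCommGroup : ∀ U, AddCommGroup (Γ U)]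
  [mod : ∀ U, Module (M.O U)ᵐᵒᵖ (Γ U)]
  lev : ∀ U, ℤ → AddSubgroup (Γ U)
  internal : ∀ U, DirectSum.IsInternal (lev U)
  smul_mem : ∀ (U) (i : ℤ) (j : ℕ) (s : Γ U) (a : M.O U), s ∈ lev U i → a ∈ M.gr U j →
    MulOpposite.op a • s ∈ lev U (i + j)
  res : ∀ {U V : Opens M.B}, V ≤ U → Γ U →+ Γ V
  res_refl : ∀ {U : Opens M.B} (s : Γ U), res le_rfl s = s
  res_res : ∀ {U V W : Opens M.B} (h : V ≤ U) (h' : W ≤ V) (s : Γ U),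
    res h' (res h s) = res (h'.trans h) s
  res_mem : ∀ {U V : Opens M.B} (h : V ≤ U) (i : ℤ) (s : Γ U), s ∈ lev U i → res h s ∈ lev V i
  res_smul : ∀ {U V : Opens M.B} (h : V ≤ U) (a : M.O U) (s : Γ U),
    res h (MulOpposite.op a • s) = MulOpposite.op (M.res h a) • res h s
  glue : ∀ {ι : Type u} (𝒰 : ι → Opens M.B) (i : ℤ) (s : ∀ j, Γ (𝒰 j)),
    (∀ j, s j ∈ lev (𝒰 j) i) →
    (∀ j l, res (inf_le_left : 𝒰 j ⊓ 𝒰 l ≤ 𝒰 j) (s j) =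
      res (inf_le_right : 𝒰 j ⊓ 𝒰 l ≤ 𝒰 l) (s l)) →
    ∃! a : Γ (iSup 𝒰), a ∈ lev (iSup 𝒰) i ∧ ∀ j, res (le_iSup 𝒰 j) a = s j

attribute [instance] GradedModuleSheaf.addCommGroup GradedModuleSheaf.mod

/-- A local trivialization over the open set `U`: homogeneous generators `ζ α`, of level
`lev α`, such that over every smaller open set each section is uniquely `∑ α, ζ α * f α`. -/
structure GradedModuleSheaf.Triv {M : NQManifold.{u} 𝕜} (E : GradedModuleSheaf.{u, w} M) where
  U : Opens M.B
  r : ℕ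
  lev : Fin r → ℤ
  ζ : Fin r → E.Γ U
  ζ_mem : ∀ α, ζ α ∈ E.lev U (lev α)
  basis : ∀ (U' : Opens M.B) (h : U' ≤ U) (s : E.Γ U'),
    ∃! f : Fin r → M.O U', s = ∑ α, MulOpposite.op (f α) • E.res h (ζ α)

/-- A representation of the `NQ`-manifold `M`: a graded vector bundle over `M` (a locally free
sheaf of graded modules of finite rank) with a lift `Qhat` of the homological vector field
which is linear in the fibres and of square zero. -/
structure QBundle (M : NQManifold.{u} 𝕜) extends GradedModuleSheaf.{u, w} M where
  locally_trivial : ∀ x : M.B, ∃ e : toGradedModuleSheaf.Triv, x ∈ e.U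
  Qhat : ∀ U, Γ U →+ Γ U
  Qhat_mem : ∀ (U) (i : ℤ) (s : Γ U), s ∈ lev U i → Qhat U s ∈ lev U (i + 1)
  Qhat_smul : ∀ (U) (i : ℤ) (s : Γ U) (a : M.O U), s ∈ lev U i →
    Qhat U (MulOpposite.op a • s) =
      MulOpposite.op a • Qhat U s + i.negOnePow • (MulOpposite.op (M.Q U a) • s)
  Qhat_Qhat : ∀ (U) (s : Γ U), Qhat U (Qhat U s) = 0
  Qhat_res : ∀ {U V : Opens M.B} (h : V ≤ U) (s : Γ U), Qhat V (res h s) = res h (Qhat U s)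

/-- The local trivializations of a representation. -/
abbrev QBundle.Triv {M : NQManifold.{u} 𝕜} (E : QBundle.{u, w} M) :=
  E.toGradedModuleSheaf.Triv

variable {M : NQManifold.{u} 𝕜} {E : QBundle.{u, w} M}

/-- The matrix of `Qhat` in a trivialization: `Qhat (ζ α) = ∑ β, ζ β * qmat β α`. -/
def QBundle.qmat (e : E.Triv) : Matrix (Fin e.r) (Fin e.r) (M.O e.U) := fun β α =>
  (e.basis e.U le_rfl (E.Qhat e.U (e.ζ α))).choose β

/-- The normalized representation matrix `T`: `Qhat (ζ α) = ∑ β, (-1) ^ β * ζ β * T β α`. -/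
def QBundle.repMat (e : E.Triv) : Matrix (Fin e.r) (Fin e.r) (M.O e.U) := fun β α =>
  (e.lev β).negOnePow • QBundle.qmat e β α

/-- The transition matrix `Ω` from `e` to `e'`, over the common domain:
`ζ' α = ∑ β, ζ β * Ω β α`. -/
def QBundle.transMat (e e' : E.Triv) : Matrix (Fin e.r) (Fin e'.r) (M.O (e.U ⊓ e'.U)) :=
  fun β α => (e.basis (e.U ⊓ e'.U) inf_le_left (E.res inf_le_right (e'.ζ α))).choose β

end Representations

/-! ### Maps `T[1]S × L → M` -/

/-- The sign in `θ_I θ_J = grassmannSign I J * θ_(I ∪ J)` for disjoint `I`, `J`, where `θ_I` is the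
product of the `θ_i`, `i ∈ I`, in increasing order. -/
def grassmannSign {d : ℕ} (I J : Finset (Fin d)) : ℤ :=
  (-1) ^ ((I ×ˢ J).filter fun p => p.2 < p.1).card

/-- A morphism of `NQ`-manifolds `T[1]S × L → M`, where `S ⊆ ℝᵈ` and `T[1]S` has the coordinates
`t_i` of degree `0` and `θ_i` of degree `1` and the homological vector field `∑ θ_i ∂/∂t_i`.

It consists of the map `f` of the bodies and of the pull-back of functions.  Whenever `f t` maps
`V` to `U`, the pull-back of `a ∈ O_M U` is, at `t`, the superfield `∑_K θ_K * pull t U V a K` with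
components in `O_L V`.  The pull-back is a morphism of sheaves of graded algebras, is smooth in all
variables, and intertwines `Q_M` with `∑ θ_i ∂/∂t_i + Q_L`. -/
structure SuperMap {𝕜 : Type k} [RCLike 𝕜] {d : ℕ} (S : Set (Fin d → ℝ))
    (L : NQManifold.{v} 𝕜) (M : NQManifold.{u} 𝕜) where
  f : (Fin d → ℝ) → L.B → M.B
  f_smooth : ContMDiffOn (𝓘(ℝ, Fin d → ℝ).prod (𝓡 L.n)) (𝓡 M.n) ∞
    (fun p : (Fin d → ℝ) × L.B => f p.1 p.2) (S ×ˢ Set.univ)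
  pull : (Fin d → ℝ) → ∀ (U : Opens M.B) (V : Opens L.B),
    M.O U →ₗ[𝕜] (Finset (Fin d) → L.O V)
  /-- a mere normalization: the value is irrelevant where the pull-back is not defined -/
  pull_undefined : ∀ t U V, ¬ (t ∈ S ∧ ∀ y ∈ V, f t y ∈ U) → pull t U V = 0
  pull_one : ∀ t ∈ S, ∀ U V, (∀ y ∈ V, f t y ∈ U) →
    pull t U V 1 = fun K => if K = ∅ then 1 else 0
  pull_mul : ∀ t ∈ S, ∀ U V, (∀ y ∈ V, f t y ∈ U) → ∀ (i : ℕ) (a b : M.O U), a ∈ M.gr U i →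
    ∀ K, pull t U V (a * b) K = ∑ I ∈ K.powerset,
      (grassmannSign I (K \ I) * (-1) ^ ((i + I.card) * (K \ I).card)) •
        (pull t U V a I * pull t U V b (K \ I))
  pull_mem : ∀ t ∈ S, ∀ U V, (∀ y ∈ V, f t y ∈ U) → ∀ (i : ℕ) (a : M.O U), a ∈ M.gr U i →
    ∀ K, pull t U V a K ∈ L.degZ V ((i : ℤ) - K.card)
  pull_val : ∀ t ∈ S, ∀ (U : Opens M.B) (V : Opens L.B) (h : ∀ y ∈ V, f t y ∈ U) (a : M.O U) (y : V),
    L.val V (pull t U V a ∅) y = M.val U a ⟨f t y, h y y.2⟩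
  pull_res_left : ∀ t ∈ S, ∀ U U' V (hU : U' ≤ U), (∀ y ∈ V, f t y ∈ U') → ∀ a : M.O U,
    pull t U' V (M.res hU a) = pull t U V a
  pull_res_right : ∀ t ∈ S, ∀ U V V' (hV : V' ≤ V), (∀ y ∈ V, f t y ∈ U) → ∀ (a : M.O U) (K),
    pull t U V' a K = L.res hV (pull t U V a K)
  pull_smooth : ∀ J : Set (Fin d → ℝ), IsOpen J → ∀ U V,
    (∀ t ∈ J ∩ S, ∀ y ∈ V, f t y ∈ U) → ∀ (a : M.O U) (K),
    L.SmoothFamily (J ∩ S) fun t => pull t U V a K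
  pull_Q : ∀ J : Set (Fin d → ℝ), IsOpen J → ∀ U V,
    (∀ t ∈ J ∩ S, ∀ y ∈ V, f t y ∈ U) → ∀ (a : M.O U) (K), ∀ t ∈ J ∩ S,
    ∀ (κ : L.Coords) (I : MonoIdx κ.deg) (x : L.B),
    κ.coeff (pull t U V (M.Q U a) K) I x =
      ∑ i ∈ K, (grassmannSign {i} (K.erase i) : 𝕜) *
        fderivWithin ℝ (fun τ => κ.coeff (pull τ U V a (K.erase i)) I x) (J ∩ S) t (Pi.single i 1)
      + (-1) ^ K.card * κ.coeff (L.Q V (pull t U V a K)) I x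

section Wilson

variable {𝕜 : Type k} [RCLike 𝕜]

/-- A super-curve `T[1][0,1] × L → M`. -/
abbrev SuperCurve (L : NQManifold.{v} 𝕜) (M : NQManifold.{u} 𝕜) :=
  SuperMap (Set.Icc (0 : Fin 1 → ℝ) 1) L M

/-- A homotopy of super-curves, i.e. a morphism `T[1][0,1] × T[1][0,1] × L → M`.  The first
variable is the deformation parameter `s`, the second one the parameter `t` of the curves. -/
abbrev SuperCurveHomotopy (L : NQManifold.{v} 𝕜) (M : NQManifold.{u} 𝕜) :=
  SuperMap (Set.Icc (0 : Fin 2 → ℝ) 1) L M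

/-- A super-loop `T[1]S¹ × L → M`, with `S¹ = ℝ / ℤ`. -/
structure SuperLoop (L : NQManifold.{v} 𝕜) (M : NQManifold.{u} 𝕜) extends
    SuperMap (Set.univ : Set (Fin 1 → ℝ)) L M where
  f_periodic : ∀ t, f (t + 1) = f t
  pull_periodic : ∀ t, pull (t + 1) = pull t

/-- A homotopy of super-loops, i.e. a morphism `T[1][0,1] × T[1]S¹ × L → M`. -/
structure SuperLoopHomotopy (L : NQManifold.{v} 𝕜) (M : NQManifold.{u} 𝕜) extends
    SuperMap {p : Fin 2 → ℝ | p 0 ∈ Set.Icc (0 : ℝ) 1} L M where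
  f_periodic : ∀ p, f (p + Pi.single 1 1) = f p
  pull_periodic : ∀ p, pull (p + Pi.single 1 1) = pull p

/-- A morphism of `NQ`-manifolds `L' → L`, i.e. `T[1](point) × L' → L`. -/
abbrev NQHom (L' : NQManifold.{v} 𝕜) (L : NQManifold.{u} 𝕜) :=
  SuperMap (Set.univ : Set (Fin 0 → ℝ)) L' L

variable {M : NQManifold.{u} 𝕜} {L : NQManifold.{v} 𝕜}

/-- `C` is the restriction of `H` to the line (inside the square or the cylinder) along which the
coordinate `j` varies while the other one has the value `c`. -/
def SuperMap.IsEdge {S₂ : Set (Fin 2 → ℝ)} {S₁ : Set (Fin 1 → ℝ)} (H : SuperMap S₂ L M)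
    (j : Fin 2) (c : ℝ) (C : SuperMap S₁ L M) : Prop :=
  ∀ t ∈ S₁, (∀ y, C.f t y = H.f (fun i => if i = j then t 0 else c) y) ∧
    ∀ U V (a : M.O U) (K : Finset (Fin 1)),
      C.pull t U V a K = H.pull (fun i => if i = j then t 0 else c) U V a (K.image fun _ => j)

/-- `C'` is the composite of `C` with `id × g`. -/
def SuperMap.IsPullback {L' : NQManifold.{v} 𝕜} {d : ℕ} {S : Set (Fin d → ℝ)}
    (C : SuperMap S L M) (g : NQHom L' L) (C' : SuperMap S L' M) : Prop :=
  ∀ t ∈ S, (∀ y, C'.f t y = C.f t (g.f 0 y)) ∧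
    ∀ U V V', (∀ y ∈ V', g.f 0 y ∈ V) → (∀ y ∈ V, C.f t y ∈ U) → ∀ (a : M.O U) (K),
      C'.pull t U V' a K = g.pull 0 V V' (C.pull t U V a K) ∅

variable {E : QBundle.{u, w} M} {S : Set (Fin 1 → ℝ)}

/-- The values over the point `t` of the curve (i.e. at `θ = 0`) of a matrix of functions. -/
def SuperMap.at (C : SuperMap S L M) (V : Opens L.B) (t : ℝ) {U : Opens M.B} {m n : ℕ}
    (A : Matrix (Fin m) (Fin n) (M.O U)) : Matrix (Fin m) (Fin n) (L.O V) :=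
  A.map fun a => C.pull (fun _ => t) U V a ∅

/-- The `θ`-components `∂_θ A` at the point `t` of the superfields of a matrix of functions. -/
def SuperMap.dtheta (C : SuperMap S L M) (V : Opens L.B) (t : ℝ) {U : Opens M.B} {m n : ℕ}
    (A : Matrix (Fin m) (Fin n) (M.O U)) : Matrix (Fin m) (Fin n) (L.O V) :=
  A.map fun a => C.pull (fun _ => t) U V a {0}

/-- The part over `V` of the piece `[a, b]` of the curve lies in the patch `U`. -/
def SuperMap.LiesIn (C : SuperMap S L M) (V : Opens L.B) (a b : ℝ) (U : Opens M.B) : Prop :=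
  ∀ t ∈ Set.Icc a b, (fun _ => t) ∈ S ∧ ∀ y ∈ V, C.f (fun _ => t) y ∈ U

/-- `W` is the path ordered exponential `P exp (- ∫ dt dθ T)` over `[a, b]` in the trivialization
`e`: it is the sum of the iterated integrals
`w_q = (-1) ^ q ∫_{b ≥ t₁ ≥ ⋯ ≥ t_q ≥ a} ∂_θ T(t₁) ⋯ ∂_θ T(t_q)`. Integrals and sums of functions
on `L` are computed on the coefficients. -/
def IsPathOrderedExp (C : SuperMap S L M) (V : Opens L.B) (e : E.Triv) (a b : ℝ)
    (W : Matrix (Fin e.r) (Fin e.r) (L.O V)) : Prop :=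
  ∃ w : ℕ → ℝ → Matrix (Fin e.r) (Fin e.r) (L.O V),
    (∀ t ∈ Set.Icc a b, w 0 t = 1) ∧
    (∀ q, ∀ t ∈ Set.Icc a b, ∀ α β (κ : L.Coords) (I : MonoIdx κ.deg) (x : L.B),
      κ.coeff (w (q + 1) t α β) I x =
        - ∫ τ in a..t, κ.coeff ((C.dtheta V τ (QBundle.repMat e) * w q τ) α β) I x) ∧
    ∀ α β (κ : L.Coords) (I : MonoIdx κ.deg) (x : L.B),
      HasSum (fun q => κ.coeff (w q b α β) I x) (κ.coeff (W α β) I x)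

/-- `W` is a Wilson line over `V` of the piece `[a, b]` of the super-curve, from the trivialization
`e` at `a` to the trivialization `e'` at `b`: a path ordered exponential if the piece lies in one
trivialization patch, and otherwise the product of the Wilson lines of successive pieces, spliced
by the transition matrices at the connecting points. -/
inductive IsWilsonLine (C : SuperMap S L M) (V : Opens L.B) :
    ∀ (_ _ : ℝ) (e e' : E.Triv), Matrix (Fin e'.r) (Fin e.r) (L.O V) → Prop
  | piece (a b : ℝ) (e : E.Triv) (W : Matrix (Fin e.r) (Fin e.r) (L.O V)) :
      a ≤ b → C.LiesIn V a b e.U → IsPathOrderedExp C V e a b W → IsWilsonLine C V a b e e W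
  | splice (a b c : ℝ) (e₀ e₁ e₂ e₃ : E.Triv) (W₁ : Matrix (Fin e₁.r) (Fin e₀.r) (L.O V))
      (W₂ : Matrix (Fin e₃.r) (Fin e₂.r) (L.O V)) :
      IsWilsonLine C V a b e₀ e₁ W₁ → IsWilsonLine C V b c e₂ e₃ W₂ →
      IsWilsonLine C V a c e₀ e₃ (W₂ * C.at V b (QBundle.transMat e₂ e₁) * W₁)

/-- `X = D₁ N + N D₀` for a matrix `N` which lowers the total degree by one. -/
def IsQExact {V : Opens L.B} (e₀ e₁ : E.Triv) (D₁ : Matrix (Fin e₁.r) (Fin e₁.r) (L.O V))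
    (D₀ : Matrix (Fin e₀.r) (Fin e₀.r) (L.O V)) (X : Matrix (Fin e₁.r) (Fin e₀.r) (L.O V)) : Prop :=
  ∃ N : Matrix (Fin e₁.r) (Fin e₀.r) (L.O V),
    (∀ α β, N α β ∈ L.degZ V (e₀.lev β - e₁.lev α - 1)) ∧ X = D₁ * N + N * D₀

/-- `w` is the Wilson loop of `C`: a function of degree zero on `L` which is given by the graded
supertrace of the Wilson line, over every open set `V` of `L` and for all choices of subdivisions
and trivializations for which the Wilson line is formed over `V`. -/
def IsWilsonLoop (E : QBundle.{u, w} M) (C : SuperLoop L M) (z : L.O ⊤) : Prop :=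
  z ∈ L.gr ⊤ 0 ∧ ∀ (V : Opens L.B) (e : E.Triv) (W : Matrix (Fin e.r) (Fin e.r) (L.O V)),
    IsWilsonLine C.toSuperMap V 0 1 e e W →
    L.res le_top z = ∑ α, (e.lev α).negOnePow • W α α

end Wilson

end

/-! Along a curve let A be the θ-component of T, D the matrix of Q̂ at θ = 0 and U the transport, so
that U' = -A U with initial value 1. The algebra comes from expanding two identities in powers of θ:
Q̂² = 0 (`qmat_mul_qmat`) and the comparison of Q̂ in two trivializations (`qmat_mul_transMat`). A
morphism of NQ-manifolds intertwines Q on the target with d + Q_L. Suppose first that Q_L = 0.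

The θ-component of the first identity reads D' = D A - A D. So D is covariantly constant and U is a
chain map, D(1) U = U D(0) (`mul_transport`). The θ-component of the second reads Ω' = Ω Ã - A Ω + D
n + n D̃, with n the signed θ-component of Ω: covariance can only hold up to homotopy. If y solves
y' = n Ũ - A y with y(0) = 0, then Ω(1) Ũ - U Ω(0) and D(1) y + y D̃(0) are values of solutions of
one linear equation with the same initial value, hence equal (`transport_homotopy`).

Over a square, the θ₀θ₁-component of Q̂² = 0 makes the curvature equal, up to sign, to D c + c D,
with c the θ₀θ₁-component of D. Therefore the transport in t, as a function of the deformation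
parameter s, obeys an equation of the same shape as Ω above (`transport_variation`), and
`transport_homotopy`, applied in s, compares the two ways around a square (`MapsInto.square`). Chain
homotopies can be composed with chain maps and the transition matrices form a cocycle, so
subdivision extends both results from one patch to all Wilson lines (`IsLineWL.htpy`,
`exists_commutes`).

The entries of these matrices are functions on L, so the differential equations are solved
coefficientwise. At a point and up to degree R, left multiplication by a matrix of functions is a
finite scalar matrix; this is multiplicative because products never lower the degree
(`Coords.rep_mul`). Smooth dependence on the point is obtained by inverting a Volterra operator on
continuous functions of the curve parameter, inversion being smooth; the coefficients are then
reassembled into a section (`exists_of_coeff`, `exists_isPOE`). Inhomogeneous equations are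
off-diagonal blocks of homogeneous ones (`exists_block`).

For arbitrary Q_L the same computations hold for values on the body, since Q_L raises the degree and
has no component of degree 0; this is the notion `Admissible`. It suffices for the Wilson loop,
because the supertrace has degree 0 and is determined by its values. The supertrace is invariant
under conjugation and kills D N + N D (`Htpy.str_eq`), which yields independence of choices, gluing
and homotopy invariance. -/

noncomputable section

/-! ### Sections of graded spaces -/

/-- The degree of the monomial with the exponents `I`. -/
def MonoIdx.total {r : ℕ} {deg : Fin r → ℕ} (I : MonoIdx deg) : ℕ := ∑ j, I.1 j * deg j

namespace GradedSpace

variable {𝕜 : Type k} [RCLike 𝕜] {X : GradedSpace.{u} 𝕜}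

attribute [instance] GradedSpace.gradedMonoid

instance decompositionGr (V : Opens X.B) : DirectSum.Decomposition (X.gr V) :=
  (X.internal V).chooseDecomposition

/-- The homogeneous component of degree `i`. -/
def comp {V : Opens X.B} (i : ℕ) (a : X.O V) : X.O V := (DirectSum.decompose (X.gr V) a i : X.O V)

theorem comp_mem {V : Opens X.B} (i : ℕ) (a : X.O V) : comp i a ∈ X.gr V i :=
  (DirectSum.decompose (X.gr V) a i).2

theorem comp_of_mem {V : Opens X.B} {i : ℕ} {a : X.O V} (h : a ∈ X.gr V i) : comp i a = a :=
  DirectSum.decompose_of_mem_same _ h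

theorem comp_of_mem_ne {V : Opens X.B} {i j : ℕ} {a : X.O V} (h : a ∈ X.gr V i) (hij : i ≠ j) :
    comp j a = 0 :=
  DirectSum.decompose_of_mem_ne _ h hij

theorem comp_add {V : Opens X.B} (i : ℕ) (a b : X.O V) : comp i (a + b) = comp i a + comp i b := by
  simp [comp, DirectSum.decompose_add]

theorem comp_zero {V : Opens X.B} (i : ℕ) : comp i (0 : X.O V) = 0 := by
  simp [comp, DirectSum.decompose_zero]

theorem comp_sum {V : Opens X.B} (i : ℕ) {ι : Type*} (s : Finset ι) (f : ι → X.O V) :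
    comp i (∑ x ∈ s, f x) = ∑ x ∈ s, comp i (f x) := by
  classical
  induction s using Finset.induction_on with
  | empty => simp [comp_zero]
  | insert a s ha ih => rw [Finset.sum_insert ha, Finset.sum_insert ha, comp_add, ih]

theorem eq_sum_comp {V : Opens X.B} (a : X.O V) : ∃ s : Finset ℕ,
    a = ∑ i ∈ s, comp i a ∧ ∀ i ∉ s, comp i a = 0 := by
  classical
  refine ⟨(DirectSum.decompose (X.gr V) a).support, (DirectSum.sum_support_decompose _ a).symm, ?_⟩
  intro i hi
  simpa [comp] using hi

theorem homogeneous_induction {V : Opens X.B} {p : X.O V → Prop} (zero : p 0)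
    (add : ∀ a b, p a → p b → p (a + b)) (hom : ∀ i, ∀ a ∈ X.gr V i, p a) (a : X.O V) : p a := by
  classical
  obtain ⟨s, hs, -⟩ := eq_sum_comp a
  rw [hs]
  exact Finset.sum_induction _ p add zero fun i _ => hom i _ (comp_mem i a)

theorem comp_res {U V : Opens X.B} (h : V ≤ U) (i : ℕ) (a : X.O U) :
    comp i (X.res h a) = X.res h (comp i a) := by
  induction a using homogeneous_induction with
  | zero => simp [comp_zero]
  | add a b ha hb => rw [map_add, comp_add, comp_add, map_add, ha, hb]
  | hom j a ha =>
    by_cases hij : j = i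
    · subst hij
      rw [comp_of_mem ha, comp_of_mem (X.res_mem h _ _ ha)]
    · rw [comp_of_mem_ne ha hij, comp_of_mem_ne (X.res_mem h _ _ ha) hij, map_zero]

/-- Gluing of homogeneous sections along a pointwise indexed cover. -/
theorem exists_glue {V : Opens X.B} (i : ℕ) (N : V → Opens X.B) (hN : ∀ y, N y ≤ V)
    (hy : ∀ y : V, (y : X.B) ∈ N y) (s : ∀ y, X.O (N y)) (hs : ∀ y, s y ∈ X.gr (N y) i)
    (hc : ∀ y z, X.res (inf_le_left : N y ⊓ N z ≤ N y) (s y) =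
      X.res (inf_le_right : N y ⊓ N z ≤ N z) (s z)) :
    ∃! a : X.O V, a ∈ X.gr V i ∧ ∀ y, X.res (hN y) a = s y := by
  have hV : V = iSup N :=
    le_antisymm (fun y hyV => Opens.mem_iSup.2 ⟨⟨y, hyV⟩, hy ⟨y, hyV⟩⟩) (iSup_le hN)
  have key := X.glue N i s hs hc
  generalize_proofs at key
  -- The types of sections depend on the open set, so the equality with the supremum is substituted
  -- for a variable open set.
  have aux : ∀ (W : Opens X.B) (hW : W = iSup N) (hN' : ∀ y, N y ≤ W),
      ∃! a : X.O W, a ∈ X.gr W i ∧ ∀ y, X.res (hN' y) a = s y := by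
    intro W hW
    subst hW
    intro _
    exact key
  exact aux V hV hN

/-- The sheaf axiom is imposed degree by degree, so homogeneous components are compared: those of
`a` and `b` of degree `i` glue the same local data. -/
theorem ext_local {V : Opens X.B} {a b : X.O V}
    (h : ∀ y ∈ V, ∃ (V' : Opens X.B) (h : V' ≤ V), y ∈ V' ∧ X.res h a = X.res h b) : a = b := by
  classical
  have hc : ∀ i, comp i a = comp i b := by
    intro i
    choose N hN hy he using h
    have := exists_glue (V := V) i (fun y => N y y.2) (fun y => hN y y.2) (fun y => hy y y.2)
      (fun y => X.res (hN y y.2) (comp i a)) (fun y => X.res_mem _ _ _ (comp_mem i a))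
      (fun y z => by rw [X.res_res, X.res_res])
    refine this.unique ⟨comp_mem i a, fun y => rfl⟩ ⟨comp_mem i b, fun y => ?_⟩
    rw [← comp_res, ← comp_res, he y y.2]
  exact (DirectSum.decompose (X.gr V)).injective (DFinsupp.ext fun i => Subtype.ext (hc i))

/-! ### Integer degrees -/

theorem mem_degZ_natCast {V : Opens X.B} {i : ℕ} {a : X.O V} :
    a ∈ X.degZ V (i : ℤ) ↔ a ∈ X.gr V i := by
  simp [degZ]

theorem mem_degZ_cases {V : Opens X.B} {i : ℤ} {a : X.O V} (h : a ∈ X.degZ V i) :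
    a = 0 ∨ ∃ n : ℕ, i = n ∧ a ∈ X.gr V n := by
  by_cases hi : 0 ≤ i
  · lift i to ℕ using hi
    exact Or.inr ⟨i, rfl, mem_degZ_natCast.1 h⟩
  · rw [degZ, if_neg hi] at h
    exact Or.inl h

theorem degZ_mul {V : Opens X.B} {i j : ℤ} {a b : X.O V} (ha : a ∈ X.degZ V i)
    (hb : b ∈ X.degZ V j) : a * b ∈ X.degZ V (i + j) := by
  rcases mem_degZ_cases ha with rfl | ⟨m, rfl, ha⟩
  · rw [zero_mul]; exact zero_mem _
  rcases mem_degZ_cases hb with rfl | ⟨n, rfl, hb⟩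
  · rw [mul_zero]; exact zero_mem _
  rw [← Nat.cast_add, mem_degZ_natCast]
  exact SetLike.mul_mem_graded ha hb

theorem degZ_res {U V : Opens X.B} (h : V ≤ U) {i : ℤ} {a : X.O U} (ha : a ∈ X.degZ U i) :
    X.res h a ∈ X.degZ V i := by
  rcases mem_degZ_cases ha with rfl | ⟨m, rfl, ha⟩
  · rw [map_zero]; exact zero_mem _
  · exact mem_degZ_natCast.2 (X.res_mem h _ _ ha)

theorem one_mem_degZ {V : Opens X.B} : (1 : X.O V) ∈ X.degZ V 0 := by
  have : (1 : X.O V) ∈ X.gr V 0 := SetLike.GradedOne.one_mem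
  exact_mod_cast mem_degZ_natCast.2 this

/-! ### Coefficients in coordinates -/

namespace Coords

variable (κ : X.Coords)

/-- The monomial `ξ ^ I`. -/
def mono (I : MonoIdx κ.deg) : X.O κ.V := (List.ofFn fun j => κ.ξ j ^ I.1 j).prod

theorem mono_mem (I : MonoIdx κ.deg) : κ.mono I ∈ X.gr κ.V I.total := by
  have h := SetLike.list_prod_ofFn_mem_graded (A := X.gr κ.V) (fun j => I.1 j * κ.deg j)
    (fun j => κ.ξ j ^ I.1 j) fun j => by
      have := SetLike.pow_mem_graded (I.1 j) (κ.ξ_mem j)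
      rwa [smul_eq_mul] at this
  rw [List.sum_ofFn] at h
  exact h

/-- The sum `∑ I, c I * ξ ^ I`. -/
def poly {D : Opens X.B} (hD : D ≤ κ.V) (c : MonoIdx κ.deg →₀ X.gr D 0) : X.O D :=
  c.sum fun I f => (f : X.O D) * X.res hD (κ.mono I)

theorem poly_inj {D : Opens X.B} (hD : D ≤ κ.V) {c c' : MonoIdx κ.deg →₀ X.gr D 0}
    (h : κ.poly hD c = κ.poly hD c') : c = c' :=
  (κ.free D hD (κ.poly hD c)).unique rfl h

theorem exists_poly {D : Opens X.B} (hD : D ≤ κ.V) (a : X.O D) : ∃ c, a = κ.poly hD c :=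
  (κ.free D hD a).exists

theorem poly_add {D : Opens X.B} (hD : D ≤ κ.V) (c c' : MonoIdx κ.deg →₀ X.gr D 0) :
    κ.poly hD (c + c') = κ.poly hD c + κ.poly hD c' := by
  classical
  unfold poly
  rw [Finsupp.sum_add_index] <;> intros <;> simp [add_mul]

theorem gr_zero_mul_mem {D : Opens X.B} (f g : X.gr D 0) : (f : X.O D) * g ∈ X.gr D 0 := by
  simpa using SetLike.mul_mem_graded f.2 g.2

theorem poly_mul {D : Opens X.B} (hD : D ≤ κ.V) (f : X.gr D 0) (c : MonoIdx κ.deg →₀ X.gr D 0) :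
    (f : X.O D) * κ.poly hD c =
      κ.poly hD (c.mapRange (fun g : X.gr D 0 => (⟨(f : X.O D) * g, gr_zero_mul_mem f g⟩ : X.gr D 0))
        (by simp)) := by
  unfold poly
  rw [Finsupp.sum_mapRange_index (by simp), Finsupp.sum, Finsupp.sum, Finset.mul_sum]
  simp only [mul_assoc]

theorem poly_res {D D' : Opens X.B} (hD : D ≤ κ.V) (h : D' ≤ D) (c : MonoIdx κ.deg →₀ X.gr D 0) :
    X.res h (κ.poly hD c) =
      κ.poly (h.trans hD) (c.mapRange
        (fun g : X.gr D 0 => (⟨X.res h g, X.res_mem h 0 _ g.2⟩ : X.gr D' 0)) (by simp)) := by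
  unfold poly
  rw [Finsupp.sum_mapRange_index (by simp), Finsupp.sum, Finsupp.sum, map_sum]
  simp only [map_mul, X.res_res]

theorem coeff_eq_zero_of_notMem {W : Opens X.B} (a : X.O W) (I : MonoIdx κ.deg) {x : X.B}
    (h : x ∉ W ⊓ κ.V) : κ.coeff a I x = 0 := dif_neg h

/-- The coefficients can be computed from the expansion on any smaller open set. -/
theorem coeff_eq {W D : Opens X.B} (a : X.O W) (hW : D ≤ W) (hD : D ≤ κ.V)
    (c : MonoIdx κ.deg →₀ X.gr D 0) (h : X.res hW a = κ.poly hD c) (I : MonoIdx κ.deg) {x : X.B}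
    (hx : x ∈ D) : κ.coeff a I x = X.val D (c I) ⟨x, hx⟩ := by
  have hx' : x ∈ W ⊓ κ.V := ⟨hW hx, hD hx⟩
  have hDW : D ≤ W ⊓ κ.V := le_inf hW hD
  have hspec : X.res (inf_le_left : W ⊓ κ.V ≤ W) a = κ.poly inf_le_right _ :=
    (κ.free (W ⊓ κ.V) inf_le_right (X.res inf_le_left a)).choose_spec.1
  have h2 := congrArg (X.res hDW) hspec
  rw [X.res_res, poly_res, h] at h2
  have h3 := DFunLike.congr_fun (κ.poly_inj _ h2) I
  rw [h3, Finsupp.mapRange_apply, X.val_res, coeff, dif_pos hx']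

theorem coeff_res {W W' : Opens X.B} (h : W' ≤ W) (a : X.O W) (I : MonoIdx κ.deg) {x : X.B}
    (hx : x ∈ W') : κ.coeff (X.res h a) I x = κ.coeff a I x := by
  by_cases hx' : x ∈ κ.V
  · obtain ⟨c, hc⟩ := κ.exists_poly (inf_le_right : W' ⊓ κ.V ≤ κ.V) (X.res inf_le_left (X.res h a))
    rw [κ.coeff_eq _ _ _ c hc I ⟨hx, hx'⟩]
    rw [X.res_res] at hc
    rw [κ.coeff_eq _ _ _ c hc I ⟨hx, hx'⟩]
  · rw [coeff_eq_zero_of_notMem _ _ _ fun h => hx' h.2, coeff_eq_zero_of_notMem _ _ _ fun h => hx' h.2]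

theorem coeff_add {W : Opens X.B} (a b : X.O W) (I : MonoIdx κ.deg) (x : X.B) :
    κ.coeff (a + b) I x = κ.coeff a I x + κ.coeff b I x := by
  by_cases hx : x ∈ W ⊓ κ.V
  · obtain ⟨c, hc⟩ := κ.exists_poly (inf_le_right : W ⊓ κ.V ≤ κ.V) (X.res inf_le_left a)
    obtain ⟨d, hd⟩ := κ.exists_poly (inf_le_right : W ⊓ κ.V ≤ κ.V) (X.res inf_le_left b)
    rw [κ.coeff_eq _ _ _ c hc I hx, κ.coeff_eq _ _ _ d hd I hx,
      κ.coeff_eq _ inf_le_left inf_le_right (c + d) (by rw [map_add, hc, hd, poly_add]) I hx]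
    simp
  · simp only [coeff_eq_zero_of_notMem _ _ _ hx, add_zero]

theorem coeff_fun_mul {W : Opens X.B} {f : X.O W} (hf : f ∈ X.gr W 0) (a : X.O W)
    (I : MonoIdx κ.deg) {x : X.B} (hx : x ∈ W) :
    κ.coeff (f * a) I x = X.val W f ⟨x, hx⟩ * κ.coeff a I x := by
  by_cases hx' : x ∈ κ.V
  · have hxD : x ∈ W ⊓ κ.V := ⟨hx, hx'⟩
    obtain ⟨c, hc⟩ := κ.exists_poly (inf_le_right : W ⊓ κ.V ≤ κ.V) (X.res inf_le_left a)
    rw [κ.coeff_eq _ _ _ c hc I hxD]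
    rw [κ.coeff_eq _ inf_le_left inf_le_right _ (by
      rw [map_mul, hc, κ.poly_mul _ ⟨X.res inf_le_left f, X.res_mem _ _ _ hf⟩]) I hxD]
    simp [X.val_res]
  · rw [coeff_eq_zero_of_notMem _ _ _ fun h => hx' h.2,
      coeff_eq_zero_of_notMem _ _ _ fun h => hx' h.2, mul_zero]

theorem algebraMap_mem {W : Opens X.B} (r : 𝕜) : algebraMap 𝕜 (X.O W) r ∈ X.gr W 0 := by
  rw [Algebra.algebraMap_eq_smul_one]
  exact Submodule.smul_mem _ _ SetLike.GradedOne.one_mem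

theorem coeff_smul {W : Opens X.B} (r : 𝕜) (a : X.O W) (I : MonoIdx κ.deg) (x : X.B) :
    κ.coeff (r • a) I x = r * κ.coeff a I x := by
  by_cases hx : x ∈ W
  · rw [Algebra.smul_def, κ.coeff_fun_mul (algebraMap_mem r) a I hx, AlgHom.commutes]
    rfl
  · rw [coeff_eq_zero_of_notMem _ _ _ fun h => hx h.1,
      coeff_eq_zero_of_notMem _ _ _ fun h => hx h.1, mul_zero]

/-- The coefficient as a linear functional. -/
def coeffL (W : Opens X.B) (I : MonoIdx κ.deg) (x : X.B) : X.O W →ₗ[𝕜] 𝕜 where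
  toFun a := κ.coeff a I x
  map_add' a b := κ.coeff_add a b I x
  map_smul' r a := κ.coeff_smul r a I x

theorem coeff_zero {W : Opens X.B} (I : MonoIdx κ.deg) (x : X.B) :
    κ.coeff (0 : X.O W) I x = 0 := (κ.coeffL W I x).map_zero

theorem coeff_sub {W : Opens X.B} (a b : X.O W) (I : MonoIdx κ.deg) (x : X.B) :
    κ.coeff (a - b) I x = κ.coeff a I x - κ.coeff b I x := (κ.coeffL W I x).map_sub a b

theorem coeff_neg {W : Opens X.B} (a : X.O W) (I : MonoIdx κ.deg) (x : X.B) :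
    κ.coeff (-a) I x = - κ.coeff a I x := (κ.coeffL W I x).map_neg a

theorem coeff_sum {W : Opens X.B} {ι : Type*} (s : Finset ι) (f : ι → X.O W) (I : MonoIdx κ.deg)
    (x : X.B) : κ.coeff (∑ i ∈ s, f i) I x = ∑ i ∈ s, κ.coeff (f i) I x :=
  map_sum (κ.coeffL W I x) f s

theorem poly_single {D : Opens X.B} (hD : D ≤ κ.V) (I : MonoIdx κ.deg) (f : X.gr D 0) :
    κ.poly hD (Finsupp.single I f) = f * X.res hD (κ.mono I) := by
  unfold poly
  rw [Finsupp.sum_single_index]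
  simp

theorem coeff_mono [DecidableEq (MonoIdx κ.deg)] (I J : MonoIdx κ.deg) {x : X.B} (hx : x ∈ κ.V) :
    κ.coeff (κ.mono I) J x = if I = J then 1 else 0 := by
  have h1 : (1 : X.O κ.V) ∈ X.gr κ.V 0 := SetLike.GradedOne.one_mem
  rw [κ.coeff_eq (κ.mono I) le_rfl le_rfl (Finsupp.single I ⟨1, h1⟩)
    (by rw [poly_single, one_mul]) J hx, Finsupp.single_apply]
  split_ifs <;> simp

/-- The unit is the monomial with the exponent zero. -/
def _root_.MonoIdx.zero {r : ℕ} (deg : Fin r → ℕ) : MonoIdx deg := ⟨0, fun _ _ => Nat.zero_le _⟩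

theorem mono_zero : κ.mono (MonoIdx.zero κ.deg) = 1 := by
  simp [mono, MonoIdx.zero]

theorem _root_.MonoIdx.total_zero {r : ℕ} (deg : Fin r → ℕ) : (MonoIdx.zero deg).total = 0 := by
  simp [MonoIdx.total, MonoIdx.zero]

theorem le_total (I : MonoIdx κ.deg) (j : Fin κ.r) : I.1 j ≤ I.total :=
  (Nat.le_mul_of_pos_right _ (κ.deg_pos j)).trans
    (Finset.single_le_sum (f := fun j => I.1 j * κ.deg j) (fun _ _ => Nat.zero_le _)
      (Finset.mem_univ j))

theorem eq_zero_of_total {I : MonoIdx κ.deg} (h : I.total = 0) : I = MonoIdx.zero κ.deg :=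
  Subtype.ext (funext fun j => Nat.le_zero.1 (h ▸ κ.le_total I j))

instance finite_total_le (R : ℕ) : Finite {I : MonoIdx κ.deg // I.total ≤ R} := by
  refine Finite.of_injective
    (fun I : {I : MonoIdx κ.deg // I.total ≤ R} => fun j : Fin κ.r =>
      (⟨I.1.1 j, Nat.lt_succ_of_le ((κ.le_total I.1 j).trans I.2)⟩ : Fin (R + 1))) ?_
  intro I J h
  refine Subtype.ext (Subtype.ext (funext fun j => ?_))
  exact congrArg Fin.val (congrFun h j)

/-- The exponents of the monomials of degree at most `R`. -/
abbrev Idx (R : ℕ) : Type := {I : MonoIdx κ.deg // I.total ≤ R}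

instance (R : ℕ) : Fintype (κ.Idx R) := Fintype.ofFinite _

/-- A section of degree `i` has only coefficients of degree `i`. -/
theorem coeff_of_mem_ne {W : Opens X.B} {i : ℕ} {a : X.O W} (ha : a ∈ X.gr W i)
    {I : MonoIdx κ.deg} (hI : I.total ≠ i) (x : X.B) : κ.coeff a I x = 0 := by
  classical
  by_cases hx : x ∈ W ⊓ κ.V
  · obtain ⟨c, hc⟩ := κ.exists_poly (inf_le_right : W ⊓ κ.V ≤ κ.V) (X.res inf_le_left a)
    have hmem : ∀ I (f : X.gr (W ⊓ κ.V) 0),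
        (f : X.O (W ⊓ κ.V)) * X.res inf_le_right (κ.mono I) ∈ X.gr (W ⊓ κ.V) I.total := by
      intro I f
      have := SetLike.mul_mem_graded f.2
        (X.res_mem (inf_le_right : W ⊓ κ.V ≤ κ.V) _ _ (κ.mono_mem I))
      simpa using this
    -- Projection to degree `i` discards the monomials of other degrees and fixes `a`; uniqueness of
    -- the expansion then makes the filtered polynomial the expansion of `a`.
    have hc2 : X.res inf_le_left a =
        κ.poly (inf_le_right : W ⊓ κ.V ≤ κ.V) (c.filter fun I => I.total = i) := by
      have h2 := congrArg (comp i) hc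
      rw [comp_of_mem (X.res_mem _ _ _ ha)] at h2
      rw [h2]
      unfold poly
      rw [Finsupp.sum, comp_sum, Finsupp.sum_filter_index, Finsupp.support_filter,
        Finset.sum_filter]
      refine Finset.sum_congr rfl fun I _ => ?_
      split_ifs with h
      · exact comp_of_mem (h ▸ hmem I (c I))
      · exact comp_of_mem_ne (hmem I (c I)) h
    rw [κ.coeff_eq _ _ _ _ hc2 I hx,
      Finsupp.filter_apply_neg (fun I : MonoIdx κ.deg => I.total = i) c hI]
    simp
  · exact coeff_eq_zero_of_notMem _ _ _ hx

theorem coeff_of_mem_degZ_ne {W : Opens X.B} {i : ℤ} {a : X.O W} (ha : a ∈ X.degZ W i)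
    {I : MonoIdx κ.deg} (hI : (I.total : ℤ) ≠ i) (x : X.B) : κ.coeff a I x = 0 := by
  rcases mem_degZ_cases ha with rfl | ⟨n, rfl, ha⟩
  · exact κ.coeff_zero I x
  · exact κ.coeff_of_mem_ne ha (fun h => hI (by exact_mod_cast h)) x

/-- A functional which is linear over the functions of degree zero, evaluated at a point, is
determined by its values on the monomials. -/
theorem functional_eq {D : Opens X.B} (hD : D ≤ κ.V) {x : X.B} (hx : x ∈ D) (Φ : X.O D →+ 𝕜)
    (hΦ : ∀ f ∈ X.gr D 0, ∀ b, Φ (f * b) = X.val D f ⟨x, hx⟩ * Φ b) (a : X.O D)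
    (s : Finset (MonoIdx κ.deg))
    (hs : ∀ I ∉ s, κ.coeff a I x * Φ (X.res hD (κ.mono I)) = 0) :
    Φ a = ∑ I ∈ s, κ.coeff a I x * Φ (X.res hD (κ.mono I)) := by
  classical
  obtain ⟨c, hc⟩ := κ.exists_poly hD a
  have hco : ∀ I, κ.coeff a I x = X.val D (c I) ⟨x, hx⟩ := fun I =>
    κ.coeff_eq a le_rfl hD c (by rw [X.res_refl, hc]) I hx
  have h1 : Φ a = ∑ I ∈ c.support, κ.coeff a I x * Φ (X.res hD (κ.mono I)) := by
    conv_lhs => rw [hc]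
    rw [poly, Finsupp.sum, map_sum]
    refine Finset.sum_congr rfl fun I _ => ?_
    rw [hΦ _ (c I).2, hco]
  rw [h1]
  have h2 : ∀ I ∉ c.support, κ.coeff a I x * Φ (X.res hD (κ.mono I)) = 0 := by
    intro I hI
    rw [hco, Finsupp.notMem_support_iff.1 hI]
    simp
  -- Neither index set need contain the other; both sums are extended by zero terms to the union.
  rw [Finset.sum_subset (Finset.subset_union_left : c.support ⊆ c.support ∪ s) fun I _ h => h2 I h,
    Finset.sum_subset (Finset.subset_union_right : s ⊆ c.support ∪ s) fun I _ h => hs I h]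

/-- Evaluation at a point kills every monomial of positive degree, so in `functional_eq` only the
constant monomial survives. -/
theorem val_eq_coeff {W : Opens X.B} (a : X.O W) {x : X.B} (hx : x ∈ W) (hx' : x ∈ κ.V) :
    X.val W a ⟨x, hx⟩ = κ.coeff a (MonoIdx.zero κ.deg) x := by
  classical
  set D := W ⊓ κ.V
  have hxD : x ∈ D := ⟨hx, hx'⟩
  let Φ : X.O D →+ 𝕜 :=
    { toFun := fun b => X.val D b ⟨x, hxD⟩
      map_zero' := by simp
      map_add' := by simp }
  have h := κ.functional_eq (inf_le_right : D ≤ κ.V) hxD Φ (fun f _ b => by simp [Φ, D])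
    (X.res inf_le_left a) {MonoIdx.zero κ.deg} (by
      intro I hI
      have hp : 0 < I.total := Nat.pos_of_ne_zero fun h =>
        hI (Finset.mem_singleton.2 (κ.eq_zero_of_total h))
      have := X.val_pos D _ _ hp (X.res_mem (inf_le_right : D ≤ κ.V) _ _ (κ.mono_mem I))
      simp [Φ, this])
  rw [Finset.sum_singleton, mono_zero, κ.coeff_res _ _ _ hxD] at h
  simpa [Φ, X.val_res] using h

theorem coeff_contMDiffOn {W : Opens X.B} (a : X.O W) (I : MonoIdx κ.deg) :
    ContMDiffOn (𝓡 X.n) 𝓘(ℝ, 𝕜) ∞ (κ.coeff a I) ((W ⊓ κ.V : Opens X.B) : Set X.B) := by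
  obtain ⟨c, hc⟩ := κ.exists_poly (inf_le_right : W ⊓ κ.V ≤ κ.V) (X.res inf_le_left a)
  have h1 : ContMDiff (𝓡 X.n) 𝓘(ℝ, 𝕜) ∞ (X.val (W ⊓ κ.V) (c I)) :=
    (X.val_range _ _).1 ⟨_, (c I).2, rfl⟩
  have h2 : X.val (W ⊓ κ.V) (c I) = fun x : (W ⊓ κ.V : Opens X.B) => κ.coeff a I x :=
    funext fun x => (κ.coeff_eq _ _ _ c hc I x.2).symm
  rw [h2] at h1
  intro x hx
  exact (contMDiffAt_subtype_iff.1 (h1 ⟨x, hx⟩)).contMDiffWithinAt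

end Coords

end GradedSpace

/-! ### Products in coordinates and truncated matrix representations -/

namespace GradedSpace

variable {𝕜 : Type k} [RCLike 𝕜] {X : GradedSpace.{u} 𝕜}

theorem gr_zero_comm {V : Opens X.B} {f : X.O V} (hf : f ∈ X.gr V 0) (b : X.O V) :
    f * b = b * f := by
  induction b using homogeneous_induction with
  | zero => simp
  | add a b ha hb => rw [mul_add, add_mul, ha, hb]
  | hom i b hb => simpa using X.gradedComm V 0 i f b hf hb

namespace Coords

variable (κ : X.Coords)

/-- A functional that sees only degrees up to `R` is a sum over an index set independent of the
section. A fixed finite sum is what later allows termwise integration and differentiation in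
families. -/
theorem functional_eq_idx {D : Opens X.B} (hD : D ≤ κ.V) {x : X.B} (hx : x ∈ D) (Φ : X.O D →+ 𝕜)
    (hΦ : ∀ f ∈ X.gr D 0, ∀ b, Φ (f * b) = X.val D f ⟨x, hx⟩ * Φ b) (R : ℕ)
    (hR : ∀ I : MonoIdx κ.deg, R < I.total → Φ (X.res hD (κ.mono I)) = 0) (a : X.O D) :
    Φ a = ∑ M : κ.Idx R, κ.coeff a M.1 x * Φ (X.res hD (κ.mono M.1)) := by
  classical
  rw [κ.functional_eq hD hx Φ hΦ a 
    ((Finset.univ : Finset (κ.Idx R)).map (Function.Embedding.subtype _))]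
  · rw [Finset.sum_map]
    rfl
  · intro I hI
    rw [hR I, mul_zero]
    by_contra h
    exact hI (Finset.mem_map.2 ⟨⟨I, not_lt.1 h⟩, Finset.mem_univ _, rfl⟩)

/-- Change of coordinates. -/
theorem coeff_change (κ' : X.Coords) {W : Opens X.B} (a : X.O W) (I' : MonoIdx κ'.deg) {x : X.B}
    (hx : x ∈ W) (hκ : x ∈ κ.V) (R : ℕ) (hR : I'.total ≤ R) :
    κ'.coeff a I' x = ∑ M : κ.Idx R, κ.coeff a M.1 x * κ'.coeff (κ.mono M.1) I' x := by
  set D := W ⊓ κ.V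
  have hxD : x ∈ D := ⟨hx, hκ⟩
  have h := κ.functional_eq_idx (inf_le_right : D ≤ κ.V) hxD (κ'.coeffL D I' x).toAddMonoidHom
    (fun f hf b => κ'.coeff_fun_mul hf b I' hxD) R
    (fun I hI => κ'.coeff_of_mem_ne (X.res_mem _ _ _ (κ.mono_mem I)) (by omega) x)
    (X.res inf_le_left a)
  simp only [LinearMap.toAddMonoidHom_coe, coeffL, LinearMap.coe_mk, AddHom.coe_mk] at h
  simpa only [κ'.coeff_res _ _ _ hxD, κ.coeff_res _ _ _ hxD] using h

/-- Degrees are non-negative, so a multiple of `m` has no component below the degree of `m`. This is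
why truncation in the degree is compatible with products. -/
theorem coeff_mul_eq_zero {D : Opens X.B} (a : X.O D) {m : X.O D} {i : ℕ} (hm : m ∈ X.gr D i)
    (K : MonoIdx κ.deg) (hK : K.total < i) (x : X.B) : κ.coeff (a * m) K x = 0 := by
  induction a using homogeneous_induction with
  | zero => rw [zero_mul, coeff_zero]
  | add a b ha hb => rw [add_mul, coeff_add, ha, hb, add_zero]
  | hom j a ha => exact κ.coeff_of_mem_ne (SetLike.mul_mem_graded ha hm) (by omega) x

/-- Expansion of the second factor of a product. -/
theorem coeff_mul_right {D : Opens X.B} (hD : D ≤ κ.V) (a b : X.O D) (K : MonoIdx κ.deg) {x : X.B}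
    (hx : x ∈ D) (R : ℕ) (hR : K.total ≤ R) :
    κ.coeff (a * b) K x =
      ∑ M : κ.Idx R, κ.coeff b M.1 x * κ.coeff (a * X.res hD (κ.mono M.1)) K x := by
  let Φ : X.O D →+ 𝕜 :=
    { toFun := fun b => κ.coeff (a * b) K x
      map_zero' := by rw [mul_zero, coeff_zero]
      map_add' := fun b c => by rw [mul_add, coeff_add] }
  refine κ.functional_eq_idx hD hx Φ (fun f hf b => ?_) R (fun I hI => ?_) b
  · change κ.coeff (a * (f * b)) K x = _ * κ.coeff (a * b) K x
    rw [← mul_assoc, ← gr_zero_comm hf, mul_assoc, κ.coeff_fun_mul hf]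
  · exact κ.coeff_mul_eq_zero a (X.res_mem _ _ _ (κ.mono_mem I)) K (by omega) x

/-- Expansion of the first factor of a product. -/
theorem coeff_mul_left {D : Opens X.B} (hD : D ≤ κ.V) (a b : X.O D) (K : MonoIdx κ.deg) {x : X.B}
    (hx : x ∈ D) (R : ℕ) (hb : ∀ I : MonoIdx κ.deg, R < I.total →
      κ.coeff (X.res hD (κ.mono I) * b) K x = 0) :
    κ.coeff (a * b) K x =
      ∑ M : κ.Idx R, κ.coeff a M.1 x * κ.coeff (X.res hD (κ.mono M.1) * b) K x := by
  let Φ : X.O D →+ 𝕜 :=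
    { toFun := fun a => κ.coeff (a * b) K x
      map_zero' := by rw [zero_mul, coeff_zero]
      map_add' := fun b c => by rw [add_mul, coeff_add] }
  refine κ.functional_eq_idx hD hx Φ (fun f hf b' => ?_) R hb a
  change κ.coeff (f * b' * b) K x = _ * κ.coeff (b' * b) K x
  rw [mul_assoc, κ.coeff_fun_mul hf]

/-- The structure constants of the multiplication of monomials. -/
def structConst (M N K : MonoIdx κ.deg) (x : X.B) : 𝕜 := κ.coeff (κ.mono M * κ.mono N) K x

theorem structConst_contMDiffOn (M N K : MonoIdx κ.deg) :
    ContMDiffOn (𝓡 X.n) 𝓘(ℝ, 𝕜) ∞ (κ.structConst M N K) (κ.V : Set X.B) := by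
  have h := κ.coeff_contMDiffOn (κ.mono M * κ.mono N) K
  rwa [inf_idem] at h

theorem structConst_eq_zero (M N K : MonoIdx κ.deg) (x : X.B) (h : M.total + N.total ≠ K.total) :
    κ.structConst M N K x = 0 :=
  κ.coeff_of_mem_ne (SetLike.mul_mem_graded (κ.mono_mem M) (κ.mono_mem N)) (by omega) x

/-- The product with a monomial in terms of structure constants. -/
theorem coeff_mul_mono {D : Opens X.B} (hD : D ≤ κ.V) (a : X.O D) (J K : MonoIdx κ.deg) {x : X.B}
    (hx : x ∈ D) (R : ℕ) (hR : K.total ≤ R) :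
    κ.coeff (a * X.res hD (κ.mono J)) K x =
      ∑ M : κ.Idx R, κ.coeff a M.1 x * κ.structConst M.1 J K x := by
  rw [κ.coeff_mul_left hD a _ K hx R]
  · refine Finset.sum_congr rfl fun M _ => ?_
    rw [← map_mul, κ.coeff_res _ _ _ hx]
    rfl
  · intro I hI
    rw [← map_mul, κ.coeff_res _ _ _ hx]
    exact κ.structConst_eq_zero I J K x (by omega)

/-- The product in terms of structure constants. -/
theorem coeff_mul {W : Opens X.B} (a b : X.O W) (K : MonoIdx κ.deg) {x : X.B}
    (hx : x ∈ W) (hκ : x ∈ κ.V) (R : ℕ) (hR : K.total ≤ R) :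
    κ.coeff (a * b) K x = ∑ N : κ.Idx R, ∑ M : κ.Idx R,
      κ.coeff a M.1 x * κ.coeff b N.1 x * κ.structConst M.1 N.1 K x := by
  have hxD : x ∈ W ⊓ κ.V := ⟨hx, hκ⟩
  rw [← κ.coeff_res (inf_le_left : W ⊓ κ.V ≤ W) _ _ hxD, map_mul,
    κ.coeff_mul_right inf_le_right _ _ K hxD R hR]
  refine Finset.sum_congr rfl fun N _ => ?_
  rw [κ.coeff_mul_mono _ _ _ _ hxD R hR, Finset.mul_sum]
  refine Finset.sum_congr rfl fun M _ => ?_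
  rw [κ.coeff_res _ _ _ hxD, κ.coeff_res _ _ _ hxD]
  ring

/-- The matrix, at the point `x` and up to the degree `R`, of the left multiplication by a matrix
of sections. -/
def rep (R : ℕ) (x : X.B) {V : Opens X.B} {m n : Type*} (A : Matrix m n (X.O V)) :
    Matrix (m × κ.Idx R) (n × κ.Idx R) 𝕜 := fun p q =>
  κ.coeff (X.res (inf_le_left : V ⊓ κ.V ≤ V) (A p.1 q.1) *
    X.res (inf_le_right : V ⊓ κ.V ≤ κ.V) (κ.mono q.2.1)) p.2.1 x

variable {κ} {R : ℕ} {x : X.B} {V : Opens X.B} {m n o : Type*}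

theorem rep_apply (hx : x ∈ V) (hκ : x ∈ κ.V) (A : Matrix m n (X.O V)) (p : m × κ.Idx R)
    (q : n × κ.Idx R) : κ.rep R x A p q =
      ∑ M : κ.Idx R, κ.coeff (A p.1 q.1) M.1 x * κ.structConst M.1 q.2.1 p.2.1 x := by
  have hxD : x ∈ V ⊓ κ.V := ⟨hx, hκ⟩
  rw [rep, κ.coeff_mul_mono _ _ _ _ hxD R p.2.2]
  simp only [κ.coeff_res _ _ _ hxD]

/-- The index of the constant monomial. -/
def zeroIdx (κ : X.Coords) (R : ℕ) : κ.Idx R :=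
  ⟨MonoIdx.zero κ.deg, by rw [MonoIdx.total_zero]; exact Nat.zero_le _⟩

/-- Applying multiplication by `A` to the constant monomial gives back the coefficients of `A`: the
representation loses nothing up to degree `R`. -/
theorem rep_apply_zero (hx : x ∈ V) (hκ : x ∈ κ.V) (A : Matrix m n (X.O V)) (p : m × κ.Idx R)
    (β : n) : κ.rep R x A p (β, κ.zeroIdx R) = κ.coeff (A p.1 β) p.2.1 x := by
  have hxD : x ∈ V ⊓ κ.V := ⟨hx, hκ⟩
  rw [rep]
  have : κ.mono (κ.zeroIdx R).1 = 1 := κ.mono_zero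
  rw [this, map_one, mul_one, κ.coeff_res _ _ _ hxD]

theorem rep_add (A B : Matrix m n (X.O V)) : κ.rep R x (A + B) = κ.rep R x A + κ.rep R x B := by
  ext p q
  simp only [rep, Matrix.add_apply, map_add, add_mul, coeff_add]

theorem rep_sub (A B : Matrix m n (X.O V)) : κ.rep R x (A - B) = κ.rep R x A - κ.rep R x B := by
  ext p q
  simp only [rep, Matrix.sub_apply, map_sub, sub_mul, coeff_sub]

theorem rep_neg (A : Matrix m n (X.O V)) : κ.rep R x (-A) = -κ.rep R x A := by
  ext p q
  simp only [rep, Matrix.neg_apply, map_neg, neg_mul, coeff_neg]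

theorem rep_zero : κ.rep R x (0 : Matrix m n (X.O V)) = 0 := by
  ext p q
  simp only [rep, Matrix.zero_apply, map_zero, zero_mul, coeff_zero]

theorem rep_one [DecidableEq m] [DecidableEq (m × κ.Idx R)] (hx : x ∈ V) (hκ : x ∈ κ.V) :
    κ.rep R x (1 : Matrix m m (X.O V)) = 1 := by
  classical
  ext p q
  have hxD : x ∈ V ⊓ κ.V := ⟨hx, hκ⟩
  simp only [rep, Matrix.one_apply]
  by_cases h : p.1 = q.1
  · rw [if_pos h, map_one, one_mul, κ.coeff_res _ _ _ hxD, κ.coeff_mono _ _ hκ]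
    refine if_congr ⟨fun h2 => Prod.ext h (Subtype.ext h2.symm), fun h2 => by rw [h2]⟩ rfl rfl
  · rw [if_neg h, map_zero, zero_mul, coeff_zero, if_neg fun h2 => h (by rw [h2])]

/-- The sections without components of degree at most `R` form an ideal, so multiplication descends
to the truncated module, where composition is the product of matrices. Equations over the functions
on `L` thereby become equations between scalar matrices. -/
theorem rep_mul [Fintype n] (hx : x ∈ V) (hκ : x ∈ κ.V) (A : Matrix m n (X.O V))
    (B : Matrix n o (X.O V)) : κ.rep R x (A * B) = κ.rep R x A * κ.rep R x B := by
  ext p q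
  have hxD : x ∈ V ⊓ κ.V := ⟨hx, hκ⟩
  rw [Matrix.mul_apply, Fintype.sum_prod_type, rep, Matrix.mul_apply, map_sum, Finset.sum_mul,
    coeff_sum]
  refine Finset.sum_congr rfl fun γ _ => ?_
  rw [map_mul, mul_assoc, κ.coeff_mul_right inf_le_right _ _ _ hxD R p.2.2]
  exact Finset.sum_congr rfl fun M _ => mul_comm _ _

end Coords

end GradedSpace

/-! ### Sections and their coefficients: uniqueness and reconstruction -/

namespace NQManifold

open GradedSpace

variable {𝕜 : Type k} [RCLike 𝕜] {L : NQManifold.{v} 𝕜} {V : Opens L.B}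

/-- A section is determined by its coefficients. -/
theorem ext_coeff {a b : L.O V} (h : ∀ (κ : L.Coords) (I : MonoIdx κ.deg), ∀ x ∈ V, x ∈ κ.V →
    κ.coeff a I x = κ.coeff b I x) : a = b := by
  refine ext_local fun y hy => ?_
  obtain ⟨κ, hκ⟩ := L.locally_free y
  refine ⟨V ⊓ κ.V, inf_le_left, ⟨hy, hκ⟩, ?_⟩
  obtain ⟨c, hc⟩ := κ.exists_poly (inf_le_right : V ⊓ κ.V ≤ κ.V) (L.res inf_le_left a)
  obtain ⟨d, hd⟩ := κ.exists_poly (inf_le_right : V ⊓ κ.V ≤ κ.V) (L.res inf_le_left b)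
  have : c = d := by
    refine Finsupp.ext fun I => Subtype.ext (sub_eq_zero.1 (L.val_inj _ _ ?_ ?_))
    · exact Submodule.sub_mem _ (c I).2 (d I).2
    · ext x
      rw [map_sub, Pi.sub_apply, Pi.zero_apply, sub_eq_zero,
        ← κ.coeff_eq a inf_le_left inf_le_right c hc I x.2,
        ← κ.coeff_eq b inf_le_left inf_le_right d hd I x.2]
      exact h κ I x x.2.1 x.2.2
  rw [hc, hd, this]

/-- A section of degree `i` with prescribed smooth coefficients, which transform in the right way
under changes of coordinates. -/
theorem exists_of_coeff (i : ℕ) (c : ∀ κ : L.Coords, MonoIdx κ.deg → L.B → 𝕜)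
    (smooth : ∀ κ I, ContMDiffOn (𝓡 L.n) 𝓘(ℝ, 𝕜) ∞ (c κ I) ((V ⊓ κ.V : Opens L.B) : Set L.B))
    (deg : ∀ κ I, ∀ x ∈ V, x ∈ κ.V → I.total ≠ i → c κ I x = 0)
    (compat : ∀ (κ κ' : L.Coords) (I' : MonoIdx κ'.deg), ∀ x ∈ V, x ∈ κ.V → x ∈ κ'.V →
      I'.total = i → c κ' I' x = ∑ M : κ.Idx i, c κ M.1 x * κ'.coeff (κ.mono M.1) I' x) :
    ∃ a ∈ L.gr V i, ∀ (κ : L.Coords) (I : MonoIdx κ.deg), ∀ x ∈ V, x ∈ κ.V →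
      κ.coeff a I x = c κ I x := by
  classical
  choose κ hκ using L.locally_free
  have hf : ∀ y (I : MonoIdx (κ y).deg), ∃ f ∈ L.gr (V ⊓ (κ y).V) 0,
      L.val _ f = fun x : (V ⊓ (κ y).V : Opens L.B) => c (κ y) I x := by
    intro y I
    rw [L.val_range]
    intro x
    exact contMDiffAt_subtype_iff.2 ((smooth (κ y) I).contMDiffAt
      ((V ⊓ (κ y).V).isOpen.mem_nhds x.2))
  choose f hf0 hfv using hf
  -- The local candidate around `y` is the polynomial with the prescribed coefficients in one chosen
  -- coordinate system; only monomials of degree exactly `i` are kept.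
  let s : ∀ y : V, L.O (V ⊓ (κ y).V) := fun y =>
    ∑ M : (κ y).Idx i, if M.1.total = i then
      f y M.1 * L.res (inf_le_right : V ⊓ (κ y).V ≤ (κ y).V) ((κ y).mono M.1) else 0
  have hs : ∀ y, s y ∈ L.gr _ i := by
    intro y
    refine Submodule.sum_mem _ fun M _ => ?_
    split_ifs with h
    · have := SetLike.mul_mem_graded (hf0 y M.1)
        (L.res_mem (inf_le_right : V ⊓ (κ y).V ≤ (κ y).V) _ _ ((κ y).mono_mem M.1))
      rwa [zero_add, h] at this
    · exact zero_mem _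
  -- By the transformation rule a local candidate has the prescribed coefficients in every
  -- coordinate system, not only in its own; hence the candidates agree on overlaps.
  have hco : ∀ (y : V) (κ' : L.Coords) (I' : MonoIdx κ'.deg), ∀ x ∈ V, x ∈ (κ y).V → x ∈ κ'.V →
      κ'.coeff (s y) I' x = c κ' I' x := by
    intro y κ' I' x hx hxy hx'
    have hxD : x ∈ V ⊓ (κ y).V := ⟨hx, hxy⟩
    by_cases hI : I'.total = i
    · rw [compat (κ y) κ' I' x hx hxy hx' hI, κ'.coeff_sum]
      refine Finset.sum_congr rfl fun M _ => ?_
      split_ifs with hM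
      · rw [κ'.coeff_fun_mul (hf0 y M.1) _ _ hxD, hfv, κ'.coeff_res _ _ _ hxD]
      · rw [κ'.coeff_zero, κ'.coeff_of_mem_ne ((κ y).mono_mem M.1) (by omega), mul_zero]
    · rw [deg κ' I' x hx hx' hI, κ'.coeff_of_mem_ne (hs y) hI]
  obtain ⟨a, ⟨ha, har⟩, -⟩ := exists_glue (V := V) i (fun y => V ⊓ (κ y).V)
    (fun y => inf_le_left) (fun y => ⟨y.2, hκ y⟩) s hs (by
      intro y z
      refine ext_coeff fun κ' I x hx hx' => ?_
      rw [κ'.coeff_res _ _ _ hx, κ'.coeff_res _ _ _ hx, hco y κ' I x hx.1.1 hx.1.2 hx',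
        hco z κ' I x hx.1.1 hx.2.2 hx'])
  refine ⟨a, ha, fun κ' I x hx hx' => ?_⟩
  have hxD : x ∈ V ⊓ (κ x).V := ⟨hx, hκ x⟩
  rw [← κ'.coeff_res (inf_le_left : V ⊓ (κ x).V ≤ V) a I hxD, har ⟨x, hx⟩,
    hco ⟨x, hx⟩ κ' I x hx (hκ x) hx']

end NQManifold

/-! ### Smooth families of continuous functions, and Volterra equations -/

/-- The Banach space of the continuous functions on a compact space. -/
def CFun (T F : Type*) [TopologicalSpace T] [NormedAddCommGroup F] : Type _ :=
  BoundedContinuousFunction T F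

namespace CFun

section Basic

variable {T : Type*} [TopologicalSpace T] {F : Type*} [NormedAddCommGroup F]

instance : NormedAddCommGroup (CFun T F) :=
  inferInstanceAs (NormedAddCommGroup (BoundedContinuousFunction T F))

instance [NormedSpace ℝ F] : NormedSpace ℝ (CFun T F) :=
  inferInstanceAs (NormedSpace ℝ (BoundedContinuousFunction T F))

instance [CompleteSpace F] : CompleteSpace (CFun T F) :=
  inferInstanceAs (CompleteSpace (BoundedContinuousFunction T F))

instance : FunLike (CFun T F) T F := inferInstanceAs (FunLike (BoundedContinuousFunction T F) T F)

@[ext] theorem ext {u v : CFun T F} (h : ∀ t, u t = v t) : u = v :=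
  BoundedContinuousFunction.ext (f := u) (g := v) h

@[simp] theorem add_apply (u v : CFun T F) (t : T) : (u + v) t = u t + v t := rfl

@[simp] theorem neg_apply (u : CFun T F) (t : T) : (-u) t = -u t := rfl

@[simp] theorem sub_apply (u v : CFun T F) (t : T) : (u - v) t = u t - v t := rfl

@[simp] theorem zero_apply (t : T) : (0 : CFun T F) t = 0 := rfl

@[simp] theorem smul_apply [NormedSpace ℝ F] (r : ℝ) (u : CFun T F) (t : T) :
    (r • u) t = r • u t := rfl

@[fun_prop] theorem continuous (u : CFun T F) : Continuous u :=
  BoundedContinuousFunction.continuous (show BoundedContinuousFunction T F from u)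

theorem norm_coe_le_norm (u : CFun T F) (t : T) : ‖u t‖ ≤ ‖u‖ :=
  BoundedContinuousFunction.norm_coe_le_norm (show BoundedContinuousFunction T F from u) t

theorem norm_le {u : CFun T F} {C : ℝ} (hC : 0 ≤ C) : ‖u‖ ≤ C ↔ ∀ t, ‖u t‖ ≤ C :=
  BoundedContinuousFunction.norm_le (f := (show BoundedContinuousFunction T F from u)) hC

/-- The evaluation at a point. -/
def evalL [NormedSpace ℝ F] (t : T) : CFun T F →L[ℝ] F :=
  LinearMap.mkContinuous
    { toFun := fun u => u t
      map_add' := fun _ _ => rfl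
      map_smul' := fun _ _ => rfl } 1 fun u => by
    rw [one_mul]
    exact u.norm_coe_le_norm t

@[simp] theorem evalL_apply [NormedSpace ℝ F] (t : T) (u : CFun T F) : evalL t u = u t := rfl

@[simp] theorem sum_apply [NormedSpace ℝ F] {J : Type*} (s : Finset J) (f : J → CFun T F) (t : T) :
    (∑ j ∈ s, f j) t = ∑ j ∈ s, f j t := map_sum (evalL t) f s

variable [CompactSpace T]

/-- A continuous function on a compact space. -/
def mk (f : T → F) (hf : Continuous f) : CFun T F :=
  BoundedContinuousFunction.mkOfCompact ⟨f, hf⟩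

@[simp] theorem mk_apply (f : T → F) (hf : Continuous f) (t : T) : mk f hf t = f t := rfl

theorem continuous_of_uncurry {X : Type*} [TopologicalSpace X] (u : X → CFun T F)
    (h : Continuous fun q : X × T => u q.1 q.2) : Continuous u := by
  have h1 : Continuous fun x => (⟨fun t => u x t, (u x).continuous⟩ : C(T, F)) :=
    ContinuousMap.continuous_of_continuous_uncurry _ h
  exact (ContinuousMap.isometryEquivBoundedOfCompact T F).isometry.continuous.comp h1

end Basic

/-! ### Currying: jointly smooth functions as smooth maps into continuous functions -/

section Curry

variable {T : Type*} [TopologicalSpace T] [CompactSpace T]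
variable {P : Type*} [NormedAddCommGroup P] [NormedSpace ℝ P]
variable {E₁ : Type*} [NormedAddCommGroup E₁] [NormedSpace ℝ E₁]
variable {F : Type*} [NormedAddCommGroup F] [NormedSpace ℝ F]
variable {G : Type*} [NormedAddCommGroup G] [NormedSpace ℝ G]

/-- The pointwise application of a continuous family of operators, as a bilinear map. -/
def applyₗ : CFun T (F →L[ℝ] G) →ₗ[ℝ] CFun T F →ₗ[ℝ] CFun T G :=
  LinearMap.mk₂ ℝ (fun A u => mk (fun t => A t (u t)) (by fun_prop))
    (fun A B u => by ext; simp) (fun r A u => by ext; simp) (fun A u v => by ext; simp)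
    (fun r A u => by ext; simp)

/-- The pointwise application of a continuous family of operators. -/
def applyL : CFun T (F →L[ℝ] G) →L[ℝ] CFun T F →L[ℝ] CFun T G :=
  applyₗ.mkContinuous₂ 1 fun A u => by
    rw [one_mul]
    refine (norm_le (mul_nonneg (norm_nonneg A) (norm_nonneg _))).2 fun t => ?_
    exact (A t).le_of_opNorm_le_of_le (A.norm_coe_le_norm t) (u.norm_coe_le_norm t)

@[simp] theorem applyL_apply (A : CFun T (F →L[ℝ] G)) (u : CFun T F) (t : T) :
    applyL A u t = A t (u t) := rfl

/-- A continuous family of operators as an operator into continuous functions. -/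
def swapL : CFun T (P →L[ℝ] F) →L[ℝ] P →L[ℝ] CFun T F :=
  (LinearMap.mk₂ ℝ (fun (A : CFun T (P →L[ℝ] F)) (p : P) => mk (fun t => A t p) (by fun_prop))
    (fun A B u => by ext; simp) (fun r A u => by ext; simp) (fun A u v => by ext; simp)
    (fun r A u => by ext; simp)).mkContinuous₂ 1 fun A p => by
    rw [one_mul]
    refine (norm_le (mul_nonneg (norm_nonneg A) (norm_nonneg _))).2 fun t => ?_
    exact (A t).le_of_opNorm_le (A.norm_coe_le_norm t) p

@[simp] theorem swapL_apply (A : CFun T (P →L[ℝ] F)) (p : P) (t : T) : swapL A p t = A t p := rfl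

/-- Compactness of `T` makes the derivatives at nearby points uniformly close to those at `p₀`; the
mean value inequality on the convex set `Ω ∩ ball` turns this into a remainder estimate uniform in
`t`, which is an estimate in the sup norm. -/
theorem hasFDerivWithinAt_curry {Ω : Set P} (hΩ : Convex ℝ Ω) {p₀ : P} (hp₀ : p₀ ∈ Ω)
    {f : T → P → F} {f' : T → P → P →L[ℝ] F}
    (hf : ∀ t, ∀ p ∈ Ω, HasFDerivWithinAt (f t) (f' t p) Ω p)
    (hcont : ContinuousOn (fun q : T × P => f' q.1 q.2) (Set.univ ×ˢ Ω)) {u : P → CFun T F}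
    (hu : ∀ p ∈ Ω, ∀ t, u p t = f t p) {u' : CFun T (P →L[ℝ] F)} (hu' : ∀ t, u' t = f' t p₀) :
    HasFDerivWithinAt u (swapL u') Ω p₀ := by
  refine .of_isLittleO (Asymptotics.isLittleO_iff.2 fun ε hε => ?_)
  have h1 : ∀ᶠ p in 𝓝 p₀, ∀ t ∈ (Set.univ : Set T), p ∈ Ω → ‖f' t p - f' t p₀‖ ≤ ε := by
    refine isCompact_univ.eventually_forall_of_forall_eventually fun t _ => ?_
    have h2 := hcont (t, p₀) ⟨Set.mem_univ _, hp₀⟩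
    have h4 : ContinuousWithinAt (fun z : P × T => f' z.2 p₀) (Ω ×ˢ Set.univ) (p₀, t) :=
      ContinuousWithinAt.comp (f := fun z : P × T => ((z.2, p₀) : T × P)) (t := Set.univ ×ˢ Ω)
        (x := (p₀, t)) h2 (by fun_prop) (fun z _ => ⟨Set.mem_univ _, hp₀⟩)
    have h5 : ContinuousWithinAt (fun z : P × T => f' z.2 z.1) (Ω ×ˢ Set.univ) (p₀, t) :=
      ContinuousWithinAt.comp (f := fun z : P × T => ((z.2, z.1) : T × P)) (t := Set.univ ×ˢ Ω)
        (x := (p₀, t)) h2 (by fun_prop) (fun z hz => ⟨Set.mem_univ _, hz.1⟩)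
    have h6 : Filter.Tendsto (fun z : P × T => ‖f' z.2 z.1 - f' z.2 p₀‖)
        (𝓝[Ω ×ˢ Set.univ] (p₀, t)) (𝓝 0) := by
      have := (h5.sub h4).norm
      unfold ContinuousWithinAt at this
      simpa using this
    have h7 := h6.eventually (Iic_mem_nhds hε)
    rw [eventually_nhdsWithin_iff] at h7
    filter_upwards [h7] with z hz hzΩ using hz ⟨hzΩ, Set.mem_univ _⟩
  obtain ⟨δ, hδ, hball⟩ := Metric.eventually_nhds_iff_ball.1 h1
  filter_upwards [self_mem_nhdsWithin, mem_nhdsWithin_of_mem_nhds (Metric.ball_mem_nhds p₀ hδ)]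
    with p hp hpb
  rw [norm_le (by positivity)]
  intro t
  have key := Convex.norm_image_sub_le_of_norm_hasFDerivWithin_le' (𝕜 := ℝ)
    (s := Ω ∩ Metric.ball p₀ δ) (f := f t) (f' := f' t) (φ := f' t p₀) (C := ε) (x := p₀) (y := p)
    (fun q hq => (hf t q hq.1).mono Set.inter_subset_left)
    (fun q hq => hball q hq.2 t (Set.mem_univ _) hq.1) (hΩ.inter (convex_ball _ _))
    ⟨hp₀, Metric.mem_ball_self hδ⟩ ⟨hp, hpb⟩
  simpa [hu p hp, hu p₀ hp₀, hu'] using key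

/-- Induction on the order: the derivative of the curried map is the curried partial derivative in
`p`, followed by `swapL`. The target changes from `F` to `P →L[ℝ] F`, so it is quantified inside the
induction, and `P` lies in the lowest universe to keep the universe of the target fixed. -/
theorem contDiffOn_curry_nat {P : Type} [NormedAddCommGroup P] [NormedSpace ℝ P] {S : Set E₁}
    (hS : UniqueDiffOn ℝ S) {Ω : Set P} (hΩ : Convex ℝ Ω)
    (hΩ' : UniqueDiffOn ℝ Ω) (γ : C(T, E₁)) (hγ : ∀ t, γ t ∈ S) (n : ℕ) :
    ∀ {F : Type v} [NormedAddCommGroup F] [NormedSpace ℝ F] (f : E₁ × P → F)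
      (_ : ContDiffOn ℝ n f (S ×ˢ Ω)) (u : P → CFun T F) (_ : ∀ p ∈ Ω, ∀ t, u p t = f (γ t, p)),
      ContDiffOn ℝ n u Ω := by
  have hcurry : ∀ {F : Type v} [NormedAddCommGroup F] [NormedSpace ℝ F] (f : E₁ × P → F)
      (_ : ContinuousOn f (S ×ˢ Ω)),
      ContinuousOn (fun q : T × P => f (γ q.1, q.2)) (Set.univ ×ˢ Ω) := fun f hf =>
    hf.comp (by fun_prop) fun q hq => ⟨hγ q.1, hq.2⟩
  induction n with
  | zero =>
    intro F _ _ f hf u hu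
    rw [Nat.cast_zero, contDiffOn_zero] at hf ⊢
    rw [continuousOn_iff_continuous_domRestrict]
    refine continuous_of_uncurry _ ?_
    have h1 : Continuous fun q : Ω × T => f (γ q.2, q.1) :=
      (hcurry f hf).comp_continuous (f := fun q : Ω × T => ((q.2, (q.1 : P)) : T × P))
        (by fun_prop) fun q => ⟨Set.mem_univ _, q.1.2⟩
    exact h1.congr fun q => (hu q.1 q.1.2 q.2).symm
  | succ n ih =>
    intro F _ _ f hf u hu
    rw [Nat.cast_add, Nat.cast_one] at hf ⊢
    rw [contDiffOn_succ_iff_fderivWithin (hS.prod hΩ')] at hf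
    rw [contDiffOn_succ_iff_hasFDerivWithinAt_of_uniqueDiffOn hΩ']
    refine ⟨fun h => absurd h (by simp), ?_⟩
    let g : E₁ × P → P →L[ℝ] F := fun q =>
      (fderivWithin ℝ f (S ×ˢ Ω) q).comp (ContinuousLinearMap.inr ℝ E₁ P)
    have hg : ContDiffOn ℝ n g (S ×ˢ Ω) := hf.2.2.clm_comp contDiffOn_const
    have hgc := hcurry g hg.continuousOn
    classical
    let u' : P → CFun T (P →L[ℝ] F) := fun p =>
      if hp : p ∈ Ω then mk (fun t => g (γ t, p)) (hgc.comp_continuous (by fun_prop)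
        (f := fun t : T => ((t, p) : T × P)) fun t => ⟨Set.mem_univ _, hp⟩) else 0
    have hu' : ∀ p ∈ Ω, ∀ t, u' p t = g (γ t, p) := fun p hp t => by simp [u', hp]
    have hsw : ContDiff ℝ n (swapL : CFun T (P →L[ℝ] F) → P →L[ℝ] CFun T F) :=
      ContinuousLinearMap.contDiff (swapL (T := T) (P := P) (F := F))
    refine ⟨fun p => swapL (u' p), hsw.comp_contDiffOn (ih g hg u' hu'), fun p hp => ?_⟩
    refine hasFDerivWithinAt_curry hΩ hp (f := fun t p => f (γ t, p))
      (f' := fun t p => g (γ t, p)) (fun t p hp => ?_) hgc hu (hu' p hp)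
    exact (hf.1 (γ t, p) ⟨hγ t, hp⟩).hasFDerivWithinAt.comp p
      (hasFDerivAt_prodMk_right (𝕜 := ℝ) (γ t) p).hasFDerivWithinAt fun q hq => ⟨hγ t, hq⟩

theorem contDiffOn_curry {P : Type} [NormedAddCommGroup P] [NormedSpace ℝ P] {S : Set E₁}
    (hS : UniqueDiffOn ℝ S) {Ω : Set P} (hΩ : Convex ℝ Ω)
    (hΩ' : UniqueDiffOn ℝ Ω) (γ : C(T, E₁)) (hγ : ∀ t, γ t ∈ S) {f : E₁ × P → F}
    (hf : ContDiffOn ℝ ∞ f (S ×ˢ Ω)) {u : P → CFun T F} (hu : ∀ p ∈ Ω, ∀ t, u p t = f (γ t, p)) :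
    ContDiffOn ℝ ∞ u Ω :=
  contDiffOn_infty.2 fun n =>
    contDiffOn_curry_nat hS hΩ hΩ' γ hγ n f (contDiffOn_infty.1 hf n) u hu

end Curry

/-! ### Inverting `1 - B` by the Neumann series -/

section Neumann

variable {E E' : Type*} [NormedAddCommGroup E] [NormedSpace ℝ E]
  [NormedAddCommGroup E'] [NormedSpace ℝ E']

/-- Summability of the powers replaces `‖B‖ < 1`: Volterra operators need not be contractions. -/
theorem exists_unit_one_sub {B : E →L[ℝ] E} (hs : Summable fun n : ℕ => B ^ n) :
    ∃ w : (E →L[ℝ] E)ˣ, (w : E →L[ℝ] E) = 1 - B ∧ Ring.inverse (1 - B) = ∑' n : ℕ, B ^ n := by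
  let w : (E →L[ℝ] E)ˣ :=
    ⟨1 - B, ∑' n, B ^ n, hs.one_sub_mul_tsum_pow, hs.tsum_pow_mul_one_sub⟩
  exact ⟨w, rfl, Ring.inverse_unit w⟩

theorem hasSum_inverse_one_sub_apply {B : E →L[ℝ] E} (hs : Summable fun n : ℕ => B ^ n) (c : E) :
    HasSum (fun n : ℕ => (B ^ n) c) (Ring.inverse (1 - B) c) := by
  obtain ⟨w, -, hw⟩ := exists_unit_one_sub hs
  rw [hw]
  exact (ContinuousLinearMap.apply ℝ _ c).hasSum hs.hasSum

theorem inverse_one_sub_apply_eq {B : E →L[ℝ] E} (hs : Summable fun n : ℕ => B ^ n) (c : E) :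
    Ring.inverse (1 - B) c = c + B (Ring.inverse (1 - B) c) := by
  obtain ⟨w, hw, -⟩ := exists_unit_one_sub hs
  have h1 : (1 - B) (Ring.inverse (1 - B) c) = c := by
    rw [← hw, Ring.inverse_unit, ← mul_apply_eq_comp, Units.mul_inv]
    rfl
  rw [← sub_eq_iff_eq_add]
  exact h1

/-- Inversion is smooth at the units of a Banach algebra, and `A ↦ 1 - Φ A` is affine with values in
the units. -/
theorem contDiff_inverse_one_sub_apply [CompleteSpace E] (Φ : E' →L[ℝ] E →L[ℝ] E)
    (hs : ∀ A, Summable fun n : ℕ => Φ A ^ n) (c : E) :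
    ContDiff ℝ ∞ fun A => Ring.inverse (1 - Φ A) c := by
  rw [contDiff_iff_contDiffAt]
  intro A
  obtain ⟨w, hw, -⟩ := exists_unit_one_sub (hs A)
  have h1 : ContDiffAt ℝ ∞ Ring.inverse (1 - Φ A) := hw ▸ contDiffAt_ringInverse ℝ w
  exact (h1.comp A (contDiffAt_const.sub Φ.contDiff.contDiffAt)).clm_apply contDiffAt_const

end Neumann

/-! ### Volterra equations with a compact space of additional parameters -/

section Volterra

variable {K : Type*} [TopologicalSpace K] [CompactSpace K]
variable {F : Type*} [NormedAddCommGroup F] [NormedSpace ℝ F]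
variable {a b : ℝ} (h : a ≤ b)

/-- Integration over the second variable. -/
def primL : CFun (K × Set.Icc a b) F →L[ℝ] CFun (K × Set.Icc a b) F :=
  LinearMap.mkContinuous
    { toFun := fun u => mk (fun q => ∫ τ in a..(q.2 : ℝ), u (q.1, Set.projIcc a b h τ))
          (intervalIntegral.continuous_parametric_intervalIntegral_of_continuous
            (f := fun (q : K × Set.Icc a b) τ => u (q.1, Set.projIcc a b h τ))
            (by unfold Function.uncurry; fun_prop) (by fun_prop))
      map_add' := fun u v => by
        ext q
        exact intervalIntegral.integral_add
          (Continuous.intervalIntegrable (by fun_prop) _ _)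
          (Continuous.intervalIntegrable (by fun_prop) _ _)
      map_smul' := fun r u => by
        ext q
        exact intervalIntegral.integral_smul r _ } (b - a) fun u => by
    refine (norm_le (mul_nonneg (sub_nonneg.2 h) (norm_nonneg _))).2 fun q => ?_
    refine (intervalIntegral.norm_integral_le_of_norm_le_const
      (C := ‖u‖) fun τ _ => u.norm_coe_le_norm _).trans ?_
    rw [abs_of_nonneg (sub_nonneg.2 q.2.2.1), mul_comm]
    exact mul_le_mul_of_nonneg_right (sub_le_sub_right q.2.2.2 _) (norm_nonneg _)

theorem primL_apply (u : CFun (K × Set.Icc a b) F) (q : K × Set.Icc a b) :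
    primL h u q = ∫ τ in a..(q.2 : ℝ), u (q.1, Set.projIcc a b h τ) := rfl

/-- The Volterra operator `u ↦ - ∫ A u`. -/
def volt : CFun (K × Set.Icc a b) (F →L[ℝ] F) →L[ℝ]
    (CFun (K × Set.Icc a b) F →L[ℝ] CFun (K × Set.Icc a b) F) :=
  -((ContinuousLinearMap.compL ℝ _ _ _ (primL h)).comp applyL)

theorem volt_apply (A : CFun (K × Set.Icc a b) (F →L[ℝ] F)) (u : CFun (K × Set.Icc a b) F)
    (q : K × Set.Icc a b) : volt h A u q =
      -∫ τ in a..(q.2 : ℝ), A (q.1, Set.projIcc a b h τ) (u (q.1, Set.projIcc a b h τ)) := rfl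

/-- Keeping the upper limit in the estimate is essential: integrating `(τ - a) ^ n` produces the
factor `1 / (n + 1)` at each step, hence the factorial. -/
theorem norm_volt_pow_apply_le (A : CFun (K × Set.Icc a b) (F →L[ℝ] F)) (u : CFun (K × Set.Icc a b) F)
    (n : ℕ) (q : K × Set.Icc a b) :
    ‖(volt h A ^ n) u q‖ ≤ ‖A‖ ^ n * ((q.2 : ℝ) - a) ^ n / n.factorial * ‖u‖ := by
  induction n generalizing q with
  | zero => simpa using u.norm_coe_le_norm q
  | succ n ih =>
    rw [pow_succ', mul_apply_eq_comp, volt_apply, norm_neg]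
    have h1 : ∀ τ ∈ Set.Ioc a (q.2 : ℝ),
        ‖A (q.1, Set.projIcc a b h τ) ((volt h A ^ n) u (q.1, Set.projIcc a b h τ))‖ ≤
          ‖A‖ ^ (n + 1) / n.factorial * ‖u‖ * (τ - a) ^ n := by
      intro τ hτ
      have hτ' : τ ∈ Set.Icc a b := ⟨hτ.1.le, hτ.2.trans q.2.2.2⟩
      have := ih (q.1, Set.projIcc a b h τ)
      refine ((A _).le_of_opNorm_le_of_le (A.norm_coe_le_norm _) this).trans (le_of_eq ?_)
      rw [Set.projIcc_of_mem h hτ']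
      ring
    refine (intervalIntegral.norm_integral_le_of_norm_le q.2.2.1
      (Filter.Eventually.of_forall h1) (Continuous.intervalIntegrable (by fun_prop) _ _)).trans
      (le_of_eq ?_)
    rw [intervalIntegral.integral_const_mul,
      intervalIntegral.integral_comp_sub_right (fun τ => τ ^ n) a, integral_pow, sub_self,
      Nat.factorial_succ]
    push_cast
    field_simp
    ring

theorem summable_volt_pow [CompleteSpace F] (A : CFun (K × Set.Icc a b) (F →L[ℝ] F)) :
    Summable fun n => volt h A ^ n := by
  refine Summable.of_norm_bounded (Real.summable_pow_div_factorial (‖A‖ * (b - a))) fun n => ?_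
  have hba : 0 ≤ b - a := sub_nonneg.2 h
  refine ContinuousLinearMap.opNorm_le_bound _ (by positivity) fun u => ?_
  refine (norm_le (by positivity)).2 fun q => ?_
  refine (norm_volt_pow_apply_le h A u n q).trans ?_
  rw [mul_pow]
  have h1 : 0 ≤ (q.2 : ℝ) - a := sub_nonneg.2 q.2.2.1
  have h2 : (q.2 : ℝ) - a ≤ b - a := sub_le_sub_right q.2.2.2 _
  gcongr

/-- The solution of the Volterra equation `u = c - ∫ A u`. -/
def voltSol (c : CFun (K × Set.Icc a b) F) (A : CFun (K × Set.Icc a b) (F →L[ℝ] F)) :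
    CFun (K × Set.Icc a b) F := Ring.inverse (1 - volt h A) c

variable [CompleteSpace F]

theorem hasSum_voltSol (c : CFun (K × Set.Icc a b) F) (A : CFun (K × Set.Icc a b) (F →L[ℝ] F)) :
    HasSum (fun n => (volt h A ^ n) c) (voltSol h c A) :=
  hasSum_inverse_one_sub_apply (summable_volt_pow h A) c

theorem voltSol_eq (c : CFun (K × Set.Icc a b) F) (A : CFun (K × Set.Icc a b) (F →L[ℝ] F)) :
    voltSol h c A = c + volt h A (voltSol h c A) :=
  inverse_one_sub_apply_eq (summable_volt_pow h A) c

theorem contDiff_voltSol (c : CFun (K × Set.Icc a b) F) :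
    ContDiff ℝ ∞ (voltSol h c : CFun (K × Set.Icc a b) (F →L[ℝ] F) → CFun (K × Set.Icc a b) F) :=
  contDiff_inverse_one_sub_apply (volt h) (summable_volt_pow h) c

end Volterra

end CFun

/-! ### Pointwise operations and matrix-valued Volterra operators -/

namespace CFun

section Operations

variable {T T' : Type*} [TopologicalSpace T] [CompactSpace T] [TopologicalSpace T'] [CompactSpace T']
variable {F G : Type*} [NormedAddCommGroup F] [NormedSpace ℝ F] [NormedAddCommGroup G]
  [NormedSpace ℝ G]

/-- Composition with an operator. -/
def postL (φ : F →L[ℝ] G) : CFun T F →L[ℝ] CFun T G := applyL (mk (fun _ => φ) continuous_const)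

@[simp] theorem postL_apply (φ : F →L[ℝ] G) (u : CFun T F) (t : T) : postL φ u t = φ (u t) := rfl

/-- Composition with a continuous map. -/
def preL (g : T' → T) (hg : Continuous g) : CFun T F →L[ℝ] CFun T' F :=
  LinearMap.mkContinuous
    { toFun := fun u => mk (fun t => u (g t)) (by fun_prop)
      map_add' := fun _ _ => rfl
      map_smul' := fun _ _ => rfl } 1 fun u => by
    rw [one_mul]
    exact (norm_le (norm_nonneg u)).2 fun t => u.norm_coe_le_norm (g t)

/-- The constant functions. -/
def constL : F →L[ℝ] CFun T F :=
  LinearMap.mkContinuous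
    { toFun := fun c => mk (fun _ => c) continuous_const
      map_add' := fun _ _ => rfl
      map_smul' := fun _ _ => rfl } 1 fun c => by
    rw [one_mul]
    exact (norm_le (norm_nonneg c)).2 fun t => le_rfl

@[simp] theorem constL_apply (c : F) (t : T) : constL c t = c := rfl

variable {𝕜 : Type*} [RCLike 𝕜]

/-- The pointwise product. -/
def mulL : CFun T 𝕜 →L[ℝ] CFun T 𝕜 →L[ℝ] CFun T 𝕜 :=
  applyL.comp (postL (ContinuousLinearMap.mul ℝ 𝕜))

@[simp] theorem mulL_apply (u v : CFun T 𝕜) (t : T) : mulL u v t = u t * v t := rfl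

variable {ι : Type*} [Fintype ι]

open Classical in
/-- The operator which multiplies the entry `q` by a scalar and puts it in the place `p`. -/
def entryL (p q : ι) : 𝕜 →L[ℝ] (ι → 𝕜) →L[ℝ] (ι → 𝕜) :=
  (ContinuousLinearMap.compL ℝ (ι → 𝕜) 𝕜 (ι → 𝕜)
      (ContinuousLinearMap.single ℝ (fun _ => 𝕜) p)).comp
    (((ContinuousLinearMap.compL ℝ (ι → 𝕜) 𝕜 𝕜).flip (ContinuousLinearMap.proj q)).comp
      (ContinuousLinearMap.mul ℝ 𝕜))

/-- The operators given by a matrix of functions. -/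
def opOf : (ι → ι → CFun T 𝕜) →L[ℝ] CFun T ((ι → 𝕜) →L[ℝ] (ι → 𝕜)) :=
  ∑ p, ∑ q, (postL (entryL p q)).comp ((ContinuousLinearMap.proj (R := ℝ)
    (φ := fun _ : ι => CFun T 𝕜) q).comp (ContinuousLinearMap.proj (R := ℝ)
      (φ := fun _ : ι => ι → CFun T 𝕜) p))

theorem opOf_apply (r : ι → ι → CFun T 𝕜) (t : T) (v : ι → 𝕜) (p : ι) :
    opOf r t v p = ∑ q, r p q t * v q := by
  classical
  simp only [opOf, sum_apply, _root_.sum_apply, ContinuousLinearMap.comp_apply,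
    ContinuousLinearMap.proj_apply, postL_apply, Finset.sum_apply]
  rw [Finset.sum_eq_single p]
  · exact Finset.sum_congr rfl fun q _ => by simp [entryL]
  · intro p' _ hp
    exact Finset.sum_eq_zero fun q _ => by simp [entryL, Ne.symm hp]
  · simp

theorem volt_opOf_apply {K : Type*} [TopologicalSpace K] [CompactSpace K]
    {a b : ℝ} (hab : a ≤ b) (r : ι → ι → CFun (K × Set.Icc a b) 𝕜)
    (w : CFun (K × Set.Icc a b) (ι → 𝕜)) (q : K × Set.Icc a b) (p : ι) :
    volt hab (opOf r) w q p = -∫ τ in a..(q.2 : ℝ),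
      ∑ s, r p s (q.1, Set.projIcc a b hab τ) * w (q.1, Set.projIcc a b hab τ) s := by
  rw [volt_apply, Pi.neg_apply]
  congr 1
  have hint : IntervalIntegrable (fun τ => opOf r (q.1, Set.projIcc a b hab τ)
      (w (q.1, Set.projIcc a b hab τ))) MeasureTheory.volume a (q.2 : ℝ) :=
    Continuous.intervalIntegrable (by fun_prop) _ _
  have := (ContinuousLinearMap.proj (R := ℝ) (φ := fun _ : ι => 𝕜) p).intervalIntegral_comp_comm
    hint
  simp only [ContinuousLinearMap.proj_apply] at this
  refine this.symm.trans (intervalIntegral.integral_congr fun τ _ => ?_)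
  exact opOf_apply r _ _ p

end Operations

end CFun

/-! ### Linear matrix differential equations -/

section MatrixODE

variable {𝕜 : Type*} [RCLike 𝕜] {ι κ' : Type*} [Fintype ι] {a b : ℝ}

/-- Grönwall, column by column: the norm of the derivative of a column is at most `C` times the norm
of the column, with `C` a bound on `[a, b]` for the sum of the norms of all entries of `A`. -/
theorem eq_zero_of_linear_ode {A : ℝ → Matrix ι ι 𝕜}
    (hA : ∀ p q, ContinuousOn (fun t => A t p q) (Set.Icc a b)) {y : ℝ → Matrix ι κ' 𝕜}
    (ha : y a = 0) (hy : ∀ t ∈ Set.Icc a b, ∀ p q,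
      HasDerivWithinAt (fun τ => y τ p q) (-(A t * y t) p q) (Set.Icc a b) t) :
    ∀ t ∈ Set.Icc a b, y t = 0 := by
  intro t ht
  ext p q
  have hb : ∃ C, ∀ t ∈ Set.Icc a b, ∑ p, ∑ q, ‖A t p q‖ ≤ C := by
    have hc : ContinuousOn (fun t => ∑ p, ∑ q, ‖A t p q‖) (Set.Icc a b) :=
      continuousOn_finsetSum _ fun p _ => continuousOn_finsetSum _ fun q _ => (hA p q).norm
    obtain ⟨C, hC⟩ := isCompact_Icc.bddAbove_image hc
    exact ⟨C, fun t ht => hC ⟨t, ht, rfl⟩⟩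
  obtain ⟨C, hC⟩ := hb
  have hd : ∀ t ∈ Set.Icc a b, HasDerivWithinAt (fun τ => fun p => y τ p q)
      (fun p => -(A t * y t) p q) (Set.Icc a b) t := fun t ht =>
    hasDerivWithinAt_pi.2 fun p => hy t ht p q
  have := eq_zero_of_abs_deriv_le_mul_abs_self_of_eq_zero_right (f := fun τ => fun p => y τ p q)
    (f' := fun t p => -(A t * y t) p q) (K := C) (a := a) (b := b)
    (fun t ht => (hd t ht).continuousWithinAt)
    (fun t ht => (hd t ⟨ht.1, ht.2.le⟩).mono_of_mem_nhdsWithin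
      (Icc_mem_nhdsGE_of_mem ht)) (by ext p; simp [ha]) (fun t ht => by
      refine (pi_norm_le_iff_of_nonneg (mul_nonneg ?_ (norm_nonneg _))).2 fun p => ?_
      · exact (Finset.sum_nonneg fun p _ => Finset.sum_nonneg fun q _ => norm_nonneg _).trans
          (hC t ⟨ht.1, ht.2.le⟩)
      · rw [norm_neg, Matrix.mul_apply]
        refine (norm_sum_le _ _).trans ?_
        refine le_trans ?_ (mul_le_mul_of_nonneg_right (hC t ⟨ht.1, ht.2.le⟩) (norm_nonneg _))
        refine le_trans ?_ (mul_le_mul_of_nonneg_right (Finset.single_le_sum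
          (f := fun p => ∑ q, ‖A t p q‖) (fun p _ => Finset.sum_nonneg fun q _ => norm_nonneg _)
          (Finset.mem_univ p)) (norm_nonneg _))
        rw [Finset.sum_mul]
        refine Finset.sum_le_sum fun r _ => ?_
        rw [norm_mul]
        exact mul_le_mul_of_nonneg_left (norm_le_pi_norm (fun p => y t p q) r) (norm_nonneg _)) t ht
  exact congrFun this p

open CFun

/-- The columns are Volterra solutions starting at the unit vectors. The last clause is the bridge
to path ordered exponentials: any sequence obeying the recursion of iterated integrals consists of
the terms of the Neumann series, hence sums to the solution. -/
theorem exists_fundamental_solution [DecidableEq ι] (hab : a ≤ b) {A : ℝ → Matrix ι ι 𝕜}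
    (hA : ∀ p q, ContinuousOn (fun t => A t p q) (Set.Icc a b)) :
    ∃ u : ℝ → Matrix ι ι 𝕜, u a = 1 ∧
      (∀ t ∈ Set.Icc a b, ∀ p q,
        HasDerivWithinAt (fun τ => u τ p q) (-(A t * u t) p q) (Set.Icc a b) t) ∧
      ∀ v : ℕ → ℝ → Matrix ι ι 𝕜, (∀ t ∈ Set.Icc a b, v 0 t = 1) →
        (∀ n, ∀ t ∈ Set.Icc a b, ∀ p q, v (n + 1) t p q = -∫ τ in a..t, (A τ * v n τ) p q) →
        ∀ t ∈ Set.Icc a b, ∀ p q, HasSum (fun n => v n t p q) (u t p q) := by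
  let pr : ℝ → Set.Icc a b := Set.projIcc a b hab
  let r : ι → ι → CFun (Unit × Set.Icc a b) 𝕜 := fun p q =>
    CFun.mk (fun s => A s.2 p q) ((hA p q).comp_continuous (by fun_prop) fun s => s.2.2)
  let c : ι → CFun (Unit × Set.Icc a b) (ι → 𝕜) := fun q => constL (fun p => (1 : Matrix ι ι 𝕜) p q)
  let sol : ι → CFun (Unit × Set.Icc a b) (ι → 𝕜) := fun q => voltSol hab (c q) (opOf r)
  let evp : ∀ (t : Set.Icc a b) (p : ι), CFun (Unit × Set.Icc a b) (ι → 𝕜) →L[ℝ] 𝕜 := fun t p =>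
    (ContinuousLinearMap.proj p : (ι → 𝕜) →L[ℝ] 𝕜).comp (evalL ((), t))
  have hvolt : ∀ (w : CFun (Unit × Set.Icc a b) (ι → 𝕜)) (t : Set.Icc a b) (p : ι),
      volt hab (opOf r) w ((), t) p =
        -∫ τ in a..(t : ℝ), ∑ s, A (pr τ) p s * w ((), pr τ) s := fun w t p =>
    volt_opOf_apply hab r w ((), t) p
  refine ⟨fun t => Matrix.of fun p q => sol q ((), pr t) p, ?_, ?_, ?_⟩
  · ext p q
    have h1 : sol q ((), pr a) p = _ :=
      congrArg (fun w : CFun _ (ι → 𝕜) => w ((), pr a) p) (voltSol_eq hab (c q) (opOf r))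
    rw [CFun.add_apply, Pi.add_apply, hvolt] at h1
    change sol q ((), pr a) p = _
    rw [h1]
    simp only [pr, Set.projIcc_left, intervalIntegral.integral_same, neg_zero, add_zero]
    rfl
  · intro t ht p q
    have h1 : ∀ τ ∈ Set.Icc a b, sol q ((), pr τ) p =
        (1 : Matrix ι ι 𝕜) p q - ∫ σ in a..τ, ∑ s, A (pr σ) p s * sol q ((), pr σ) s := by
      intro τ hτ
      have h1 : sol q ((), pr τ) p = _ :=
        congrArg (fun w : CFun _ (ι → 𝕜) => w ((), pr τ) p) (voltSol_eq hab (c q) (opOf r))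
      rw [CFun.add_apply, Pi.add_apply, hvolt] at h1
      rw [h1, sub_eq_add_neg]
      simp only [pr, Set.projIcc_of_mem hab hτ]
      rfl
    have hcont : Continuous fun σ => ∑ s, A (pr σ) p s * sol q ((), pr σ) s := by
      refine continuous_finsetSum _ fun s _ => ?_
      have hr : Continuous fun σ => r p s ((), pr σ) := by fun_prop
      exact Continuous.mul hr (by fun_prop)
    have h2 := ((hcont.integral_hasStrictDerivAt a t).hasDerivAt.const_sub
      ((1 : Matrix ι ι 𝕜) p q)).hasDerivWithinAt (s := Set.Icc a b)
    refine (h2.congr (fun τ hτ => h1 τ hτ) (h1 t ht)).congr_deriv ?_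
    simp only [pr, Set.projIcc_of_mem hab ht]
    rfl
  · intro v hv0 hv t ht p q
    have h1 : ∀ n, ∀ t (ht : t ∈ Set.Icc a b) p,
        v n t p q = (volt hab (opOf r) ^ n) (c q) ((), ⟨t, ht⟩) p := by
      intro n
      induction n with
      | zero =>
        intro t ht p
        rw [hv0 t ht]
        rfl
      | succ n ih =>
        intro t ht p
        rw [hv n t ht, pow_succ', mul_apply_eq_comp, hvolt]
        congr 1
        refine intervalIntegral.integral_congr fun τ hτ => ?_
        rw [Set.uIcc_of_le ht.1] at hτ
        have hτ' : τ ∈ Set.Icc a b := ⟨hτ.1, hτ.2.trans ht.2⟩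
        simp only [Matrix.mul_apply, pr, Set.projIcc_of_mem hab hτ']
        exact Finset.sum_congr rfl fun s _ => by rw [ih τ hτ' s]
    have h2 := (evp ⟨t, ht⟩ p).hasSum (hasSum_voltSol hab (c q) (opOf r))
    simp only [pr, Set.projIcc_of_mem hab ht, h1 _ t ht]
    exact h2

end MatrixODE

/-! ### Smooth compact families of sections -/

namespace NQManifold

open GradedSpace

variable {𝕜 : Type k} [RCLike 𝕜] {L : NQManifold.{v} 𝕜} {V : Opens L.B}
variable {T T' : Type*} [TopologicalSpace T] [CompactSpace T] [TopologicalSpace T']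
  [CompactSpace T']

theorem _root_.ContDiff.comp_contMDiffOn_body {E F : Type*} [NormedAddCommGroup E] [NormedSpace ℝ E]
    [NormedAddCommGroup F] [NormedSpace ℝ F] {Φ : E → F} (hΦ : ContDiff ℝ ∞ Φ) {f : L.B → E}
    {s : Set L.B} (hf : ContMDiffOn (𝓡 L.n) 𝓘(ℝ, E) ∞ f s) :
    ContMDiffOn (𝓡 L.n) 𝓘(ℝ, F) ∞ (fun x => Φ (f x)) s :=
  hΦ.contMDiff.comp_contMDiffOn hf

open Classical in
/-- The coefficients of a family of sections as continuous functions of the parameter. -/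
def famCoeff (a : T → L.O V) (κ : L.Coords) (I : MonoIdx κ.deg) (x : L.B) : CFun T 𝕜 :=
  if h : Continuous fun t => κ.coeff (a t) I x then CFun.mk _ h else 0

/-- A family of sections with a compact parameter space whose coefficients are smooth functions
with values in the continuous functions of the parameter. -/
def IsSmoothFam (a : T → L.O V) : Prop :=
  ∀ (κ : L.Coords) (I : MonoIdx κ.deg),
    (∀ x ∈ V, x ∈ κ.V → Continuous fun t => κ.coeff (a t) I x) ∧
    ContMDiffOn (𝓡 L.n) 𝓘(ℝ, CFun T 𝕜) ∞ (famCoeff a κ I) ((V ⊓ κ.V : Opens L.B) : Set L.B)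

theorem famCoeff_eq {a : T → L.O V} {κ : L.Coords} {I : MonoIdx κ.deg} {x : L.B} {u : CFun T 𝕜}
    (h : ∀ t, u t = κ.coeff (a t) I x) : famCoeff a κ I x = u := by
  have hc : Continuous fun t => κ.coeff (a t) I x := u.continuous.congr h
  rw [famCoeff, dif_pos hc]
  exact CFun.ext fun t => (h t).symm

/-- `famCoeff` has the default value 0 where continuity fails; here it is enough to exhibit some
smooth map with the right values, whose existence contains the continuity. -/
theorem IsSmoothFam.mk {a : T → L.O V} (h : ∀ (κ : L.Coords) (I : MonoIdx κ.deg),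
    ∃ u : L.B → CFun T 𝕜,
      ContMDiffOn (𝓡 L.n) 𝓘(ℝ, CFun T 𝕜) ∞ u ((V ⊓ κ.V : Opens L.B) : Set L.B) ∧
      ∀ x ∈ V, x ∈ κ.V → ∀ t, u x t = κ.coeff (a t) I x) : IsSmoothFam a := by
  intro κ I
  obtain ⟨u, hu, he⟩ := h κ I
  exact ⟨fun x hx hκ => (u x).continuous.congr (he x hx hκ),
    hu.congr fun x hx => famCoeff_eq (he x hx.1 hx.2)⟩

theorem IsSmoothFam.famCoeff_apply {a : T → L.O V} (h : IsSmoothFam a) {κ : L.Coords}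
    (I : MonoIdx κ.deg) {x : L.B} (hx : x ∈ V) (hκ : x ∈ κ.V) (t : T) :
    famCoeff a κ I x t = κ.coeff (a t) I x := by
  rw [famCoeff, dif_pos ((h κ I).1 x hx hκ)]
  rfl

theorem IsSmoothFam.of_local {a : T → L.O V} (h : ∀ y ∈ V, ∃ (V' : Opens L.B) (h : V' ≤ V),
    y ∈ V' ∧ IsSmoothFam fun t => L.res h (a t)) : IsSmoothFam a := by
  have hfc : ∀ (κ : L.Coords) (I : MonoIdx κ.deg) (V' : Opens L.B) (hV : V' ≤ V), ∀ x ∈ V',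
      famCoeff (fun t => L.res hV (a t)) κ I x = famCoeff a κ I x := by
    intro κ I V' hV x hx
    have h1 : (fun t => κ.coeff (L.res hV (a t)) I x) = fun t => κ.coeff (a t) I x :=
      funext fun t => κ.coeff_res hV _ _ hx
    classical
    have h2 : ∀ f g : T → 𝕜, f = g → (if h : Continuous f then CFun.mk f h else 0) =
        if h : Continuous g then CFun.mk g h else 0 := by
      rintro _ _ rfl
      rfl
    exact h2 _ _ h1
  intro κ I
  refine ⟨fun x hx hκ => ?_, fun x hx => ?_⟩
  · obtain ⟨V', hV, hxV, hs⟩ := h x hx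
    simpa only [κ.coeff_res hV _ _ hxV] using (hs κ I).1 x hxV hκ
  · obtain ⟨V', hV, hxV, hs⟩ := h x hx.1
    have h1 := ((hs κ I).2.contMDiffAt ((V' ⊓ κ.V).isOpen.mem_nhds ⟨hxV, hx.2⟩))
    refine (h1.congr_of_eventuallyEq ?_).contMDiffWithinAt
    filter_upwards [V'.isOpen.mem_nhds hxV] with z hz using (hfc κ I V' hV z hz).symm

theorem IsSmoothFam.comp {a : T → L.O V} (h : IsSmoothFam a) {g : T' → T} (hg : Continuous g) :
    IsSmoothFam fun t => a (g t) :=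
  .mk fun κ I => ⟨fun x => CFun.preL g hg (famCoeff a κ I x),
    ContDiff.comp_contMDiffOn_body (ContinuousLinearMap.contDiff (CFun.preL g hg)) (h κ I).2,
    fun _ hx hκ t => h.famCoeff_apply I hx hκ (g t)⟩

theorem IsSmoothFam.const (a : L.O V) : IsSmoothFam fun _ : T => a :=
  .mk fun κ I => ⟨fun x => CFun.constL (κ.coeff a I x),
    ContDiff.comp_contMDiffOn_body (ContinuousLinearMap.contDiff (CFun.constL (F := 𝕜)))
      (κ.coeff_contMDiffOn a I), fun _ _ _ _ => rfl⟩

theorem IsSmoothFam.add {a b : T → L.O V} (ha : IsSmoothFam a) (hb : IsSmoothFam b) :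
    IsSmoothFam fun t => a t + b t :=
  .mk fun κ I => ⟨fun x => famCoeff a κ I x + famCoeff b κ I x, (ha κ I).2.add (hb κ I).2,
    fun x hx hκ t => by
      rw [CFun.add_apply, ha.famCoeff_apply I hx hκ, hb.famCoeff_apply I hx hκ, κ.coeff_add]⟩

theorem IsSmoothFam.neg {a : T → L.O V} (ha : IsSmoothFam a) : IsSmoothFam fun t => -a t :=
  .mk fun κ I => ⟨fun x => -famCoeff a κ I x, (ha κ I).2.neg,
    fun x hx hκ t => by rw [CFun.neg_apply, ha.famCoeff_apply I hx hκ, κ.coeff_neg]⟩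

theorem IsSmoothFam.zero : IsSmoothFam fun _ : T => (0 : L.O V) := .const 0

theorem IsSmoothFam.sum {J : Type*} (s : Finset J) {a : J → T → L.O V}
    (h : ∀ j ∈ s, IsSmoothFam (a j)) : IsSmoothFam fun t => ∑ j ∈ s, a j t := by
  classical
  induction s using Finset.induction_on with
  | empty => simpa using IsSmoothFam.zero
  | insert j s hj ih =>
    simp only [Finset.sum_insert hj]
    exact (h j (Finset.mem_insert_self _ _)).add (ih fun i hi => h i (Finset.mem_insert_of_mem hi))

theorem contMDiffOn_mulL {s : Set L.B} {f g : L.B → CFun T 𝕜}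
    (hf : ContMDiffOn (𝓡 L.n) 𝓘(ℝ, CFun T 𝕜) ∞ f s)
    (hg : ContMDiffOn (𝓡 L.n) 𝓘(ℝ, CFun T 𝕜) ∞ g s) :
    ContMDiffOn (𝓡 L.n) 𝓘(ℝ, CFun T 𝕜) ∞ (fun x => CFun.mulL (f x) (g x)) s :=
  (ContDiff.comp_contMDiffOn_body
    (ContinuousLinearMap.contDiff (CFun.mulL (T := T) (𝕜 := 𝕜))) hf).clm_apply hg

theorem contMDiffOn_sum {E : Type*} [NormedAddCommGroup E] [NormedSpace ℝ E] {s : Set L.B}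
    {J : Type*} (S : Finset J) {f : J → L.B → E} (hf : ∀ j ∈ S, ContMDiffOn (𝓡 L.n) 𝓘(ℝ, E) ∞ (f j) s) :
    ContMDiffOn (𝓡 L.n) 𝓘(ℝ, E) ∞ (fun x => ∑ j ∈ S, f j x) s := by
  classical
  induction S using Finset.induction_on with
  | empty => simpa using contMDiffOn_const
  | insert j S hj ih =>
    simp only [Finset.sum_insert hj]
    exact (hf j (Finset.mem_insert_self _ _)).add (ih fun i hi => hf i (Finset.mem_insert_of_mem hi))

theorem contMDiffOn_constL {s : Set L.B} {f : L.B → 𝕜} (hf : ContMDiffOn (𝓡 L.n) 𝓘(ℝ, 𝕜) ∞ f s) :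
    ContMDiffOn (𝓡 L.n) 𝓘(ℝ, CFun T 𝕜) ∞ (fun x => (CFun.constL (f x) : CFun T 𝕜)) s :=
  ContDiff.comp_contMDiffOn_body (ContinuousLinearMap.contDiff (CFun.constL (T := T) (F := 𝕜))) hf

theorem contMDiffOn_structConst (κ : L.Coords) (M N K : MonoIdx κ.deg) :
    ContMDiffOn (𝓡 L.n) 𝓘(ℝ, 𝕜) ∞ (κ.structConst M N K) ((V ⊓ κ.V : Opens L.B) : Set L.B) :=
  (κ.structConst_contMDiffOn M N K).mono inf_le_right

theorem IsSmoothFam.mul {a b : T → L.O V} (ha : IsSmoothFam a) (hb : IsSmoothFam b) :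
    IsSmoothFam fun t => a t * b t :=
  .mk fun κ I => ⟨fun x => ∑ N : κ.Idx I.total, ∑ M : κ.Idx I.total,
      CFun.mulL (CFun.mulL (famCoeff a κ M.1 x) (famCoeff b κ N.1 x))
        (CFun.constL (κ.structConst M.1 N.1 I x)),
    contMDiffOn_sum _ fun N _ => contMDiffOn_sum _ fun M _ =>
      contMDiffOn_mulL (contMDiffOn_mulL (ha κ _).2 (hb κ _).2)
        (contMDiffOn_constL (contMDiffOn_structConst κ _ _ _)),
    fun x hx hκ t => by
      rw [κ.coeff_mul _ _ I hx hκ _ le_rfl]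
      simp only [CFun.sum_apply, CFun.mulL_apply, CFun.constL_apply, ha.famCoeff_apply _ hx hκ,
        hb.famCoeff_apply _ hx hκ]⟩

theorem IsSmoothFam.continuous_rep {m n : Type*} {A : T → Matrix m n (L.O V)}
    (hA : ∀ α β, IsSmoothFam fun t => A t α β) {κ : L.Coords} {R : ℕ} {x : L.B} (hx : x ∈ V)
    (hκ : x ∈ κ.V) (p : m × κ.Idx R) (q : n × κ.Idx R) :
    Continuous fun t => κ.rep R x (A t) p q := by
  simp only [Coords.rep_apply hx hκ]
  exact continuous_finsetSum _ fun M _ => ((hA _ _ κ M.1).1 x hx hκ).mul continuous_const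

/-- The entries of the representation of a family of matrices, as functions of the parameter. -/
def famRep {m n : Type*} (A : T → Matrix m n (L.O V)) (κ : L.Coords) (R : ℕ) (x : L.B)
    (p : m × κ.Idx R) (q : n × κ.Idx R) : CFun T 𝕜 :=
  ∑ M : κ.Idx R, CFun.mulL (famCoeff (fun t => A t p.1 q.1) κ M.1 x)
    (CFun.constL (κ.structConst M.1 q.2.1 p.2.1 x))

theorem famRep_apply {m n : Type*} {A : T → Matrix m n (L.O V)}
    (hA : ∀ α β, IsSmoothFam fun t => A t α β) {κ : L.Coords} {R : ℕ} {x : L.B} (hx : x ∈ V)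
    (hκ : x ∈ κ.V) (p : m × κ.Idx R) (q : n × κ.Idx R) (t : T) :
    famRep A κ R x p q t = κ.rep R x (A t) p q := by
  rw [Coords.rep_apply hx hκ]
  simp only [famRep, CFun.sum_apply, CFun.mulL_apply, CFun.constL_apply,
    (hA _ _).famCoeff_apply _ hx hκ]

theorem contMDiffOn_famRep {m n : Type*} {A : T → Matrix m n (L.O V)}
    (hA : ∀ α β, IsSmoothFam fun t => A t α β) (κ : L.Coords) (R : ℕ)
    (p : m × κ.Idx R) (q : n × κ.Idx R) :
    ContMDiffOn (𝓡 L.n) 𝓘(ℝ, CFun T 𝕜) ∞ (fun x => famRep A κ R x p q)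
      ((V ⊓ κ.V : Opens L.B) : Set L.B) :=
  contMDiffOn_sum _ fun _ _ => contMDiffOn_mulL (hA _ _ κ _).2
    (contMDiffOn_constL (contMDiffOn_structConst κ _ _ _))

/-! ### Integrals of smooth families -/

section Integral

variable {K : Type*} [TopologicalSpace K] [CompactSpace K]
variable {a b : ℝ}

/-- Coordinate changes act on coefficients linearly, with matrices independent of the parameter, so
they commute with integration and the integrated coefficients again belong to a section. In negative
degree the family vanishes. -/
theorem exists_integral (hab : a ≤ b) (i : ℤ) {s : K × Set.Icc a b → L.O V} (hs : IsSmoothFam s)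
    (hdeg : ∀ q, s q ∈ L.degZ V i) :
    ∃ w : K × Set.Icc a b → L.O V, IsSmoothFam w ∧ (∀ q, w q ∈ L.degZ V i) ∧
      ∀ q (κ : L.Coords) (I : MonoIdx κ.deg), ∀ x ∈ V, x ∈ κ.V → κ.coeff (w q) I x =
        ∫ τ in a..(q.2 : ℝ), κ.coeff (s (q.1, Set.projIcc a b hab τ)) I x := by
  have hci : ∀ (κ : L.Coords) (I : MonoIdx κ.deg), ∀ x ∈ V, x ∈ κ.V → ∀ σ,
      Continuous fun τ => κ.coeff (s (σ, Set.projIcc a b hab τ)) I x := fun κ I x hx hκ σ =>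
    ((hs κ I).1 x hx hκ).comp (f := fun τ => (σ, Set.projIcc a b hab τ)) (by fun_prop)
  by_cases hi : 0 ≤ i
  · lift i to ℕ using hi
    have hprim : ∀ q (κ : L.Coords) (I : MonoIdx κ.deg), ∀ x ∈ V, x ∈ κ.V →
        CFun.primL hab (famCoeff s κ I x) q =
          ∫ τ in a..(q.2 : ℝ), κ.coeff (s (q.1, Set.projIcc a b hab τ)) I x := by
      intro q κ I x hx hκ
      rw [CFun.primL_apply]
      exact intervalIntegral.integral_congr fun τ _ => hs.famCoeff_apply I hx hκ _
    have hsm : ∀ (κ : L.Coords) (I : MonoIdx κ.deg), ContMDiffOn (𝓡 L.n)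
        𝓘(ℝ, CFun (K × Set.Icc a b) 𝕜) ∞ (fun x => CFun.primL hab (famCoeff s κ I x))
        ((V ⊓ κ.V : Opens L.B) : Set L.B) := fun κ I =>
      ContDiff.comp_contMDiffOn_body (ContinuousLinearMap.contDiff (CFun.primL hab)) (hs κ I).2
    have hex : ∀ q, ∃ w ∈ L.gr V i, ∀ (κ : L.Coords) (I : MonoIdx κ.deg), ∀ x ∈ V, x ∈ κ.V →
        κ.coeff w I x = CFun.primL hab (famCoeff s κ I x) q := by
      intro q
      refine exists_of_coeff i (fun κ I x => CFun.primL hab (famCoeff s κ I x) q)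
        (fun κ I => ContDiff.comp_contMDiffOn_body (ContinuousLinearMap.contDiff (CFun.evalL (F := 𝕜) q))
          (hsm κ I)) (fun κ I x hx hκ hI => ?_) (fun κ κ' I' x hx hκ hκ' hI' => ?_)
      · rw [hprim q κ I x hx hκ]
        simp only [κ.coeff_of_mem_degZ_ne (hdeg _) (by exact_mod_cast hI),
          intervalIntegral.integral_zero]
      · simp only [hprim q _ _ x hx hκ, hprim q _ _ x hx hκ']
        simp only [← intervalIntegral.integral_mul_const]
        rw [← intervalIntegral.integral_finsetSum fun M _ =>
          ((hci κ M.1 x hx hκ q.1).mul continuous_const).intervalIntegrable _ _]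
        exact intervalIntegral.integral_congr fun τ _ =>
          κ.coeff_change κ' _ I' hx hκ i hI'.le
    choose w hw hwc using hex
    exact ⟨w, .mk fun κ I => ⟨_, hsm κ I, fun x hx hκ t => (hwc t κ I x hx hκ).symm⟩,
      fun q => mem_degZ_natCast.2 (hw q), fun q κ I x hx hκ => by
        rw [hwc q κ I x hx hκ, hprim q κ I x hx hκ]⟩
  · have h0 : ∀ q, s q = 0 := fun q => by
      have := hdeg q
      rwa [degZ, if_neg hi] at this
    refine ⟨fun _ => 0, .zero, fun _ => zero_mem _, fun q κ I x hx hκ => ?_⟩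
    simp only [h0, κ.coeff_zero, intervalIntegral.integral_zero]

end Integral

end NQManifold

/-! ### Path ordered exponentials of families of matrices -/

instance {r : ℕ} {deg : Fin r → ℕ} : DecidableEq (MonoIdx deg) := Classical.decEq _

namespace NQManifold

open GradedSpace

variable {𝕜 : Type k} [RCLike 𝕜] {L : NQManifold.{v} 𝕜} {V : Opens L.B}
variable {m : Type*} [Fintype m] [DecidableEq m]

/-- `W` is the path ordered exponential of the family `A` of matrices over `[a, b]`. -/
def IsPOE (A : ℝ → Matrix m m (L.O V)) (a b : ℝ) (W : Matrix m m (L.O V)) : Prop :=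
  ∃ w : ℕ → ℝ → Matrix m m (L.O V),
    (∀ t ∈ Set.Icc a b, w 0 t = 1) ∧
    (∀ q, ∀ t ∈ Set.Icc a b, ∀ α β (κ : L.Coords) (I : MonoIdx κ.deg) (x : L.B),
      κ.coeff (w (q + 1) t α β) I x = - ∫ τ in a..t, κ.coeff ((A τ * w q τ) α β) I x) ∧
    ∀ α β (κ : L.Coords) (I : MonoIdx κ.deg) (x : L.B),
      HasSum (fun q => κ.coeff (w q b α β) I x) (κ.coeff (W α β) I x)

theorem IsPOE.congr {A A' : ℝ → Matrix m m (L.O V)} {a b : ℝ} {W : Matrix m m (L.O V)}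
    (h : IsPOE A a b W) (hA : ∀ t ∈ Set.Icc a b, A t = A' t) : IsPOE A' a b W := by
  obtain ⟨w, h0, h1, h2⟩ := h
  refine ⟨w, h0, fun q t ht α β κ I x => ?_, h2⟩
  rw [h1 q t ht]
  congr 1
  refine intervalIntegral.integral_congr fun τ hτ => ?_
  rw [Set.uIcc_of_le ht.1] at hτ
  simp only [hA τ ⟨hτ.1, hτ.2.trans ht.2⟩]

theorem IsPOE.res {A : ℝ → Matrix m m (L.O V)} {a b : ℝ} {W : Matrix m m (L.O V)}
    (h : IsPOE A a b W) {V' : Opens L.B} (hV : V' ≤ V) :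
    IsPOE (fun t => (A t).map (L.res hV)) a b (W.map (L.res hV)) := by
  obtain ⟨w, h0, h1, h2⟩ := h
  refine ⟨fun q t => (w q t).map (L.res hV), fun t ht => ?_, fun q t ht α β κ I x => ?_,
    fun α β κ I x => ?_⟩
  · simp only [h0 t ht]
    exact Matrix.map_one _ (map_zero _) (map_one _)
  · by_cases hx : x ∈ V'
    · have hmul : ∀ τ, (A τ).map (L.res hV) * (w q τ).map (L.res hV) =
          (A τ * w q τ).map (L.res hV) := fun τ => (Matrix.map_mul (f := L.res hV)).symm
      simp only [hmul, Matrix.map_apply, κ.coeff_res hV _ _ hx]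
      exact h1 q t ht α β κ I x
    · have h0 : ∀ s : L.O V', κ.coeff s I x = 0 := fun s =>
        κ.coeff_eq_zero_of_notMem s I fun h => hx h.1
      simp only [h0, intervalIntegral.integral_zero, neg_zero]
  · by_cases hx : x ∈ V'
    · simp only [Matrix.map_apply, κ.coeff_res hV _ _ hx]
      exact h2 α β κ I x
    · have h0 : ∀ s : L.O V', κ.coeff s I x = 0 := fun s =>
        κ.coeff_eq_zero_of_notMem s I fun h => hx h.1
      simp only [h0]
      exact hasSum_zero

/-- The recursion fixes the coefficients of every iterate, and sums of series are unique; no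
regularity of `A` enters. -/
theorem IsPOE.unique {A : ℝ → Matrix m m (L.O V)} {a b : ℝ} (hab : a ≤ b)
    {W W' : Matrix m m (L.O V)} (h : IsPOE A a b W) (h' : IsPOE A a b W') : W = W' := by
  obtain ⟨w, h0, h1, h2⟩ := h
  obtain ⟨w', h0', h1', h2'⟩ := h'
  have hw : ∀ q, ∀ t ∈ Set.Icc a b, w q t = w' q t := by
    intro q
    induction q with
    | zero => exact fun t ht => (h0 t ht).trans (h0' t ht).symm
    | succ q ih =>
      intro t ht
      ext α β
      refine ext_coeff fun κ I x _ _ => ?_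
      rw [h1 q t ht, h1' q t ht]
      congr 1
      refine intervalIntegral.integral_congr fun τ hτ => ?_
      rw [Set.uIcc_of_le ht.1] at hτ
      simp only [ih τ ⟨hτ.1, hτ.2.trans ht.2⟩]
  ext α β
  refine ext_coeff fun κ I x _ _ => (h2 α β κ I x).unique ?_
  simpa only [hw _ b ⟨hab, le_rfl⟩] using h2' α β κ I x

/-- In a representation, the path ordered exponential is the solution of a linear differential
equation. -/
theorem IsPOE.exists_solution {A : ℝ → Matrix m m (L.O V)} {a b : ℝ} (hab : a ≤ b)
    {W : Matrix m m (L.O V)} (h : IsPOE A a b W) {κ : L.Coords} {R : ℕ} {x : L.B} (hx : x ∈ V)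
    (hκ : x ∈ κ.V) (hA : ∀ p q, ContinuousOn (fun t => κ.rep R x (A t) p q) (Set.Icc a b)) :
    ∃ u : ℝ → Matrix (m × κ.Idx R) (m × κ.Idx R) 𝕜, u a = 1 ∧ u b = κ.rep R x W ∧
      ∀ t ∈ Set.Icc a b, ∀ p q, HasDerivWithinAt (fun τ => u τ p q)
        (-(κ.rep R x (A t) * u t) p q) (Set.Icc a b) t := by
  obtain ⟨w, h0, h1, h2⟩ := h
  obtain ⟨u, hu0, hud, hus⟩ := exists_fundamental_solution hab hA
  -- Continuity of the iterates is not part of the definition; each is a primitive of a continuous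
  -- function by induction. It provides the integrability for exchanging the integral with the
  -- finite sums over monomials.
  have hcw : ∀ n, ∀ p q, ContinuousOn (fun t => κ.rep R x (w n t) p q) (Set.Icc a b) := by
    intro n
    induction n with
    | zero =>
      intro p q
      exact continuousOn_const.congr fun t ht => by rw [h0 t ht]
    | succ n ih =>
      intro p q
      simp only [Coords.rep_apply hx hκ]
      refine continuousOn_finsetSum _ fun M _ => ContinuousOn.mul ?_ continuousOn_const
      refine ContinuousOn.congr (f := fun t => -∫ τ in a..t,
        κ.rep R x (A τ * w n τ) (p.1, M) (q.1, κ.zeroIdx R)) ?_ fun t ht => ?_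
      · refine (intervalIntegral.continuousOn_primitive_interval ?_).neg.mono (by rw [Set.uIcc_of_le hab])
        rw [Set.uIcc_of_le hab]
        refine ContinuousOn.integrableOn_Icc ?_
        simp only [Coords.rep_mul hx hκ, Matrix.mul_apply]
        exact continuousOn_finsetSum _ fun s _ => (hA _ _).mul (ih _ _)
      · simp only [Coords.rep_apply_zero hx hκ]
        exact h1 n t ht _ _ κ M.1 x
  have hint : ∀ n, ∀ t ∈ Set.Icc a b, ∀ (p q : m × κ.Idx R), IntervalIntegrable
      (fun τ => κ.rep R x (A τ * w n τ) p q) MeasureTheory.volume a t := by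
    intro n t ht p q
    refine ContinuousOn.intervalIntegrable ?_
    rw [Set.uIcc_of_le ht.1]
    refine ContinuousOn.mono ?_ (Set.Icc_subset_Icc_right ht.2)
    simp only [Coords.rep_mul hx hκ, Matrix.mul_apply]
    exact continuousOn_finsetSum _ fun s _ => (hA _ _).mul (hcw n _ _)
  refine ⟨u, hu0, ?_, hud⟩
  ext p q
  refine (hus (fun n t => κ.rep R x (w n t)) (fun t ht => ?_) (fun n t ht p q => ?_) b
    ⟨hab, le_rfl⟩ p q).unique ?_
  · rw [h0 t ht, Coords.rep_one hx hκ]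
  · simp only [← Coords.rep_mul hx hκ]
    simp only [Coords.rep_apply hx hκ _ p q]
    rw [intervalIntegral.integral_finsetSum, ← Finset.sum_neg_distrib]
    · refine Finset.sum_congr rfl fun M _ => ?_
      rw [h1 n t ht, intervalIntegral.integral_mul_const, neg_mul]
    · intro M _
      have := hint n t ht (p.1, M) (q.1, κ.zeroIdx R)
      simp only [Coords.rep_apply_zero hx hκ] at this
      exact this.mul_const _
  · simp only [Coords.rep_apply hx hκ _ p q]
    exact hasSum_sum fun M _ => (h2 _ _ κ M.1 x).mul_right _

section Existence

variable {K : Type*} [TopologicalSpace K] [CompactSpace K] {a b : ℝ}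

/-- Existence of the path ordered exponential of a smooth family with a compact parameter space. -/
theorem exists_isPOE (hab : a ≤ b) (lev : m → ℤ) (A : K → ℝ → Matrix m m (L.O V))
    (hs : ∀ α β, IsSmoothFam fun q : K × Set.Icc a b => A q.1 q.2 α β)
    (hd : ∀ σ, ∀ τ ∈ Set.Icc a b, ∀ α β, A σ τ α β ∈ L.degZ V (lev β - lev α)) :
    ∃ W : K → Matrix m m (L.O V), (∀ σ, IsPOE (A σ) a b (W σ)) ∧
      (∀ α β, IsSmoothFam fun σ => W σ α β) ∧
      ∀ σ α β, W σ α β ∈ L.degZ V (lev β - lev α) := by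
  let T := K × Set.Icc a b
  let A' : T → Matrix m m (L.O V) := fun q => A q.1 q.2
  -- The iterates are constructed inside the class of smooth families of the correct degrees, so
  -- that `exists_integral` applies again at each step.
  let Good : (T → Matrix m m (L.O V)) → Prop := fun w =>
    (∀ α β, IsSmoothFam fun q => w q α β) ∧ ∀ q α β, w q α β ∈ L.degZ V (lev β - lev α)
  have hAw : ∀ w, Good w → Good fun q => A' q * w q := by
    intro w hw
    refine ⟨fun α β => ?_, fun q α β => ?_⟩
    · simp only [Matrix.mul_apply]
      exact IsSmoothFam.sum _ fun γ _ => (hs α γ).mul (hw.1 γ β)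
    · change (A' q * w q) α β ∈ _
      rw [Matrix.mul_apply]
      refine Submodule.sum_mem _ fun γ _ => ?_
      have := degZ_mul (hd q.1 q.2 q.2.2 α γ) (hw.2 q γ β)
      rwa [show lev γ - lev α + (lev β - lev γ) = lev β - lev α by ring] at this
  have step : ∀ w : {w // Good w}, ∃ w' : {w // Good w}, ∀ q α β (κ : L.Coords)
      (I : MonoIdx κ.deg) (x : L.B), κ.coeff (w'.1 q α β) I x = -∫ τ in a..(q.2 : ℝ),
        κ.coeff ((A' (q.1, Set.projIcc a b hab τ) * w.1 (q.1, Set.projIcc a b hab τ)) α β) I x := by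
    intro w
    have h := hAw w.1 w.2
    choose z hz1 hz2 hz3 using fun α β => exists_integral hab (lev β - lev α) (h.1 α β)
      (fun q => h.2 q α β)
    refine ⟨⟨fun q => Matrix.of fun α β => -z α β q, fun α β => (hz1 α β).neg,
      fun q α β => neg_mem (hz2 α β q)⟩, fun q α β κ I x => ?_⟩
    by_cases hx : x ∈ V ⊓ κ.V
    · change κ.coeff (-z α β q) I x = _
      rw [κ.coeff_neg, hz3 α β q κ I x hx.1 hx.2]
    · simp only [κ.coeff_eq_zero_of_notMem _ I hx, intervalIntegral.integral_zero, neg_zero]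
  choose f hf using step
  have hone : Good fun _ => 1 := by
    refine ⟨fun α β => .const _, fun q α β => ?_⟩
    change (1 : Matrix m m (L.O V)) α β ∈ _
    rw [Matrix.one_apply]
    split_ifs with hαβ
    · rw [hαβ, sub_self]; exact one_mem_degZ
    · exact zero_mem _
  let w : ℕ → {w // Good w} := fun n => Nat.rec ⟨_, hone⟩ (fun _ => f) n
  have hw0 : ∀ q, (w 0).1 q = 1 := fun q => rfl
  have hw1 : ∀ n, w (n + 1) = f (w n) := fun n => rfl
  -- The expected coefficients of column `β` of the exponential: the truncated Volterra solution
  -- whose initial value is the unit vector of `β` and the constant monomial.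
  let sol : ∀ (κ : L.Coords) (R : ℕ) (β : m) (x : L.B), CFun T (m × κ.Idx R → 𝕜) :=
    fun κ R β x => CFun.voltSol hab
      (CFun.constL fun p => (1 : Matrix (m × κ.Idx R) (m × κ.Idx R) 𝕜) p (β, κ.zeroIdx R))
      (CFun.opOf (famRep A' κ R x))
  have hwn : ∀ (κ : L.Coords) (R : ℕ) (β : m), ∀ x ∈ V, x ∈ κ.V → ∀ n (q : T) p,
      κ.coeff ((w n).1 q p.1 β) p.2.1 x = (CFun.volt hab (CFun.opOf (famRep A' κ R x)) ^ n)
        (CFun.constL fun p => (1 : Matrix (m × κ.Idx R) (m × κ.Idx R) 𝕜) p (β, κ.zeroIdx R)) q p := by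
    intro κ R β x hx hκ n
    induction n with
    | zero =>
      intro q p
      rw [hw0, ← Coords.rep_apply_zero hx hκ, Coords.rep_one hx hκ]
      rfl
    | succ n ih =>
      intro q p
      rw [hw1, hf, pow_succ', mul_apply_eq_comp, CFun.volt_opOf_apply]
      congr 1
      refine intervalIntegral.integral_congr fun τ _ => ?_
      rw [← Coords.rep_apply_zero hx hκ (R := R), Coords.rep_mul hx hκ, Matrix.mul_apply]
      refine Finset.sum_congr rfl fun s _ => ?_
      rw [famRep_apply hs hx hκ, Coords.rep_apply_zero hx hκ, ih]
  have hsum : ∀ (κ : L.Coords) (R : ℕ) (β : m), ∀ x ∈ V, x ∈ κ.V → ∀ (q : T) p,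
      HasSum (fun n => κ.coeff ((w n).1 q p.1 β) p.2.1 x) (sol κ R β x q p) := by
    intro κ R β x hx hκ q p
    rw [funext fun n => hwn κ R β x hx hκ n q p]
    exact ((ContinuousLinearMap.proj (R := ℝ) (φ := fun _ : m × κ.Idx R => 𝕜) p).comp
      (CFun.evalL q)).hasSum (CFun.hasSum_voltSol hab _ _)
  let idx : ∀ (κ : L.Coords) (I : MonoIdx κ.deg), κ.Idx I.total := fun κ I => ⟨I, le_rfl⟩
  -- The truncated matrix is a smooth map from the body to a Banach space of continuous families,
  -- and the Volterra solution is a smooth function of that matrix.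
  have hsm : ∀ (κ : L.Coords) (I : MonoIdx κ.deg) (α β : m),
      ContMDiffOn (𝓡 L.n) 𝓘(ℝ, CFun T 𝕜) ∞ (fun x => CFun.postL (ContinuousLinearMap.proj (R := ℝ)
        (φ := fun _ : m × κ.Idx I.total => 𝕜) (α, idx κ I)) (sol κ I.total β x))
        ((V ⊓ κ.V : Opens L.B) : Set L.B) := by
    intro κ I α β
    refine ContDiff.comp_contMDiffOn_body (ContinuousLinearMap.contDiff (CFun.postL _)) ?_
    refine ContDiff.comp_contMDiffOn_body (CFun.contDiff_voltSol hab _) ?_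
    refine ContDiff.comp_contMDiffOn_body (ContinuousLinearMap.contDiff (F := CFun T ((m × κ.Idx I.total → 𝕜) →L[ℝ] (m × κ.Idx I.total → 𝕜))) CFun.opOf) ?_
    exact contMDiffOn_pi_space.2 fun p => contMDiffOn_pi_space.2 fun q =>
      contMDiffOn_famRep hs κ _ p q
  -- Vanishing off the degree and the rule for coordinate changes pass from the iterates to the
  -- limit by uniqueness of sums. Different truncations `I.total` are used for different
  -- coefficients; the series `hsum` shows that they are consistent.
  have hex : ∀ (q : T) (α β : m), ∃ W ∈ L.degZ V (lev β - lev α), ∀ (κ : L.Coords)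
      (I : MonoIdx κ.deg), ∀ x ∈ V, x ∈ κ.V →
        κ.coeff W I x = sol κ I.total β x q (α, idx κ I) := by
    intro q α β
    have hzero : ∀ (κ : L.Coords) (I : MonoIdx κ.deg), ∀ x ∈ V, x ∈ κ.V →
        (I.total : ℤ) ≠ lev β - lev α → sol κ I.total β x q (α, idx κ I) = 0 := by
      intro κ I x hx hκ hI
      refine (hsum κ _ β x hx hκ q (α, idx κ I)).unique ?_
      simp only [idx, κ.coeff_of_mem_degZ_ne ((w _).2.2 q α β) hI]
      exact hasSum_zero
    by_cases hi : 0 ≤ lev β - lev α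
    · obtain ⟨i, hi⟩ := Int.eq_ofNat_of_zero_le hi
      rw [hi] at hzero ⊢
      obtain ⟨W, hW, hWc⟩ := exists_of_coeff (V := V) i
        (fun κ I x => sol κ I.total β x q (α, idx κ I))
        (fun κ I => ContDiff.comp_contMDiffOn_body
          (ContinuousLinearMap.contDiff (CFun.evalL (F := 𝕜) q)) (hsm κ I α β))
        (fun κ I x hx hκ hI => hzero κ I x hx hκ (by exact_mod_cast hI))
        (fun κ κ' I' x hx hκ hκ' hI' => by
          refine (hsum κ' _ β x hx hκ' q (α, idx κ' I')).unique ?_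
          simp only [idx, fun n => κ.coeff_change κ' ((w n).1 q α β) I' hx hκ i hI'.le]
          exact hasSum_sum fun M _ => (hsum κ _ β x hx hκ q (α, idx κ M.1)).mul_right _)
      exact ⟨W, mem_degZ_natCast.2 hW, hWc⟩
    · refine ⟨0, zero_mem _, fun κ I x hx hκ => ?_⟩
      rw [κ.coeff_zero, hzero κ I x hx hκ (by omega)]
  choose W hWd hWc using hex
  have hb : b ∈ Set.Icc a b := ⟨hab, le_rfl⟩
  refine ⟨fun σ => Matrix.of fun α β => W (σ, ⟨b, hb⟩) α β, fun σ => ?_, fun α β => ?_,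
    fun σ α β => hWd _ α β⟩
  · refine ⟨fun n t => (w n).1 (σ, Set.projIcc a b hab t), fun t _ => rfl,
      fun n t ht α β κ I x => ?_, fun α β κ I x => ?_⟩
    · change κ.coeff ((f (w n)).1 (σ, Set.projIcc a b hab t) α β) I x = _
      rw [hf]
      simp only [Set.projIcc_of_mem hab ht]
      congr 1
      refine intervalIntegral.integral_congr fun τ hτ => ?_
      rw [Set.uIcc_of_le ht.1] at hτ
      simp only [A', Set.projIcc_of_mem hab ⟨hτ.1, hτ.2.trans ht.2⟩]
    · change HasSum (fun q => κ.coeff ((w q).1 (σ, Set.projIcc a b hab b) α β) I x)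
        (κ.coeff (W (σ, ⟨b, hb⟩) α β) I x)
      by_cases hx : x ∈ V ⊓ κ.V
      · rw [hWc _ α β κ I x hx.1 hx.2]
        simp only [Set.projIcc_of_mem hab hb]
        exact hsum κ _ β x hx.1 hx.2 _ (α, idx κ I)
      · simp only [κ.coeff_eq_zero_of_notMem _ I hx]
        exact hasSum_zero
  · have : IsSmoothFam fun q => W q α β := .mk fun κ I => ⟨_, hsm κ I α β,
      fun x hx hκ q => (hWc q α β κ I x hx hκ).symm⟩
    exact this.comp (g := fun σ => (σ, ⟨b, hb⟩)) (by fun_prop)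

/-- Existence of the path ordered exponential of a smooth family. -/
theorem exists_isPOE_single (hab : a ≤ b) (lev : m → ℤ) (A : ℝ → Matrix m m (L.O V))
    (hs : ∀ α β, IsSmoothFam fun t : Set.Icc a b => A t α β)
    (hd : ∀ τ ∈ Set.Icc a b, ∀ α β, A τ α β ∈ L.degZ V (lev β - lev α)) :
    ∃ W : Matrix m m (L.O V), IsPOE A a b W ∧ ∀ α β, W α β ∈ L.degZ V (lev β - lev α) := by
  obtain ⟨W, h1, -, h3⟩ := exists_isPOE (K := Unit) hab lev (fun _ => A)
    (fun α β => (hs α β).comp (g := fun q : Unit × Set.Icc a b => q.2) continuous_snd)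
    (fun _ => hd)
  exact ⟨W (), h1 (), h3 ()⟩

end Existence

end NQManifold

/-! ### Pull-backs along lines -/

open NQManifold GradedSpace

/-- Convex domains with interior points. -/
def IsFat {d : ℕ} (S : Set (Fin d → ℝ)) : Prop := Convex ℝ S ∧ (interior S).Nonempty

theorem IsFat.uniqueDiffOn {d : ℕ} {S : Set (Fin d → ℝ)} (hS : IsFat S) {J : Set (Fin d → ℝ)}
    (hJ : IsOpen J) : UniqueDiffOn ℝ (J ∩ S) := by
  rw [Set.inter_comm]
  exact (uniqueDiffOn_convex hS.1 hS.2).inter hJ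

section Families

variable {𝕜 : Type k} [RCLike 𝕜] {L : NQManifold.{v} 𝕜} {V : Opens L.B} {d : ℕ}
variable {S : Set (Fin d → ℝ)}

theorem GradedSpace.SmoothFamily.contDiffOn {s : (Fin d → ℝ) → L.O V} (hs : L.SmoothFamily S s)
    (κ : L.Coords) (I : MonoIdx κ.deg) {x : L.B} (hx : x ∈ V) (hκ : x ∈ κ.V) :
    ContDiffOn ℝ ∞ (fun t => κ.coeff (s t) I x) S := by
  rw [← contMDiffOn_iff_contDiffOn]
  refine (hs κ I).comp (f := fun t => (t, x)) ?_ fun t ht => ⟨ht, hx, hκ⟩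
  exact contMDiffOn_id.prodMk contMDiffOn_const

variable {T : Type*} [TopologicalSpace T] [CompactSpace T]

/-- In a chart of the body the coefficients are jointly smooth on `S` times a small ball, so
`CFun.contDiffOn_curry` applies; convexity of the ball is what the mean value argument there
requires. -/
theorem GradedSpace.SmoothFamily.isSmoothFam {s : (Fin d → ℝ) → L.O V} (hs : L.SmoothFamily S s)
    (hS : UniqueDiffOn ℝ S) {γ : T → Fin d → ℝ} (hγ : Continuous γ) (hγS : ∀ t, γ t ∈ S) :
    IsSmoothFam fun t => s (γ t) := by
  intro κ I
  have hc : ∀ x ∈ V, x ∈ κ.V → Continuous fun t => κ.coeff (s (γ t)) I x := fun x hx hκ =>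
    (hs.contDiffOn κ I hx hκ).continuousOn.comp_continuous hγ hγS
  have hfc : ∀ x ∈ V, x ∈ κ.V → ∀ t, famCoeff (fun t => s (γ t)) κ I x t =
      κ.coeff (s (γ t)) I x := fun x hx hκ t => by
    rw [famCoeff, dif_pos (hc x hx hκ)]
    rfl
  refine ⟨hc, fun x₀ hx₀ => ContMDiffAt.contMDiffWithinAt ?_⟩
  set φ := extChartAt (𝓡 L.n) x₀ with hφ
  have htgt : φ.target ∈ 𝓝 (φ x₀) := extChartAt_target_mem_nhds x₀
  have hpre : φ.symm ⁻¹' ((V ⊓ κ.V : Opens L.B) : Set L.B) ∈ 𝓝 (φ x₀) := by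
    refine (continuousAt_extChartAt_symm x₀).preimage_mem_nhds ?_
    rw [extChartAt_to_inv]
    exact (V ⊓ κ.V).isOpen.mem_nhds hx₀
  obtain ⟨ε, hε, hball⟩ := Metric.mem_nhds_iff.1 (Filter.inter_mem htgt hpre)
  set Ω := Metric.ball (φ x₀) ε
  have hf : ContDiffOn ℝ ∞ (fun p : (Fin d → ℝ) × EuclideanSpace ℝ (Fin L.n) =>
      κ.coeff (s p.1) I (φ.symm p.2)) (S ×ˢ Ω) := by
    rw [← contMDiffOn_iff_contDiffOn, modelWithCornersSelf_prod]
    refine (hs κ I).comp (f := fun p : (Fin d → ℝ) × EuclideanSpace ℝ (Fin L.n) =>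
      (p.1, φ.symm p.2)) ?_ fun p hp => ⟨hp.1, (hball hp.2).2⟩
    rw [← chartedSpaceSelf_prod]
    refine contMDiffOn_fst.prodMk ?_
    exact (contMDiffOn_extChartAt_symm x₀).comp contMDiffOn_snd fun p hp => (hball hp.2).1
  have hu : ContDiffOn ℝ ∞ (fun p => famCoeff (fun t => s (γ t)) κ I (φ.symm p)) Ω :=
    CFun.contDiffOn_curry hS (convex_ball _ _) Metric.isOpen_ball.uniqueDiffOn ⟨γ, hγ⟩ hγS hf
      fun p hp t => hfc _ (hball hp).2.1 (hball hp).2.2 t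
  have h1 : ContMDiffAt 𝓘(ℝ, EuclideanSpace ℝ (Fin L.n)) 𝓘(ℝ, CFun T 𝕜) ∞
      (fun p => famCoeff (fun t => s (γ t)) κ I (φ.symm p)) (φ x₀) :=
    (hu.contDiffAt (Metric.ball_mem_nhds _ hε)).contMDiffAt
  have h2 : ContMDiffAt (𝓡 L.n) 𝓘(ℝ, CFun T 𝕜) ∞
      (fun x => famCoeff (fun t => s (γ t)) κ I (φ.symm (φ x))) x₀ :=
    h1.comp x₀ contMDiffAt_extChartAt
  refine h2.congr_of_eventuallyEq ?_
  filter_upwards [extChartAt_source_mem_nhds (I := 𝓡 L.n) x₀] with x hx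
  rw [φ.left_inv hx]

end Families

/-! ### Truncations that do not see `Q` of the test manifold -/

section Admissible

variable {𝕜 : Type k} [RCLike 𝕜]

/-- The truncations in which the differential of `L` is not visible. -/
def NQManifold.Admissible (L : NQManifold.{v} 𝕜) (R : ℕ) : Prop := R = 0 ∨ ∀ U, L.Q U = 0

/-- `Q` raises the degree by one, so its values have no coefficient of degree 0; this settles `R =
0` for arbitrary `Q`. -/
theorem NQManifold.Admissible.coeff_Q {L : NQManifold.{v} 𝕜} {R : ℕ} (h : L.Admissible R)
    {V : Opens L.B} (κ : L.Coords) (a : L.O V) {I : MonoIdx κ.deg} (hI : I.total ≤ R) (x : L.B) :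
    κ.coeff (L.Q V a) I x = 0 := by
  rcases h with rfl | h
  · induction a using homogeneous_induction with
    | zero => rw [map_zero, κ.coeff_zero]
    | add a b ha hb => rw [map_add, κ.coeff_add, ha, hb, add_zero]
    | hom i a ha => exact κ.coeff_of_mem_ne (L.Q_mem V i a ha) (by omega) x
  · rw [h, LinearMap.zero_apply, κ.coeff_zero]

end Admissible

namespace SuperMap

variable {𝕜 : Type k} [RCLike 𝕜] {L : NQManifold.{v} 𝕜} {M : NQManifold.{u} 𝕜} {d : ℕ}
variable {S : Set (Fin d → ℝ)} (H : SuperMap S L M)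

/-- Tube lemma. The open thickening `J` of `Z` is needed because smoothness and compatibility with
`Q` are available on relatively open sets of parameters only. -/
theorem exists_tube {Z : Set (Fin d → ℝ)} (hZ : IsCompact Z) (hZS : Z ⊆ S) {U : Opens M.B}
    {x : L.B} (h : ∀ t ∈ Z, H.f t x ∈ U) : ∃ J, IsOpen J ∧ Z ⊆ J ∧ ∃ V' : Opens L.B, x ∈ V' ∧
      ∀ t ∈ J ∩ S, ∀ y ∈ V', H.f t y ∈ U := by
  obtain ⟨O, hO, hOe⟩ := continuousOn_iff'.1 H.f_smooth.continuousOn (U : Set M.B) U.isOpen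
  have hsub : Z ×ˢ {x} ⊆ O := by
    rintro ⟨t, y⟩ ⟨ht, rfl⟩
    have : (t, y) ∈ (fun p : (Fin d → ℝ) × L.B => H.f p.1 p.2) ⁻¹' U ∩ S ×ˢ Set.univ :=
      ⟨h t ht, hZS ht, trivial⟩
    rw [hOe] at this
    exact this.1
  obtain ⟨J, V', hJ, hV', hZJ, hxV, hJV⟩ := generalized_tube_lemma hZ isCompact_singleton hO hsub
  refine ⟨J, hJ, hZJ, ⟨V', hV'⟩, hxV rfl, fun t ht y hy => ?_⟩
  have : (t, y) ∈ O ∩ S ×ˢ Set.univ := ⟨hJV ⟨ht.1, hy⟩, ht.2, trivial⟩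
  rw [← hOe] at this
  exact this.1

/-- The part of the map over the parameters in `Z` and over `V` takes its values in `U`. -/
def MapsInto (Z : Set (Fin d → ℝ)) (V : Opens L.B) (U : Opens M.B) : Prop :=
  ∀ t ∈ Z, t ∈ S ∧ ∀ y ∈ V, H.f t y ∈ U

variable {H} {V : Opens L.B} {U : Opens M.B} {Z : Set (Fin d → ℝ)}

theorem MapsInto.mono (h : H.MapsInto Z V U) {Z' : Set (Fin d → ℝ)} (hZ : Z' ⊆ Z) :
    H.MapsInto Z' V U := fun t ht => h t (hZ ht)

theorem MapsInto.res (h : H.MapsInto Z V U) {V' : Opens L.B} (hV : V' ≤ V) :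
    H.MapsInto Z V' U := fun t ht => ⟨(h t ht).1, fun y hy => (h t ht).2 y (hV hy)⟩

theorem MapsInto.inf (h : H.MapsInto Z V U) {U' : Opens M.B} (h' : H.MapsInto Z V U') :
    H.MapsInto Z V (U ⊓ U') := fun t ht => ⟨(h t ht).1, fun y hy => ⟨(h t ht).2 y hy, (h' t ht).2 y hy⟩⟩

/-- Near a point, the map takes values in the patch for all the parameters close to `Z`. -/
theorem MapsInto.exists_nhds (h : H.MapsInto Z V U) (hZ : IsCompact Z) {x : L.B} (hx : x ∈ V) :
    ∃ J, IsOpen J ∧ Z ⊆ J ∧ ∃ V' : Opens L.B, x ∈ V' ∧ V' ≤ V ∧ ∀ t ∈ J ∩ S, ∀ y ∈ V', H.f t y ∈ U := by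
  obtain ⟨J, hJ, hZJ, V', hxV, hV'⟩ := H.exists_tube hZ (fun t ht => (h t ht).1)
    fun t ht => (h t ht).2 x hx
  exact ⟨J, hJ, hZJ, V' ⊓ V, ⟨hxV, hx⟩, inf_le_right, fun t ht y hy => hV' t ht y hy.1⟩

theorem MapsInto.isSmoothFam (hS : IsFat S) {T : Type*} [TopologicalSpace T] [CompactSpace T]
    {γ : T → Fin d → ℝ} (hγ : Continuous γ)
    (h : H.MapsInto (Set.range γ) V U) (a : M.O U) (K : Finset (Fin d)) :
    IsSmoothFam fun t => H.pull (γ t) U V a K := by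
  refine .of_local fun x hx => ?_
  obtain ⟨J, hJ, hZJ, V', hxV, hV', hJV⟩ := h.exists_nhds (isCompact_range hγ) hx
  refine ⟨V', hV', hxV, ?_⟩
  have h1 : ∀ t, L.res hV' (H.pull (γ t) U V a K) = H.pull (γ t) U V' a K := fun t =>
    (H.pull_res_right _ (h _ ⟨t, rfl⟩).1 U V V' hV' (h _ ⟨t, rfl⟩).2 a K).symm
  simp only [h1]
  exact (H.pull_smooth J hJ U V' hJV a K).isSmoothFam (hS.uniqueDiffOn hJ) hγ
    fun t => ⟨hZJ ⟨t, rfl⟩, (h _ ⟨t, rfl⟩).1⟩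

theorem MapsInto.coeff_pull_res (h : H.MapsInto Z V U) {V' : Opens L.B} (hV : V' ≤ V) {x : L.B}
    (hx : x ∈ V') {t : Fin d → ℝ} (ht : t ∈ Z) (a : M.O U) (K : Finset (Fin d)) (κ : L.Coords)
    (I : MonoIdx κ.deg) : κ.coeff (H.pull t U V' a K) I x = κ.coeff (H.pull t U V a K) I x := by
  rw [H.pull_res_right t (h t ht).1 U V V' hV (h t ht).2 a K, κ.coeff_res hV _ _ hx]

/-- The coefficients are smooth in the parameters. -/
theorem MapsInto.contDiffOn (h : H.MapsInto Z V U) (hZ : IsCompact Z) (a : M.O U)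
    (K : Finset (Fin d)) {κ : L.Coords} (I : MonoIdx κ.deg) {x : L.B} (hx : x ∈ V) (hκ : x ∈ κ.V) :
    ContDiffOn ℝ ∞ (fun t => κ.coeff (H.pull t U V a K) I x) Z := by
  obtain ⟨J, hJ, hZJ, V', hxV, hV', hJV⟩ := h.exists_nhds hZ hx
  exact (((H.pull_smooth J hJ U V' hJV a K).contDiffOn κ I hxV hκ).mono
    fun t ht => ⟨hZJ ht, (h t ht).1⟩).congr fun t ht => (h.coeff_pull_res hV' hxV ht a K κ I).symm

theorem hasDerivWithinAt_pull {J : Set (Fin d → ℝ)} (hJ : IsOpen J)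
    (hJV : ∀ t ∈ J ∩ S, ∀ y ∈ V, H.f t y ∈ U) {γ : ℝ → Fin d → ℝ} {j : Fin d}
    (hγ : ∀ τ, HasDerivAt γ (Pi.single j 1) τ) {s : Set ℝ} (hs : ∀ τ ∈ s, γ τ ∈ J ∩ S) (a : M.O U)
    (K : Finset (Fin d)) {κ : L.Coords} (I : MonoIdx κ.deg) {x : L.B} (hx : x ∈ V) (hκ : x ∈ κ.V)
    {τ : ℝ} (hτ : τ ∈ s) :
    HasDerivWithinAt (fun τ => κ.coeff (H.pull (γ τ) U V a K) I x)
      (fderivWithin ℝ (fun t => κ.coeff (H.pull t U V a K) I x) (J ∩ S) (γ τ) (Pi.single j 1)) s τ :=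
  ((((H.pull_smooth J hJ U V hJV a K).contDiffOn κ I hx hκ).differentiableOn (by simp)
    (γ τ) (hs τ hτ)).hasFDerivWithinAt).comp_hasDerivWithinAt τ (hγ τ).hasDerivWithinAt hs

variable {R : ℕ} {κ : L.Coords} {x : L.B}

/-- The θ-free component of the pull-back of `Q a` contains no derivative in the parameters, only
`Q` of the test manifold, which an admissible truncation does not see. -/
theorem MapsInto.coeff_pull_Q_empty (h : H.MapsInto Z V U) (hR : L.Admissible R) (hx : x ∈ V)
    {t : Fin d → ℝ} (ht : t ∈ Z) (a : M.O U) {I : MonoIdx κ.deg} (hI : I.total ≤ R) :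
    κ.coeff (H.pull t U V (M.Q U a) ∅) I x = 0 := by
  obtain ⟨J, hJ, hZJ, V', hxV, hV', hJV⟩ := (h.mono (Set.singleton_subset_iff.2 ht)).exists_nhds
    isCompact_singleton hx
  rw [← h.coeff_pull_res hV' hxV ht, H.pull_Q J hJ U V' hJV a ∅ t ⟨hZJ rfl, (h t ht).1⟩,
    hR.coeff_Q κ _ hI]
  simp

theorem grassmannSign_empty_left (I : Finset (Fin d)) : grassmannSign ∅ I = 1 := by
  simp [grassmannSign]

theorem grassmannSign_empty_right (I : Finset (Fin d)) : grassmannSign I ∅ = 1 := by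
  simp [grassmannSign]

/-- The derivative of a pull-back along a coordinate line. -/
theorem MapsInto.hasDerivWithinAt {γ : ℝ → Fin d → ℝ} {j : Fin d}
    (hγ : ∀ τ, HasDerivAt γ (Pi.single j 1) τ) {p q : ℝ} (h : H.MapsInto (γ '' Set.Icc p q) V U)
    (hR : L.Admissible R) (hx : x ∈ V) (hκ : x ∈ κ.V) (a : M.O U) {I : MonoIdx κ.deg}
    (hI : I.total ≤ R) {τ : ℝ} (hτ : τ ∈ Set.Icc p q) :
    HasDerivWithinAt (fun τ => κ.coeff (H.pull (γ τ) U V a ∅) I x)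
      (κ.coeff (H.pull (γ τ) U V (M.Q U a) {j}) I x) (Set.Icc p q) τ := by
  have hcont : Continuous γ := continuous_iff_continuousAt.2 fun τ => (hγ τ).continuousAt
  obtain ⟨J, hJ, hZJ, V', hxV, hV', hJV⟩ := h.exists_nhds (isCompact_Icc.image hcont) hx
  have hm : ∀ τ ∈ Set.Icc p q, γ τ ∈ J ∩ S := fun τ hτ =>
    ⟨hZJ ⟨τ, hτ, rfl⟩, (h _ ⟨τ, hτ, rfl⟩).1⟩
  have h1 := hasDerivWithinAt_pull hJ hJV hγ hm a ∅ I hxV hκ hτ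
  have h2 := H.pull_Q J hJ U V' hJV a {j} (γ τ) (hm τ hτ) κ I x
  rw [hR.coeff_Q κ _ hI, Finset.sum_singleton, mul_zero, add_zero, Finset.erase_singleton,
    grassmannSign_empty_right, Int.cast_one, one_mul] at h2
  rw [← h.coeff_pull_res hV' hxV ⟨τ, hτ, rfl⟩, h2]
  exact h1.congr (fun σ hσ => (h.coeff_pull_res hV' hxV ⟨σ, hσ, rfl⟩ a ∅ κ I).symm)
    (h.coeff_pull_res hV' hxV ⟨τ, hτ, rfl⟩ a ∅ κ I).symm

end SuperMap

/-- The points of the plane. -/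
def pt (s t : ℝ) : Fin 2 → ℝ := ![s, t]

theorem hasDerivAt_pt_left (t s : ℝ) : HasDerivAt (fun s => pt s t) (Pi.single 0 1) s := by
  rw [hasDerivAt_pi]
  intro i
  fin_cases i
  · exact hasDerivAt_id s
  · exact hasDerivAt_const s t

theorem hasDerivAt_pt_right (s t : ℝ) : HasDerivAt (fun t => pt s t) (Pi.single 1 1) t := by
  rw [hasDerivAt_pi]
  intro i
  fin_cases i
  · exact hasDerivAt_const t s
  · exact hasDerivAt_id t

theorem continuous_pt : Continuous fun q : ℝ × ℝ => pt q.1 q.2 :=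
  continuous_pi fun i => by fin_cases i <;> simp [pt] <;> fun_prop

/-! ### Two parameters: rectangles and the curl -/

namespace SuperMap

variable {𝕜 : Type k} [RCLike 𝕜] {L : NQManifold.{v} 𝕜} {M : NQManifold.{u} 𝕜}
variable {S : Set (Fin 2 → ℝ)} {H : SuperMap S L M} {V : Opens L.B} {U : Opens M.B}
variable {R : ℕ} {κ : L.Coords} {x : L.B} {s₀ s₁ t₀ t₁ : ℝ}

/-- A rectangle in the plane. -/
def _root_.rect (s₀ s₁ t₀ t₁ : ℝ) : Set (Fin 2 → ℝ) :=
  (fun q : ℝ × ℝ => pt q.1 q.2) '' (Set.Icc s₀ s₁ ×ˢ Set.Icc t₀ t₁)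

theorem _root_.isCompact_rect : IsCompact (rect s₀ s₁ t₀ t₁) :=
  (isCompact_Icc.prod isCompact_Icc).image continuous_pt

theorem _root_.pt_mem_rect {s t : ℝ} (hs : s ∈ Set.Icc s₀ s₁) (ht : t ∈ Set.Icc t₀ t₁) :
    pt s t ∈ rect s₀ s₁ t₀ t₁ := ⟨(s, t), ⟨hs, ht⟩, rfl⟩

/-- The `θ₀ θ₁`-component of the pull-back of `Q a` is the curl of the components of the pull-back
of `a`. -/
theorem MapsInto.exists_curl (h : H.MapsInto (rect s₀ s₁ t₀ t₁) V U) (hR : L.Admissible R)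
    (hx : x ∈ V) (hκ : x ∈ κ.V) (a : M.O U) {I : MonoIdx κ.deg} (hI : I.total ≤ R) {s t : ℝ}
    (hs : s ∈ Set.Icc s₀ s₁) (ht : t ∈ Set.Icc t₀ t₁) :
    ∃ c c' : 𝕜,
      HasDerivWithinAt (fun s => κ.coeff (H.pull (pt s t) U V a {1}) I x) c (Set.Icc s₀ s₁) s ∧
      HasDerivWithinAt (fun t => κ.coeff (H.pull (pt s t) U V a {0}) I x) c' (Set.Icc t₀ t₁) t ∧
      κ.coeff (H.pull (pt s t) U V (M.Q U a) {0, 1}) I x = c - c' := by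
  obtain ⟨J, hJ, hZJ, V', hxV, hV', hJV⟩ := h.exists_nhds isCompact_rect hx
  have hm : ∀ p ∈ rect s₀ s₁ t₀ t₁, p ∈ J ∩ S := fun p hp => ⟨hZJ hp, (h p hp).1⟩
  have h1 := hasDerivWithinAt_pull hJ hJV (hasDerivAt_pt_left t)
    (fun s hs => hm _ (pt_mem_rect hs ht)) a {1} I hxV hκ hs
  have h2 := hasDerivWithinAt_pull hJ hJV (hasDerivAt_pt_right s)
    (fun t ht => hm _ (pt_mem_rect hs ht)) a {0} I hxV hκ ht
  refine ⟨_, _, h1.congr (fun s hs => (h.coeff_pull_res hV' hxV (pt_mem_rect hs ht) a _ κ I).symm)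
    (h.coeff_pull_res hV' hxV (pt_mem_rect hs ht) a _ κ I).symm,
    h2.congr (fun t ht => (h.coeff_pull_res hV' hxV (pt_mem_rect hs ht) a _ κ I).symm)
    (h.coeff_pull_res hV' hxV (pt_mem_rect hs ht) a _ κ I).symm, ?_⟩
  have h3 := H.pull_Q J hJ U V' hJV a {0, 1} _ (hm _ (pt_mem_rect hs ht)) κ I x
  have e0 : ({0, 1} : Finset (Fin 2)).erase 0 = {1} := by decide
  have e1 : ({0, 1} : Finset (Fin 2)).erase 1 = {0} := by decide
  have g0 : grassmannSign ({0} : Finset (Fin 2)) {1} = 1 := by decide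
  have g1 : grassmannSign ({1} : Finset (Fin 2)) {0} = -1 := by decide
  rw [hR.coeff_Q κ _ hI, Finset.sum_pair (by decide), e0, e1, g0, g1] at h3
  rw [← h.coeff_pull_res hV' hxV (pt_mem_rect hs ht), h3]
  push_cast
  ring

end SuperMap

/-! ### Identities between the matrices of a representation -/

namespace GradedModuleSheaf

open GradedSpace MulOpposite

variable {𝕜 : Type k} [RCLike 𝕜] {M : NQManifold.{u} 𝕜} {E : GradedModuleSheaf.{u, w} M}

/-- The section with the components `f` in a trivialization. -/
def Triv.lin (e : E.Triv) {U' : Opens M.B} (h : U' ≤ e.U) (f : Fin e.r → M.O U') : E.Γ U' :=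
  ∑ α, op (f α) • E.res h (e.ζ α)

theorem Triv.lin_inj (e : E.Triv) {U' : Opens M.B} (h : U' ≤ e.U) {f g : Fin e.r → M.O U'}
    (hfg : e.lin h f = e.lin h g) : f = g :=
  (e.basis U' h (e.lin h f)).unique rfl hfg

theorem Triv.lin_res (e : E.Triv) {U' U'' : Opens M.B} (h : U' ≤ e.U) (h' : U'' ≤ U')
    (f : Fin e.r → M.O U') :
    E.res h' (e.lin h f) = e.lin (h'.trans h) fun α => M.res h' (f α) := by
  simp only [lin, map_sum, E.res_smul, E.res_res]

theorem Triv.lin_add (e : E.Triv) {U' : Opens M.B} (h : U' ≤ e.U) (f g : Fin e.r → M.O U') :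
    e.lin h (f + g) = e.lin h f + e.lin h g := by
  simp only [lin, Pi.add_apply, op_add, add_smul, Finset.sum_add_distrib]

theorem Triv.lin_zero (e : E.Triv) {U' : Opens M.B} (h : U' ≤ e.U) : e.lin h 0 = 0 := by
  simp [lin]

theorem Triv.lin_smul (e : E.Triv) {U' : Opens M.B} (h : U' ≤ e.U) (f : Fin e.r → M.O U')
    (a : M.O U') : op a • e.lin h f = e.lin h fun α => f α * a := by
  simp only [lin, Finset.smul_sum, smul_smul, op_mul]

theorem Triv.lin_sum (e : E.Triv) {U' : Opens M.B} (h : U' ≤ e.U) {J : Type*} (s : Finset J)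
    (f : J → Fin e.r → M.O U') : ∑ j ∈ s, e.lin h (f j) = e.lin h (∑ j ∈ s, f j) := by
  classical
  induction s using Finset.induction_on with
  | empty => simp [lin_zero]
  | insert j s hj ih => rw [Finset.sum_insert hj, Finset.sum_insert hj, ih, lin_add]

theorem Triv.lin_single (e : E.Triv) {U' : Opens M.B} (h : U' ≤ e.U) (α : Fin e.r) :
    e.lin h (Pi.single α 1) = E.res h (e.ζ α) := by
  rw [lin, Finset.sum_eq_single α]
  · rw [Pi.single_eq_same, op_one, one_smul]
  · intro β _ hβ
    rw [Pi.single_eq_of_ne hβ, op_zero, zero_smul]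
  · simp

instance decompositionLev (U : Opens M.B) : DirectSum.Decomposition (E.lev U) :=
  (E.internal U).chooseDecomposition

/-- The component of integer degree `i` of a function. -/
def compZ {V : Opens M.B} (i : ℤ) (a : M.O V) : M.O V := if 0 ≤ i then comp i.toNat a else 0

theorem compZ_mem {V : Opens M.B} (i : ℤ) (a : M.O V) : compZ i a ∈ M.degZ V i := by
  unfold compZ degZ
  split_ifs
  · exact comp_mem _ a
  · exact zero_mem _

/-- A homogeneous section only shifts the degrees of its coefficient by its level. -/
theorem decompose_smul {U : Opens M.B} {l : ℤ} {s : E.Γ U} (hs : s ∈ E.lev U l) (a : M.O U) (i : ℤ) :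
    (DirectSum.decompose (E.lev U) (op a • s) i : E.Γ U) = op (compZ (i - l) a) • s := by
  induction a using homogeneous_induction with
  | zero =>
    have : compZ (i - l) (0 : M.O U) = 0 := by
      unfold compZ
      split_ifs
      exacts [comp_zero _, rfl]
    rw [this, op_zero, zero_smul, DirectSum.decompose_zero]
    rfl
  | add a b ha hb =>
    have : compZ (i - l) (a + b) = compZ (i - l) a + compZ (i - l) b := by
      unfold compZ
      split_ifs
      exacts [comp_add _ _ _, (add_zero _).symm]
    rw [this, op_add, op_add, add_smul, add_smul, DirectSum.decompose_add, ← ha, ← hb]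
    rfl
  | hom n a ha =>
    have hm := E.smul_mem U l n s a hs ha
    by_cases hi : l + n = i
    · subst hi
      rw [DirectSum.decompose_of_mem_same _ hm]
      congr 2
      rw [show l + (n : ℤ) - l = n by ring]
      simp [compZ, comp_of_mem ha]
    · rw [DirectSum.decompose_of_mem_ne _ hm hi]
      have : compZ (i - l) a = 0 := by
        unfold compZ
        split_ifs with h
        · exact comp_of_mem_ne ha (by omega)
        · rfl
      rw [this, op_zero, zero_smul]

/-- The components of a homogeneous section are homogeneous. -/
theorem Triv.mem_of_lin_mem (e : E.Triv) {U' : Opens M.B} (h : U' ≤ e.U) {f : Fin e.r → M.O U'}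
    {i : ℤ} (hf : e.lin h f ∈ E.lev U' i) (α : Fin e.r) : f α ∈ M.degZ U' (i - e.lev α) := by
  -- Projecting the section to its own degree changes nothing, so by uniqueness each component
  -- equals its part of the expected degree.
  have h1 : e.lin h f = e.lin h fun α => compZ (i - e.lev α) (f α) := by
    have h2 := DirectSum.decompose_of_mem_same _ hf
    rw [← h2]
    conv_lhs => rw [lin]
    rw [DirectSum.decompose_sum, DFinsupp.finsetSum_apply, AddSubmonoidClass.coe_finsetSum]
    exact Finset.sum_congr rfl fun β _ => decompose_smul (E.res_mem h _ _ (e.ζ_mem β)) _ _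
  have h2 := congrFun (e.lin_inj h h1) α
  rw [h2]
  exact compZ_mem _ _

end GradedModuleSheaf

namespace QBundle

open GradedSpace MulOpposite GradedModuleSheaf

variable {𝕜 : Type k} [RCLike 𝕜] {M : NQManifold.{u} 𝕜} {E : QBundle.{u, w} M}

/-- The diagonal matrix of the signs of the levels. -/
def sgn {m : Type*} [DecidableEq m] (lev : m → ℤ) (A : Type*) [Ring A] : Matrix m m A :=
  Matrix.diagonal fun α => (((lev α).negOnePow : ℤ) : A)

theorem lin_qmat (e : E.Triv) {U' : Opens M.B} (h : U' ≤ e.U) (α : Fin e.r) :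
    E.Qhat U' (E.res h (e.ζ α)) = e.lin h fun β => M.res h (qmat e β α) := by
  rw [E.Qhat_res]
  have h1 : E.Qhat e.U (e.ζ α) = e.lin le_rfl fun β => qmat e β α :=
    (e.basis e.U le_rfl (E.Qhat e.U (e.ζ α))).choose_spec.1
  rw [h1, e.lin_res]

theorem lin_transMat (e e' : E.Triv) {U' : Opens M.B} (h : U' ≤ e.U ⊓ e'.U) (α : Fin e'.r) :
    E.res (h.trans inf_le_right) (e'.ζ α) =
      e.lin (h.trans inf_le_left) fun β => M.res h (transMat e e' β α) := by
  have h1 : E.res inf_le_right (e'.ζ α) = e.lin inf_le_left fun β => transMat e e' β α :=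
    (e.basis (e.U ⊓ e'.U) inf_le_left (E.res inf_le_right (e'.ζ α))).choose_spec.1
  rw [← E.res_res inf_le_right h, h1, e.lin_res]

theorem qmat_mem (e : E.Triv) (β α : Fin e.r) :
    qmat e β α ∈ M.degZ e.U (e.lev α + 1 - e.lev β) := by
  have h1 := lin_qmat e le_rfl α
  have h2 := e.mem_of_lin_mem le_rfl (f := fun β => M.res le_rfl (qmat e β α)) (i := e.lev α + 1)
    (h1 ▸ E.Qhat_mem _ _ _ (E.res_mem _ _ _ (e.ζ_mem α))) β
  simpa only [M.res_refl] using h2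

theorem transMat_mem (e e' : E.Triv) (β : Fin e.r) (α : Fin e'.r) :
    transMat e e' β α ∈ M.degZ (e.U ⊓ e'.U) (e'.lev α - e.lev β) := by
  have h1 := lin_transMat e e' le_rfl α
  have h2 := e.mem_of_lin_mem inf_le_left (f := fun β => M.res le_rfl (transMat e e' β α))
    (i := e'.lev α) (h1 ▸ E.res_mem _ _ _ (e'.ζ_mem α)) β
  simpa only [M.res_refl] using h2

theorem transMat_self (e : E.Triv) {U' : Opens M.B} (h : U' ≤ e.U ⊓ e.U) :
    (transMat e e).map (M.res h) = 1 := by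
  ext β α
  have h1 := lin_transMat e e h α
  rw [← e.lin_single] at h1
  have := congrFun (e.lin_inj _ h1) β
  rw [Matrix.map_apply, ← this, Matrix.one_apply, Pi.single_apply]

/-- The cocycle rule: both sides are the components of the generators of `e''` in `e`, which are
unique. -/
theorem transMat_mul (e e' e'' : E.Triv) {U' : Opens M.B} (h : U' ≤ e.U ⊓ e'.U)
    (h' : U' ≤ e'.U ⊓ e''.U) (h'' : U' ≤ e.U ⊓ e''.U) :
    (transMat e e').map (M.res h) * (transMat e' e'').map (M.res h') =
      (transMat e e'').map (M.res h'') := by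
  ext β α
  have h1 := lin_transMat e e'' h'' α
  have h2 := lin_transMat e' e'' h' α
  rw [h2] at h1
  conv_lhs at h1 => rw [Triv.lin]
  simp only [lin_transMat e e' h, Triv.lin_smul, Triv.lin_sum] at h1
  have := congrFun (e.lin_inj _ h1) β
  rw [Finset.sum_apply] at this
  rw [Matrix.mul_apply, Matrix.map_apply, ← this]
  rfl

theorem Qhat_lin (e : E.Triv) {U' : Opens M.B} (h : U' ≤ e.U) (f : Fin e.r → M.O U') :
    E.Qhat U' (e.lin h f) = e.lin h fun γ => (∑ β, M.res h (qmat e γ β) * f β) +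
      ((e.lev γ).negOnePow : ℤ) * M.Q U' (f γ) := by
  have h1 : ∀ β, E.Qhat U' (op (f β) • E.res h (e.ζ β)) =
      e.lin h (fun γ => M.res h (qmat e γ β) * f β) +
        op (((e.lev β).negOnePow : ℤ) * M.Q U' (f β)) • E.res h (e.ζ β) := by
    intro β
    rw [E.Qhat_smul U' _ _ _ (E.res_mem h _ _ (e.ζ_mem β)), lin_qmat, e.lin_smul]
    congr 1
    rcases Int.units_eq_one_or (e.lev β).negOnePow with h | h <;> simp [h]
  conv_lhs => rw [Triv.lin, map_sum]
  simp only [h1, Finset.sum_add_distrib, Triv.lin_sum]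
  have h2 : ∑ β, op (((e.lev β).negOnePow : ℤ) * M.Q U' (f β)) • E.res h (e.ζ β) =
    e.lin h fun β => ((e.lev β).negOnePow : ℤ) * M.Q U' (f β) := rfl
  rw [h2, ← e.lin_add]
  congr 1
  ext γ
  simp

/-- The square of `Qhat` is zero. -/
theorem qmat_mul_qmat (e : E.Triv) :
    qmat e * qmat e + sgn e.lev (M.O e.U) * (qmat e).map (M.Q e.U) = 0 := by
  ext γ α
  have h1 := lin_qmat e le_rfl α
  have h2 := E.Qhat_Qhat e.U (E.res le_rfl (e.ζ α))
  rw [h1, Qhat_lin, ← e.lin_zero le_rfl] at h2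
  have := congrFun (e.lin_inj _ h2) γ
  simp only [M.res_refl] at this
  rw [Matrix.add_apply, sgn, Matrix.diagonal_mul, Matrix.mul_apply, Matrix.map_apply]
  exact this

/-- The matrices of `Qhat` in two trivializations. -/
theorem qmat_mul_transMat (e e' : E.Triv) {U' : Opens M.B} (h : U' ≤ e.U ⊓ e'.U) :
    (qmat e).map (M.res (h.trans inf_le_left)) * (transMat e e').map (M.res h) +
      sgn e.lev (M.O U') * ((transMat e e').map (M.res h)).map (M.Q U') =
    (transMat e e').map (M.res h) * (qmat e').map (M.res (h.trans inf_le_right)) := by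
  ext γ α
  have h1 := lin_qmat e' (h.trans inf_le_right) α
  rw [lin_transMat e e' h, Qhat_lin] at h1
  conv_rhs at h1 => rw [Triv.lin]
  simp only [lin_transMat e e' h, Triv.lin_smul, Triv.lin_sum] at h1
  have := congrFun (e.lin_inj _ h1) γ
  rw [Matrix.add_apply, sgn, Matrix.diagonal_mul, Matrix.mul_apply, Matrix.mul_apply]
  rw [Finset.sum_apply] at this
  exact this

end QBundle

/-! ### Pull-backs of matrices -/

open NQManifold GradedSpace QBundle

section Sign

variable {m n A : Type*} [Fintype m] [DecidableEq m] [Ring A]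

theorem QBundle.sgn_mul_sgn (lev : m → ℤ) : sgn lev A * sgn lev A = 1 := by
  rw [sgn, Matrix.diagonal_mul_diagonal, ← Matrix.diagonal_one]
  congr 1
  ext α
  rw [← Int.cast_mul, ← Units.val_mul, Int.units_mul_self, Units.val_one, Int.cast_one]

theorem QBundle.sgn_mul_sgn_mul (lev : m → ℤ) (B : Matrix m n A) :
    sgn lev A * (sgn lev A * B) = B := by
  rw [← Matrix.mul_assoc, sgn_mul_sgn, Matrix.one_mul]

theorem QBundle.repMat_eq {𝕜 : Type k} [RCLike 𝕜] {M : NQManifold.{u} 𝕜} {E : QBundle.{u, w} M}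
    (e : E.Triv) : repMat e = sgn e.lev (M.O e.U) * qmat e := by
  ext β α
  rw [sgn, Matrix.diagonal_mul]
  rcases Int.units_eq_one_or (e.lev β).negOnePow with h | h <;> simp [repMat, h]

end Sign

namespace SuperMap

variable {𝕜 : Type k} [RCLike 𝕜] {L : NQManifold.{v} 𝕜} {M : NQManifold.{u} 𝕜} {d : ℕ}
variable {S : Set (Fin d → ℝ)} (H : SuperMap S L M)
variable {V : Opens L.B} {U : Opens M.B} {Z : Set (Fin d → ℝ)} {p : Fin d → ℝ}
variable {m n o : Type*}

/-- The `θ_K`-components at the point `p` of the pull-back of a matrix of functions. -/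
def pullM (p : Fin d → ℝ) (V : Opens L.B) (K : Finset (Fin d)) (A : Matrix m n (M.O U)) :
    Matrix m n (L.O V) := A.map fun a => H.pull p U V a K

variable {H}

theorem MapsInto.pullM_res_left (h : H.MapsInto Z V U) (hp : p ∈ Z) {U' : Opens M.B} (hU : U ≤ U')
    (K : Finset (Fin d)) (A : Matrix m n (M.O U')) :
    H.pullM p V K (A.map (M.res hU)) = H.pullM p V K A := by
  ext α β
  exact congrFun (H.pull_res_left p (h p hp).1 U' U V hU (h p hp).2 (A α β)) K

theorem MapsInto.pullM_res_right (h : H.MapsInto Z V U) (hp : p ∈ Z) {V' : Opens L.B} (hV : V' ≤ V)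
    (K : Finset (Fin d)) (A : Matrix m n (M.O U)) :
    (H.pullM p V K A).map (L.res hV) = H.pullM p V' K A := by
  ext α β
  exact (H.pull_res_right p (h p hp).1 U V V' hV (h p hp).2 (A α β) K).symm

theorem pullM_add (K : Finset (Fin d)) (A B : Matrix m n (M.O U)) :
    H.pullM p V K (A + B) = H.pullM p V K A + H.pullM p V K B := by
  ext α β
  simp [pullM]

theorem pullM_zero (K : Finset (Fin d)) : H.pullM p V K (0 : Matrix m n (M.O U)) = 0 := by
  ext α β
  simp [pullM]

theorem MapsInto.pullM_one [DecidableEq m] (h : H.MapsInto Z V U) (hp : p ∈ Z) :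
    H.pullM p V ∅ (1 : Matrix m m (M.O U)) = 1 := by
  ext α β
  have := congrFun (H.pull_one p (h p hp).1 U V (h p hp).2) ∅
  by_cases hαβ : α = β
  · subst hαβ
    simpa [pullM] using this
  · simp [pullM, hαβ]

theorem pullM_sgn_mul [Fintype m] [DecidableEq m] (lev : m → ℤ) (K : Finset (Fin d))
    (A : Matrix m n (M.O U)) :
    H.pullM p V K (sgn lev (M.O U) * A) = sgn lev (L.O V) * H.pullM p V K A := by
  ext α β
  rw [sgn, sgn, Matrix.diagonal_mul]
  simp only [pullM, Matrix.map_apply, Matrix.diagonal_mul]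
  rw [← zsmul_eq_mul, ← zsmul_eq_mul, map_zsmul]
  rfl

theorem MapsInto.pull_mem (h : H.MapsInto Z V U) (hp : p ∈ Z) {i : ℤ} {a : M.O U}
    (ha : a ∈ M.degZ U i) (K : Finset (Fin d)) : H.pull p U V a K ∈ L.degZ V (i - K.card) := by
  rcases mem_degZ_cases ha with rfl | ⟨n, rfl, ha⟩
  · rw [map_zero]
    exact zero_mem _
  · exact H.pull_mem p (h p hp).1 U V (h p hp).2 n a ha K

theorem MapsInto.pull_mul_empty (h : H.MapsInto Z V U) (hp : p ∈ Z) (a b : M.O U) :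
    H.pull p U V (a * b) ∅ = H.pull p U V a ∅ * H.pull p U V b ∅ := by
  induction a using homogeneous_induction with
  | zero => simp
  | add a a' ha ha' => rw [add_mul, map_add, map_add, Pi.add_apply, Pi.add_apply, ha, ha', add_mul]
  | hom i a ha =>
    rw [H.pull_mul p (h p hp).1 U V (h p hp).2 i a b ha]
    simp [grassmannSign_empty_left]

theorem MapsInto.pull_mul_singleton (h : H.MapsInto Z V U) (hp : p ∈ Z) (j : Fin d) {i : ℤ}
    {a : M.O U} (ha : a ∈ M.degZ U i) (b : M.O U) :
    H.pull p U V (a * b) {j} = H.pull p U V a {j} * H.pull p U V b ∅ +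
      (i.negOnePow : ℤ) • (H.pull p U V a ∅ * H.pull p U V b {j}) := by
  rcases mem_degZ_cases ha with rfl | ⟨n, rfl, ha⟩
  · simp
  · rw [H.pull_mul p (h p hp).1 U V (h p hp).2 n a b ha]
    have : ({j} : Finset (Fin d)).powerset = {∅, {j}} := by
      ext s
      simp [Finset.subset_singleton_iff]
    rw [this, Finset.sum_pair (by simp)]
    simp only [Finset.sdiff_empty, Finset.card_empty, Finset.card_singleton, sdiff_self,
      grassmannSign_empty_left, grassmannSign_empty_right, Finset.bot_eq_empty]
    rw [add_comm]
    congr 1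
    · simp
    · simp [Int.negOnePow_def]

theorem MapsInto.pullM_mul_empty [Fintype n] (h : H.MapsInto Z V U) (hp : p ∈ Z) (A : Matrix m n (M.O U))
    (B : Matrix n o (M.O U)) :
    H.pullM p V ∅ (A * B) = H.pullM p V ∅ A * H.pullM p V ∅ B := by
  ext α γ
  simp only [pullM, Matrix.map_apply, Matrix.mul_apply, map_sum, Finset.sum_apply,
    h.pull_mul_empty hp]

theorem _root_.Int.negOnePow_sub_add (a b c : ℤ) : ((a - b + c).negOnePow : ℤ) =
    (c.negOnePow : ℤ) * ((b.negOnePow : ℤ) * (a.negOnePow : ℤ)) := by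
  rw [Int.negOnePow_add, Int.negOnePow_sub]
  push_cast
  ring

variable [Fintype m] [DecidableEq m] [Fintype n] [DecidableEq n]

/-- Moving `θ_j` past an entry of `A` costs the parity of its degree `l' β - l α + c`, which factors
into a global sign and diagonal sign matrices on the two sides. The normalization of `T` absorbs
these diagonal matrices. -/
theorem MapsInto.pullM_mul_singleton (h : H.MapsInto Z V U) (hp : p ∈ Z) (j : Fin d)
    {l : m → ℤ} {l' : n → ℤ} (c : ℤ) {A : Matrix m n (M.O U)}
    (hA : ∀ α β, A α β ∈ M.degZ U (l' β - l α + c)) (B : Matrix n o (M.O U)) :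
    H.pullM p V {j} (A * B) = H.pullM p V {j} A * H.pullM p V ∅ B + (c.negOnePow : ℤ) •
      (sgn l (L.O V) * (H.pullM p V ∅ A * (sgn l' (L.O V) * H.pullM p V {j} B))) := by
  ext α γ
  have hL : H.pullM p V {j} (A * B) α γ = ∑ β, H.pull p U V (A α β * B β γ) {j} := by
    simp [pullM, Matrix.mul_apply]
  rw [hL, Matrix.add_apply, Matrix.smul_apply, sgn, Matrix.diagonal_mul, Matrix.mul_apply,
    Matrix.mul_apply, Finset.mul_sum, Finset.smul_sum, ← Finset.sum_add_distrib]
  simp only [h.pull_mul_singleton hp j (hA _ _), sgn, Matrix.diagonal_mul]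
  refine Finset.sum_congr rfl fun β _ => ?_
  congr 1
  rw [Int.negOnePow_sub_add, mul_smul, mul_smul]
  simp only [← zsmul_eq_mul, mul_smul_comm]
  rw [smul_comm ((l' β).negOnePow : ℤ)]
  rfl

variable {E : QBundle.{u, w} M} {e e' : E.Triv}

theorem _root_.QBundle.qmat_mem' (e : E.Triv) (α β : Fin e.r) :
    qmat e α β ∈ M.degZ e.U (e.lev β - e.lev α + 1) := by
  have := qmat_mem e α β
  rwa [show e.lev β + 1 - e.lev α = e.lev β - e.lev α + 1 by ring] at this

/-- The matrix of `Qhat` at a point. -/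
abbrev D₀ (H : SuperMap S L M) (p : Fin d → ℝ) (V : Opens L.B) (e : E.Triv) :
    Matrix (Fin e.r) (Fin e.r) (L.O V) := H.pullM p V ∅ (qmat e)

/-- The connection in the direction `j` at a point. -/
abbrev conn (H : SuperMap S L M) (j : Fin d) (p : Fin d → ℝ) (V : Opens L.B) (e : E.Triv) :
    Matrix (Fin e.r) (Fin e.r) (L.O V) := H.pullM p V {j} (repMat e)

/-- The transition matrix at a point. -/
abbrev trans (H : SuperMap S L M) (p : Fin d → ℝ) (V : Opens L.B) (e e' : E.Triv) :
    Matrix (Fin e.r) (Fin e'.r) (L.O V) := H.pullM p V ∅ (transMat e e')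

/-- The normalized `θ_j`-component of the transition matrix at a point. -/
abbrev trans₁ (H : SuperMap S L M) (j : Fin d) (p : Fin d → ℝ) (V : Opens L.B) (e e' : E.Triv) :
    Matrix (Fin e.r) (Fin e'.r) (L.O V) :=
  H.pullM p V {j} (sgn e.lev (M.O (e.U ⊓ e'.U)) * transMat e e')

/-- The `θ_j`-component of `Qhat ^ 2 = 0`. In an admissible truncation the left side is the
derivative in direction `j`, so this is covariant constancy of the differential. -/
theorem MapsInto.pullM_Q_qmat_singleton (h : H.MapsInto Z V e.U) (hp : p ∈ Z) (j : Fin d) :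
    H.pullM p V {j} ((qmat e).map (M.Q e.U)) =
      H.D₀ p V e * H.conn j p V e - H.conn j p V e * H.D₀ p V e := by
  have h1 := congrArg (H.pullM p V {j}) (qmat_mul_qmat e)
  rw [pullM_add, pullM_zero, h.pullM_mul_singleton hp j 1 (qmat_mem' e), pullM_sgn_mul] at h1
  have h2 := congrArg (fun X => sgn e.lev (L.O V) * X) (eq_neg_of_add_eq_zero_right h1)
  simp only [sgn_mul_sgn_mul] at h2
  rw [h2, conn, repMat_eq, pullM_sgn_mul]
  simp only [Int.negOnePow_one, Units.val_neg, Units.val_one, neg_smul, one_smul, mul_neg, mul_add,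
    sgn_mul_sgn_mul, neg_add, neg_neg, Matrix.mul_assoc]
  abel

/-- The left side is invisible in admissible truncations by `coeff_pull_Q_empty`; there the identity
says that transition matrices are chain maps. -/
theorem MapsInto.pullM_Q_transMat_empty (h : H.MapsInto Z V e.U) (h' : H.MapsInto Z V e'.U)
    (hp : p ∈ Z) : H.pullM p V ∅ ((transMat e e').map (M.Q (e.U ⊓ e'.U))) =
      sgn e.lev (L.O V) * (H.trans p V e e' * H.D₀ p V e' - H.D₀ p V e * H.trans p V e e') := by
  have hh := h.inf h'
  have h1 := congrArg (H.pullM p V ∅) (qmat_mul_transMat e e' le_rfl)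
  rw [pullM_add, pullM_sgn_mul, hh.pullM_mul_empty hp, hh.pullM_mul_empty hp,
    hh.pullM_res_left hp, hh.pullM_res_left hp, hh.pullM_res_left hp] at h1
  have h3 : (transMat e e').map (M.res le_rfl) = transMat e e' := by
    ext
    exact M.res_refl _
  rw [h3] at h1
  rw [← sgn_mul_sgn_mul e.lev (H.pullM p V ∅ ((transMat e e').map (M.Q (e.U ⊓ e'.U)))),
    eq_sub_of_add_eq' h1]

/-- The first two terms are the usual gauge transformation rule. The terms with `trans₁` are its
failure, a null-homotopic term, and are the origin of the matrix `N` in the covariance statement. -/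
theorem MapsInto.pullM_Q_transMat_singleton (h : H.MapsInto Z V e.U) (h' : H.MapsInto Z V e'.U)
    (hp : p ∈ Z) (j : Fin d) : H.pullM p V {j} ((transMat e e').map (M.Q (e.U ⊓ e'.U))) =
      H.trans p V e e' * H.conn j p V e' - H.conn j p V e * H.trans p V e e' +
        H.D₀ p V e * H.trans₁ j p V e e' + H.trans₁ j p V e e' * H.D₀ p V e' := by
  have hh := h.inf h'
  have h1 := congrArg (H.pullM p V {j}) (qmat_mul_transMat e e' le_rfl)
  have h3 : (transMat e e').map (M.res le_rfl) = transMat e e' := by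
    ext
    exact M.res_refl _
  rw [h3, pullM_add, hh.pullM_mul_singleton hp j 1 (l := e.lev) (l' := e.lev)
      (A := (qmat e).map (M.res _)) (fun α β => degZ_res _ (qmat_mem' e α β)),
    hh.pullM_mul_singleton hp j 0 (l := e.lev) (l' := e'.lev)
      (A := transMat e e') (fun α β => by simpa using transMat_mem e e' α β), pullM_sgn_mul,
    hh.pullM_res_left hp, hh.pullM_res_left hp, hh.pullM_res_left hp, hh.pullM_res_left hp] at h1
  rw [← sgn_mul_sgn_mul e.lev (H.pullM p V {j} ((transMat e e').map (M.Q (e.U ⊓ e'.U)))),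
    eq_sub_of_add_eq' h1, conn, repMat_eq, conn, repMat_eq, trans₁]
  simp only [pullM_sgn_mul, Int.negOnePow_one, Int.negOnePow_zero, Units.val_neg, Units.val_one,
    neg_smul, one_smul, Matrix.mul_neg, Matrix.mul_add, Matrix.mul_sub, sgn_mul_sgn_mul, Matrix.mul_assoc]
  abel

end SuperMap

/-! ### The component in both odd directions: curvature -/

namespace SuperMap

variable {𝕜 : Type k} [RCLike 𝕜] {L : NQManifold.{v} 𝕜} {M : NQManifold.{u} 𝕜}
variable {S : Set (Fin 2 → ℝ)} {H : SuperMap S L M}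
variable {V : Opens L.B} {U : Opens M.B} {Z : Set (Fin 2 → ℝ)} {p : Fin 2 → ℝ}

theorem MapsInto.pull_mul_pair (h : H.MapsInto Z V U) (hp : p ∈ Z) {i : ℤ}
    {a : M.O U} (ha : a ∈ M.degZ U i) (b : M.O U) :
    H.pull p U V (a * b) {0, 1} = H.pull p U V a ∅ * H.pull p U V b {0, 1} +
      H.pull p U V a {0, 1} * H.pull p U V b ∅ -
      (i.negOnePow : ℤ) • (H.pull p U V a {0} * H.pull p U V b {1} -
        H.pull p U V a {1} * H.pull p U V b {0}) := by
  rcases mem_degZ_cases ha with rfl | ⟨n, rfl, ha⟩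
  · simp
  · rw [H.pull_mul p (h p hp).1 U V (h p hp).2 n a b ha]
    have h0 : ({0, 1} : Finset (Fin 2)).powerset = {∅, {0}, {1}, {0, 1}} := by decide
    have h1 : ({0, 1} : Finset (Fin 2)) \ {0} = {1} := by decide
    have h2 : ({0, 1} : Finset (Fin 2)) \ {1} = {0} := by decide
    have g0 : grassmannSign ({0} : Finset (Fin 2)) {1} = 1 := by decide
    have g1 : grassmannSign ({1} : Finset (Fin 2)) {0} = -1 := by decide
    have h3 : ({0, 1} : Finset (Fin 2)).card = 2 := by decide
    rw [h0, Finset.sum_insert (by decide), Finset.sum_insert (by decide),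
      Finset.sum_pair (by decide), h1, h2, g0, g1, Finset.sdiff_empty, sdiff_self,
      Finset.bot_eq_empty, grassmannSign_empty_left, grassmannSign_empty_right]
    have hn : ((n : ℤ).negOnePow : ℤ) = (-1) ^ n := by simp [Int.negOnePow_def]
    simp only [h3, hn, Finset.card_empty, Finset.card_singleton, mul_zero, pow_zero, mul_one,
      add_zero, one_mul, pow_succ, pow_mul]
    rcases neg_one_pow_eq_or ℤ n with h | h <;> simp [h] <;> abel

variable {m n o : Type*} [Fintype m] [DecidableEq m] [Fintype n] [DecidableEq n]

theorem MapsInto.pullM_mul_pair (h : H.MapsInto Z V U) (hp : p ∈ Z)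
    {l : m → ℤ} {l' : n → ℤ} (c : ℤ) {A : Matrix m n (M.O U)}
    (hA : ∀ α β, A α β ∈ M.degZ U (l' β - l α + c)) (B : Matrix n o (M.O U)) :
    H.pullM p V {0, 1} (A * B) = H.pullM p V ∅ A * H.pullM p V {0, 1} B +
      H.pullM p V {0, 1} A * H.pullM p V ∅ B - (c.negOnePow : ℤ) • (sgn l (L.O V) *
        (H.pullM p V {0} A * (sgn l' (L.O V) * H.pullM p V {1} B) -
          H.pullM p V {1} A * (sgn l' (L.O V) * H.pullM p V {0} B))) := by
  ext α γ
  have hL : H.pullM p V {0, 1} (A * B) α γ = ∑ β, H.pull p U V (A α β * B β γ) {0, 1} := by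
    simp [pullM, Matrix.mul_apply]
  rw [hL, Matrix.sub_apply, Matrix.add_apply, Matrix.smul_apply, sgn, Matrix.diagonal_mul,
    Matrix.sub_apply, Matrix.mul_apply, Matrix.mul_apply, Matrix.mul_apply, Matrix.mul_apply,
    ← Finset.sum_sub_distrib, Finset.mul_sum, Finset.smul_sum, ← Finset.sum_add_distrib,
    ← Finset.sum_sub_distrib]
  simp only [h.pull_mul_pair hp (hA _ _), sgn, Matrix.diagonal_mul]
  refine Finset.sum_congr rfl fun β _ => ?_
  congr 1
  rw [Int.negOnePow_sub_add, mul_smul, mul_smul]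
  simp only [← zsmul_eq_mul, mul_smul_comm, smul_sub]
  rfl

variable {E : QBundle.{u, w} M} {e : E.Triv}

/-- The curvature of the connection. -/
theorem MapsInto.pullM_Q_repMat_pair (h : H.MapsInto Z V e.U) (hp : p ∈ Z) :
    H.pullM p V {0, 1} ((repMat e).map (M.Q e.U)) =
      H.conn 1 p V e * H.conn 0 p V e - H.conn 0 p V e * H.conn 1 p V e -
        (H.D₀ p V e * H.pullM p V {0, 1} (qmat e) + H.pullM p V {0, 1} (qmat e) * H.D₀ p V e) := by
  have h0 : (repMat e).map (M.Q e.U) = sgn e.lev (M.O e.U) * (qmat e).map (M.Q e.U) := by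
    rw [repMat_eq]
    ext α β
    rw [sgn, Matrix.map_apply, Matrix.diagonal_mul, Matrix.diagonal_mul, Matrix.map_apply,
      ← zsmul_eq_mul, ← zsmul_eq_mul, map_zsmul]
  have h1 := congrArg (H.pullM p V {0, 1}) (qmat_mul_qmat e)
  rw [pullM_add, pullM_zero, h.pullM_mul_pair hp 1 (qmat_mem' e)] at h1
  rw [h0, eq_neg_of_add_eq_zero_right h1, conn, conn, repMat_eq]
  simp only [pullM_sgn_mul, Int.negOnePow_one, Units.val_neg, Units.val_one, neg_smul, one_smul,
    mul_sub, Matrix.mul_assoc]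
  abel

end SuperMap

/-! ### Linear differential equations for matrices -/

section MDeriv

variable {𝕜 : Type*} [RCLike 𝕜] {ι κ' ρ : Type*}

/-- Entrywise derivatives of matrices. -/
def MDeriv (F : ℝ → Matrix ι κ' 𝕜) (F' : Matrix ι κ' 𝕜) (s : Set ℝ) (t : ℝ) : Prop :=
  ∀ p q, HasDerivWithinAt (fun τ => F τ p q) (F' p q) s t

variable {F G : ℝ → Matrix ι κ' 𝕜} {F' G' : Matrix ι κ' 𝕜} {s : Set ℝ} {t : ℝ}

theorem MDeriv.add (hF : MDeriv F F' s t) (hG : MDeriv G G' s t) :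
    MDeriv (fun τ => F τ + G τ) (F' + G') s t := fun p q => (hF p q).add (hG p q)

theorem MDeriv.sub (hF : MDeriv F F' s t) (hG : MDeriv G G' s t) :
    MDeriv (fun τ => F τ - G τ) (F' - G') s t := fun p q => (hF p q).sub (hG p q)

theorem MDeriv.const (X : Matrix ι κ' 𝕜) : MDeriv (fun _ => X) 0 s t :=
  fun _ _ => hasDerivWithinAt_const _ _ _

theorem MDeriv.mul [Fintype κ'] (hF : MDeriv F F' s t) {K : ℝ → Matrix κ' ρ 𝕜} {K' : Matrix κ' ρ 𝕜}
    (hK : MDeriv K K' s t) : MDeriv (fun τ => F τ * K τ) (F' * K t + F t * K') s t := by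
  intro p q
  simp only [Matrix.mul_apply, Matrix.add_apply, ← Finset.sum_add_distrib]
  exact HasDerivWithinAt.fun_sum fun r _ => (hF p r).mul (hK r q)

theorem MDeriv.congr_deriv (hF : MDeriv F F' s t) (h : F' = G') : MDeriv F G' s t := h ▸ hF

end MDeriv

section ODE

variable {𝕜 : Type*} [RCLike 𝕜] {ι ι' ρ : Type*} [Fintype ι] [Fintype ι'] {a b : ℝ}

theorem eq_zero_of_MDeriv {A : ℝ → Matrix ι ι 𝕜}
    (hA : ∀ p q, ContinuousOn (fun t => A t p q) (Set.Icc a b)) {y : ℝ → Matrix ι ρ 𝕜}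
    (ha : y a = 0) (hy : ∀ t ∈ Set.Icc a b, MDeriv y (-(A t * y t)) (Set.Icc a b) t) :
    ∀ t ∈ Set.Icc a b, y t = 0 :=
  eq_zero_of_linear_ode hA ha fun t ht p q => hy t ht p q

/-- Parallel transport intertwines the values of a covariantly constant matrix. -/
theorem mul_transport [DecidableEq ι] {A D u : ℝ → Matrix ι ι 𝕜}
    (hA : ∀ p q, ContinuousOn (fun t => A t p q) (Set.Icc a b))
    (hD : ∀ t ∈ Set.Icc a b, MDeriv D (D t * A t - A t * D t) (Set.Icc a b) t) (hu0 : u a = 1)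
    (hu : ∀ t ∈ Set.Icc a b, MDeriv u (-(A t * u t)) (Set.Icc a b) t) :
    ∀ t ∈ Set.Icc a b, D t * u t = u t * D a := by
  intro t ht
  -- The difference satisfies the same equation `y' = -A y` as the transport and starts at zero.
  refine sub_eq_zero.1 (eq_zero_of_MDeriv hA (y := fun t => D t * u t - u t * D a) ?_ ?_ t ht)
  · simp only [hu0, Matrix.mul_one, Matrix.one_mul, sub_self]
  · intro t ht
    refine (((hD t ht).mul (hu t ht)).sub ((hu t ht).mul (.const (D a)))).congr_deriv ?_
    simp only [Matrix.mul_zero, Matrix.sub_mul, Matrix.mul_sub, Matrix.mul_neg, Matrix.neg_mul,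
      Matrix.mul_assoc]
    abel

/-- Transport along a homotopically covariantly constant matrix. -/
theorem transport_homotopy [DecidableEq ι] [DecidableEq ι'] (hab : a ≤ b)
    {A D u : ℝ → Matrix ι ι 𝕜} {A' D' u' : ℝ → Matrix ι' ι' 𝕜} {Ω N y : ℝ → Matrix ι ι' 𝕜}
    (hA : ∀ p q, ContinuousOn (fun t => A t p q) (Set.Icc a b))
    (hA' : ∀ p q, ContinuousOn (fun t => A' t p q) (Set.Icc a b))
    (hD : ∀ t ∈ Set.Icc a b, MDeriv D (D t * A t - A t * D t) (Set.Icc a b) t)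
    (hD' : ∀ t ∈ Set.Icc a b, MDeriv D' (D' t * A' t - A' t * D' t) (Set.Icc a b) t)
    (hΩ : ∀ t ∈ Set.Icc a b, MDeriv Ω (Ω t * A' t - A t * Ω t + D t * N t + N t * D' t)
      (Set.Icc a b) t)
    (hu0 : u a = 1) (hu : ∀ t ∈ Set.Icc a b, MDeriv u (-(A t * u t)) (Set.Icc a b) t)
    (hu0' : u' a = 1) (hu' : ∀ t ∈ Set.Icc a b, MDeriv u' (-(A' t * u' t)) (Set.Icc a b) t)
    (hy0 : y a = 0) (hy : ∀ t ∈ Set.Icc a b, MDeriv y (N t * u' t - A t * y t) (Set.Icc a b) t) :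
    Ω b * u' b - u b * Ω a = D b * y b + y b * D' a := by
  have hz := mul_transport hA' hD' hu0' hu'
  -- The difference of the two sides at time `t` again satisfies `y' = -A y`: the source terms leave
  -- `N (D' u' - u' D'(a))`, which vanishes by `hz`.
  refine sub_eq_zero.1 (eq_zero_of_MDeriv hA
    (y := fun t => Ω t * u' t - u t * Ω a - (D t * y t + y t * D' a)) ?_ ?_ b ⟨hab, le_rfl⟩)
  · simp only [hu0, hu0', hy0, Matrix.mul_one, Matrix.one_mul, Matrix.mul_zero, Matrix.zero_mul,
      sub_self, add_zero]
  · intro t ht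
    refine ((((hΩ t ht).mul (hu' t ht)).sub ((hu t ht).mul (.const (Ω a)))).sub
      (((hD t ht).mul (hy t ht)).add ((hy t ht).mul (.const (D' a))))).congr_deriv ?_
    simp only [Matrix.mul_zero, Matrix.sub_mul, Matrix.mul_sub, Matrix.mul_neg, Matrix.neg_mul,
      Matrix.mul_assoc, Matrix.add_mul, Matrix.mul_add, hz t ht]
    abel

end ODE

namespace NQManifold

open GradedSpace

variable {𝕜 : Type k} [RCLike 𝕜] {L : NQManifold.{v} 𝕜} {V : Opens L.B}

/-! ### Equality up to the differential of the test manifold -/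

section Agree

variable {m n o : Type*}

/-- Equality of all the coefficients which do not see the differential of `L`. -/
def Agree (X Y : Matrix m n (L.O V)) : Prop :=
  ∀ (κ : L.Coords) (R : ℕ), L.Admissible R → ∀ x ∈ V, x ∈ κ.V → κ.rep R x X = κ.rep R x Y

theorem Agree.of_eq {X Y : Matrix m n (L.O V)} (h : X = Y) : Agree X Y := fun _ _ _ _ _ _ => h ▸ rfl

theorem Agree.symm {X Y : Matrix m n (L.O V)} (h : Agree X Y) : Agree Y X :=
  fun κ R hR x hx hκ => (h κ R hR x hx hκ).symm

theorem Agree.trans {X Y Z : Matrix m n (L.O V)} (h : Agree X Y) (h' : Agree Y Z) : Agree X Z :=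
  fun κ R hR x hx hκ => (h κ R hR x hx hκ).trans (h' κ R hR x hx hκ)

theorem Agree.add {X Y X' Y' : Matrix m n (L.O V)} (h : Agree X Y) (h' : Agree X' Y') :
    Agree (X + X') (Y + Y') := fun κ R hR x hx hκ => by
  rw [Coords.rep_add, Coords.rep_add, h κ R hR x hx hκ, h' κ R hR x hx hκ]

theorem Agree.neg {X Y : Matrix m n (L.O V)} (h : Agree X Y) : Agree (-X) (-Y) :=
  fun κ R hR x hx hκ => by rw [Coords.rep_neg, Coords.rep_neg, h κ R hR x hx hκ]

theorem Agree.mul [Fintype n] {X Y : Matrix m n (L.O V)} (h : Agree X Y)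
    {X' Y' : Matrix n o (L.O V)} (h' : Agree X' Y') : Agree (X * X') (Y * Y') :=
  fun κ R hR x hx hκ => by
    rw [Coords.rep_mul hx hκ, Coords.rep_mul hx hκ, h κ R hR x hx hκ, h' κ R hR x hx hκ]

/-- If `Q` vanishes every truncation is admissible, so all coefficients are compared. -/
theorem Agree.eq {X Y : Matrix m n (L.O V)} (h : Agree X Y) (hQ : ∀ U, L.Q U = 0) : X = Y := by
  ext α β
  refine ext_coeff fun κ I x hx hκ => ?_
  have h1 := congrFun (congrFun (h κ I.total (Or.inr hQ) x hx hκ) (α, ⟨I, le_rfl⟩))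
    (β, κ.zeroIdx _)
  rwa [Coords.rep_apply_zero hx hκ, Coords.rep_apply_zero hx hκ] at h1

/-- For arbitrary `Q` the truncation `R = 0` remains and controls the values on the body, which is
all the Wilson loop depends on. -/
theorem Agree.val {X Y : Matrix m n (L.O V)} (h : Agree X Y) {x : L.B} (hx : x ∈ V) (α : m) (β : n) :
    L.val V (X α β) ⟨x, hx⟩ = L.val V (Y α β) ⟨x, hx⟩ := by
  obtain ⟨κ, hκ⟩ := L.locally_free x
  have h1 := congrFun (congrFun (h κ 0 (Or.inl rfl) x hx hκ) (α, κ.zeroIdx _)) (β, κ.zeroIdx _)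
  rw [Coords.rep_apply_zero hx hκ, Coords.rep_apply_zero hx hκ] at h1
  rwa [κ.val_eq_coeff _ hx hκ, κ.val_eq_coeff _ hx hκ]

end Agree

/-! ### Homotopies of matrices -/

/-- A trivial graded bundle with a differential. -/
structure Frame (L : NQManifold.{v} 𝕜) (V : Opens L.B) (m : Type*) where
  lev : m → ℤ
  D : Matrix m m (L.O V)

section Frames

variable {m n o : Type*}
variable {F : Frame L V m} {G : Frame L V n} {K : Frame L V o}

theorem mul_mem_degZ [Fintype n] {i : n → ℤ} {j : m → ℤ} {l : o → ℤ} {c c' : ℤ} {Z : Matrix o n (L.O V)}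
    (hZ : ∀ α β, Z α β ∈ L.degZ V (i β - l α + c)) {W : Matrix n m (L.O V)}
    (hW : ∀ α β, W α β ∈ L.degZ V (j β - i α + c')) (α : o) (β : m) :
    (Z * W) α β ∈ L.degZ V (j β - l α + (c + c')) := by
  rw [Matrix.mul_apply]
  refine Submodule.sum_mem _ fun γ _ => ?_
  have := degZ_mul (hZ α γ) (hW γ β)
  rwa [show i γ - l α + c + (j β - i γ + c') = j β - l α + (c + c') by ring] at this

theorem mul_mem_degZ' [Fintype n] {i : n → ℤ} {j : m → ℤ} {l : o → ℤ} {Z : Matrix o n (L.O V)}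
    (hZ : ∀ α β, Z α β ∈ L.degZ V (i β - l α)) {W : Matrix n m (L.O V)}
    (hW : ∀ α β, W α β ∈ L.degZ V (j β - i α)) (α : o) (β : m) :
    (Z * W) α β ∈ L.degZ V (j β - l α) := by
  simpa using mul_mem_degZ (c := 0) (c' := 0) (by simpa using hZ) (by simpa using hW) α β

variable [Fintype m] [Fintype n]

/-- Morphisms of bundles. -/
def IsMor (F : Frame L V m) (G : Frame L V n) (W : Matrix n m (L.O V)) : Prop :=
  (∀ α β, W α β ∈ L.degZ V (F.lev β - G.lev α)) ∧ Agree (G.D * W) (W * F.D)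

/-- Homotopies between morphisms of bundles. -/
def Htpy (F : Frame L V m) (G : Frame L V n) (X Y : Matrix n m (L.O V)) : Prop :=
  ∃ N : Matrix n m (L.O V), (∀ α β, N α β ∈ L.degZ V (F.lev β - G.lev α - 1)) ∧
    Agree (X - Y) (G.D * N + N * F.D)

theorem Htpy.refl (X : Matrix n m (L.O V)) : Htpy F G X X :=
  ⟨0, fun _ _ => zero_mem _, .of_eq (by simp)⟩

theorem Htpy.symm {X Y : Matrix n m (L.O V)} (h : Htpy F G X Y) : Htpy F G Y X := by
  obtain ⟨N, hN, h⟩ := h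
  refine ⟨-N, fun α β => neg_mem (hN α β), ?_⟩
  have := h.neg
  rwa [neg_sub, neg_add, ← Matrix.mul_neg, ← Matrix.neg_mul] at this

theorem Htpy.trans {X Y Z : Matrix n m (L.O V)} (h : Htpy F G X Y) (h' : Htpy F G Y Z) :
    Htpy F G X Z := by
  obtain ⟨N, hN, h⟩ := h
  obtain ⟨N', hN', h'⟩ := h'
  refine ⟨N + N', fun α β => add_mem (hN α β) (hN' α β), ?_⟩
  have := h.add h'
  rwa [sub_add_sub_cancel, add_add_add_comm, ← Matrix.mul_add, ← Matrix.add_mul] at this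

variable [Fintype o]

theorem IsMor.mul {Z : Matrix o n (L.O V)} (hZ : IsMor G K Z) {W : Matrix n m (L.O V)}
    (hW : IsMor F G W) : IsMor F K (Z * W) := by
  refine ⟨mul_mem_degZ' hZ.1 hW.1, ?_⟩
  have h1 := hZ.2.mul (.of_eq (rfl : W = W))
  have h2 := (Agree.of_eq (rfl : Z = Z)).mul hW.2
  rw [Matrix.mul_assoc, Matrix.mul_assoc] at h1
  rw [← Matrix.mul_assoc Z W] at h2
  exact h1.trans h2

/-- The differential can be moved past the chain map `Z`, so `Z * N` is a homotopy whenever `N` is.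
-/
theorem Htpy.mul_left {X Y : Matrix n m (L.O V)} (h : Htpy F G X Y) {Z : Matrix o n (L.O V)}
    (hZ : IsMor G K Z) : Htpy F K (Z * X) (Z * Y) := by
  obtain ⟨N, hN, h⟩ := h
  refine ⟨Z * N, fun α β => ?_, ?_⟩
  · have := mul_mem_degZ (c := 0) (c' := -1) (by simpa using hZ.1) hN α β
    rwa [show F.lev β - K.lev α + (0 + -1) = F.lev β - K.lev α - 1 by ring] at this
  · have h1 := (Agree.of_eq (rfl : Z = Z)).mul h
    have h2 := hZ.2.mul (.of_eq (rfl : N = N))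
    rw [Matrix.mul_add, Matrix.mul_sub, ← Matrix.mul_assoc, ← Matrix.mul_assoc Z N] at h1
    refine h1.trans (Agree.add ?_ (.of_eq rfl))
    rw [← Matrix.mul_assoc]
    exact h2.symm

theorem Htpy.mul_right {X Y : Matrix o n (L.O V)} (h : Htpy G K X Y) {Z : Matrix n m (L.O V)}
    (hZ : IsMor F G Z) : Htpy F K (X * Z) (Y * Z) := by
  obtain ⟨N, hN, h⟩ := h
  refine ⟨N * Z, fun α β => ?_, ?_⟩
  · have := mul_mem_degZ (c := -1) (c' := 0) hN (by simpa using hZ.1) α β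
    rwa [show F.lev β - K.lev α + (-1 + 0) = F.lev β - K.lev α - 1 by ring] at this
  · have h1 := h.mul (.of_eq (rfl : Z = Z))
    have h2 := (Agree.of_eq (rfl : N = N)).mul hZ.2
    rw [Matrix.add_mul, Matrix.sub_mul, Matrix.mul_assoc K.D, Matrix.mul_assoc N] at h1
    refine h1.trans (Agree.add (.of_eq rfl) ?_)
    rw [Matrix.mul_assoc N]
    exact h2

end Frames

/-! ### Block triangular systems -/

section Block

variable {m n : Type*} [Fintype m] [Fintype n]

theorem rep_fromBlocks_mul_inl {ρ : Type*} {κ : L.Coords} {R : ℕ} {x : L.B}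
    (A : Matrix m m (L.O V)) (B : Matrix m n (L.O V)) (C : Matrix n m (L.O V))
    (D : Matrix n n (L.O V)) (y : Matrix ((m ⊕ n) × κ.Idx R) ρ 𝕜) (p : m × κ.Idx R) (q : ρ) :
    (κ.rep R x (Matrix.fromBlocks A B C D) * y) (Sum.inl p.1, p.2) q =
      (κ.rep R x A * Matrix.of fun (p : m × κ.Idx R) q => y (Sum.inl p.1, p.2) q) p q +
      (κ.rep R x B * Matrix.of fun (p : n × κ.Idx R) q => y (Sum.inr p.1, p.2) q) p q := by
  simp only [Matrix.mul_apply, Fintype.sum_prod_type, Fintype.sum_sum_type]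
  rfl

theorem rep_fromBlocks_mul_inr {ρ : Type*} {κ : L.Coords} {R : ℕ} {x : L.B}
    (A : Matrix m m (L.O V)) (B : Matrix m n (L.O V)) (C : Matrix n m (L.O V))
    (D : Matrix n n (L.O V)) (y : Matrix ((m ⊕ n) × κ.Idx R) ρ 𝕜) (p : n × κ.Idx R) (q : ρ) :
    (κ.rep R x (Matrix.fromBlocks A B C D) * y) (Sum.inr p.1, p.2) q =
      (κ.rep R x C * Matrix.of fun (p : m × κ.Idx R) q => y (Sum.inl p.1, p.2) q) p q +
      (κ.rep R x D * Matrix.of fun (p : n × κ.Idx R) q => y (Sum.inr p.1, p.2) q) p q := by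
  simp only [Matrix.mul_apply, Fintype.sum_prod_type, Fintype.sum_sum_type]
  rfl

variable {K : Type*} [TopologicalSpace K] [CompactSpace K] {a b : ℝ}

theorem continuousOn_rep {i j : Type*} {C : K → ℝ → Matrix i j (L.O V)}
    (hC : ∀ α β, IsSmoothFam fun q : K × Set.Icc a b => C q.1 q.2 α β) (σ : K) {κ : L.Coords}
    {R : ℕ} {x : L.B} (hx : x ∈ V) (hκ : x ∈ κ.V) (p : i × κ.Idx R) (q : j × κ.Idx R) :
    ContinuousOn (fun t => κ.rep R x (C σ t) p q) (Set.Icc a b) := by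
  rw [continuousOn_iff_continuous_domRestrict]
  exact (IsSmoothFam.continuous_rep (A := fun q : K × Set.Icc a b => C q.1 q.2) hC hx hκ p q).comp
    (f := fun t : Set.Icc a b => (σ, t)) (by fun_prop)

variable [DecidableEq m] [DecidableEq n]

/-- The solution of an inhomogeneous equation with the transport `W` in the right hand side. -/
theorem exists_block (hab : a ≤ b) (l : m → ℤ) (l' : n → ℤ) (A : K → ℝ → Matrix m m (L.O V))
    (B : K → ℝ → Matrix n n (L.O V)) (N : K → ℝ → Matrix m n (L.O V))
    (hA : ∀ α β, IsSmoothFam fun q : K × Set.Icc a b => A q.1 q.2 α β)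
    (hB : ∀ α β, IsSmoothFam fun q : K × Set.Icc a b => B q.1 q.2 α β)
    (hN : ∀ α β, IsSmoothFam fun q : K × Set.Icc a b => N q.1 q.2 α β)
    (dA : ∀ σ, ∀ τ ∈ Set.Icc a b, ∀ α β, A σ τ α β ∈ L.degZ V (l β - l α))
    (dB : ∀ σ, ∀ τ ∈ Set.Icc a b, ∀ α β, B σ τ α β ∈ L.degZ V (l' β - l' α))
    (dN : ∀ σ, ∀ τ ∈ Set.Icc a b, ∀ α β, N σ τ α β ∈ L.degZ V (l' β - l α - 1)) :
    ∃ (X : K → Matrix m n (L.O V)) (W : K → Matrix n n (L.O V)),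
      (∀ α β, IsSmoothFam fun σ => X σ α β) ∧ (∀ σ, IsPOE (B σ) a b (W σ)) ∧
      (∀ σ α β, X σ α β ∈ L.degZ V (l' β - l α - 1)) ∧
      ∀ (σ : K) (κ : L.Coords) (R : ℕ), ∀ x ∈ V, x ∈ κ.V →
        ∃ (y : ℝ → Matrix (m × κ.Idx R) (n × κ.Idx R) 𝕜)
          (u : ℝ → Matrix (n × κ.Idx R) (n × κ.Idx R) 𝕜),
          y a = 0 ∧ y b = κ.rep R x (X σ) ∧ u a = 1 ∧ u b = κ.rep R x (W σ) ∧
          (∀ t ∈ Set.Icc a b, MDeriv y (κ.rep R x (N σ t) * u t - κ.rep R x (A σ t) * y t)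
            (Set.Icc a b) t) ∧
          ∀ t ∈ Set.Icc a b, MDeriv u (-(κ.rep R x (B σ t) * u t)) (Set.Icc a b) t := by
  obtain ⟨W, hW, -, -⟩ := exists_isPOE hab l' B hB dB
  -- The upper right block of the exponential of this triangular system solves `y' = N u - A y` with
  -- `y a = 0`. Lowering the levels `l'` by one makes `N` fit the degree condition and leaves that
  -- of `B` unchanged.
  obtain ⟨Y, hY, sY, dY⟩ := exists_isPOE (m := m ⊕ n) hab (Sum.elim l fun β => l' β - 1)
    (fun σ τ => Matrix.fromBlocks (A σ τ) (-N σ τ) 0 (B σ τ)) (by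
      rintro (α | α) (β | β)
      exacts [hA α β, (hN α β).neg, .zero, hB α β]) (by
      rintro σ τ hτ (α | α) (β | β)
      · exact dA σ τ hτ α β
      · have := neg_mem (dN σ τ hτ α β)
        simpa [sub_right_comm] using this
      · exact zero_mem _
      · simpa using dB σ τ hτ α β)
  have hblk : ∀ α β, IsSmoothFam fun q : K × Set.Icc a b =>
      Matrix.fromBlocks (A q.1 q.2) (-N q.1 q.2) 0 (B q.1 q.2) α β := by
    rintro (α | α) (β | β)
    exacts [hA α β, (hN α β).neg, .zero, hB α β]
  refine ⟨fun σ => (Y σ).toBlocks₁₂, W, fun α β => sY (.inl α) (.inr β), hW, fun σ α β => ?_,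
    fun σ κ R x hx hκ => ?_⟩
  · have := dY σ (.inl α) (.inr β)
    simpa [sub_right_comm, Matrix.toBlocks₁₂] using this
  · obtain ⟨u, hu0, hub, hu⟩ := (hW σ).exists_solution hab (R := R) hx hκ (continuousOn_rep hB σ hx hκ)
    obtain ⟨z, hz0, hzb, hz⟩ := (hY σ).exists_solution hab (R := R) hx hκ
      (continuousOn_rep (C := fun σ τ => Matrix.fromBlocks (A σ τ) (-N σ τ) 0 (B σ τ)) hblk σ hx hκ)
    have hu' : ∀ t ∈ Set.Icc a b, MDeriv u (-(κ.rep R x (B σ t) * u t)) (Set.Icc a b) t :=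
      fun t ht p q => hu t ht p q
    let z₂ : ℝ → Matrix (n × κ.Idx R) (n × κ.Idx R) 𝕜 := fun t =>
      Matrix.of fun p q => z t (Sum.inr p.1, p.2) (Sum.inr q.1, q.2)
    have hz₂ : ∀ t ∈ Set.Icc a b, MDeriv z₂ (-(κ.rep R x (B σ t) * z₂ t)) (Set.Icc a b) t := by
      intro t ht p q
      refine (hz t ht (Sum.inr p.1, p.2) (Sum.inr q.1, q.2)).congr_deriv ?_
      rw [rep_fromBlocks_mul_inr, Coords.rep_zero, Matrix.zero_mul, Matrix.zero_apply, zero_add]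
      rfl
    have hz₂0 : z₂ a = 1 := by
      ext p q
      change z a _ _ = _
      rw [hz0, Matrix.one_apply, Matrix.one_apply]
      exact if_congr (by rw [Prod.ext_iff, Prod.ext_iff, Sum.inr.injEq]) rfl rfl
    -- The lower right block is decoupled, hence equals the transport of `B` by uniqueness and may
    -- be replaced by `u` in the source term.
    have huz : ∀ t ∈ Set.Icc a b, z₂ t = u t := by
      intro t ht
      refine sub_eq_zero.1 (eq_zero_of_MDeriv (continuousOn_rep hB σ hx hκ)
        (y := fun t => z₂ t - u t) (by rw [hz₂0, hu0, sub_self]) (fun t ht => ?_) t ht)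
      refine ((hz₂ t ht).sub (hu' t ht)).congr_deriv ?_
      rw [Matrix.mul_sub]
      abel
    refine ⟨fun t => Matrix.of fun p q => z t (Sum.inl p.1, p.2) (Sum.inr q.1, q.2), u, ?_, ?_,
      hu0, hub, fun t ht p q => ?_, hu'⟩
    · ext p q
      change z a _ _ = _
      rw [hz0, Matrix.one_apply_ne (by simp), Matrix.zero_apply]
    · ext p q
      change z b _ _ = _
      rw [hzb]
      rfl
    · refine (hz t ht (Sum.inl p.1, p.2) (Sum.inr q.1, q.2)).congr_deriv ?_
      rw [rep_fromBlocks_mul_inl, Coords.rep_neg, ← huz t ht, Matrix.sub_apply, Matrix.neg_mul,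
        Matrix.neg_apply, neg_add, neg_neg, add_comm, ← sub_eq_add_neg]
      rfl

theorem exists_block_single (hab : a ≤ b) (l : m → ℤ) (l' : n → ℤ) (A : ℝ → Matrix m m (L.O V))
    (B : ℝ → Matrix n n (L.O V)) (N : ℝ → Matrix m n (L.O V))
    (hA : ∀ α β, IsSmoothFam fun t : Set.Icc a b => A t α β)
    (hB : ∀ α β, IsSmoothFam fun t : Set.Icc a b => B t α β)
    (hN : ∀ α β, IsSmoothFam fun t : Set.Icc a b => N t α β)
    (dA : ∀ τ ∈ Set.Icc a b, ∀ α β, A τ α β ∈ L.degZ V (l β - l α))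
    (dB : ∀ τ ∈ Set.Icc a b, ∀ α β, B τ α β ∈ L.degZ V (l' β - l' α))
    (dN : ∀ τ ∈ Set.Icc a b, ∀ α β, N τ α β ∈ L.degZ V (l' β - l α - 1)) :
    ∃ (X : Matrix m n (L.O V)) (W : Matrix n n (L.O V)), IsPOE B a b W ∧
      (∀ α β, X α β ∈ L.degZ V (l' β - l α - 1)) ∧
      ∀ (κ : L.Coords) (R : ℕ), ∀ x ∈ V, x ∈ κ.V →
        ∃ (y : ℝ → Matrix (m × κ.Idx R) (n × κ.Idx R) 𝕜)
          (u : ℝ → Matrix (n × κ.Idx R) (n × κ.Idx R) 𝕜),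
          y a = 0 ∧ y b = κ.rep R x X ∧ u a = 1 ∧ u b = κ.rep R x W ∧
          (∀ t ∈ Set.Icc a b, MDeriv y (κ.rep R x (N t) * u t - κ.rep R x (A t) * y t)
            (Set.Icc a b) t) ∧
          ∀ t ∈ Set.Icc a b, MDeriv u (-(κ.rep R x (B t) * u t)) (Set.Icc a b) t := by
  obtain ⟨X, W, -, hW, dX, hX⟩ := exists_block (K := Unit) hab l l' (fun _ => A) (fun _ => B)
    (fun _ => N)
    (fun α β => (hA α β).comp (g := fun q : Unit × Set.Icc a b => q.2) continuous_snd)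
    (fun α β => (hB α β).comp (g := fun q : Unit × Set.Icc a b => q.2) continuous_snd)
    (fun α β => (hN α β).comp (g := fun q : Unit × Set.Icc a b => q.2) continuous_snd)
    (fun _ => dA) (fun _ => dB) (fun _ => dN)
  exact ⟨X (), W (), hW (), dX (), hX ()⟩

end Block

end NQManifold

/-! ### Parallel transport in one patch -/

open NQManifold GradedSpace QBundle

namespace SuperMap

variable {𝕜 : Type k} [RCLike 𝕜] {L : NQManifold.{v} 𝕜} {M : NQManifold.{u} 𝕜} {d : ℕ}
variable {S : Set (Fin d → ℝ)} {H : SuperMap S L M}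
variable {V : Opens L.B} {U : Opens M.B} {Z : Set (Fin d → ℝ)} {p : Fin d → ℝ}
variable {m n : Type*} {E : QBundle.{u, w} M} {e e' e'' : E.Triv}

theorem sgn_mul_mem [Fintype m] [DecidableEq m] {l : m → ℤ} {A : Matrix m n (M.O U)}
    {i : m → n → ℤ} (hA : ∀ α β, A α β ∈ M.degZ U (i α β)) (α : m) (β : n) :
    (sgn l (M.O U) * A) α β ∈ M.degZ U (i α β) := by
  rw [sgn, Matrix.diagonal_mul, ← zsmul_eq_mul]
  exact zsmul_mem (hA α β) _

/-- Removing `θ_j` compensates the degree 1 of `Qhat`, so the connection, and with it the transport,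
preserves the total degree. -/
theorem MapsInto.conn_mem (h : H.MapsInto Z V e.U) (hp : p ∈ Z) (j : Fin d) (α β : Fin e.r) :
    H.conn j p V e α β ∈ L.degZ V (e.lev β - e.lev α) := by
  have := h.pull_mem hp (sgn_mul_mem (l := e.lev) (qmat_mem' e) α β) {j}
  rw [Finset.card_singleton, Nat.cast_one, add_sub_cancel_right] at this
  rw [conn, repMat_eq]
  exact this

theorem MapsInto.trans_mem (h : H.MapsInto Z V e.U) (h' : H.MapsInto Z V e'.U) (hp : p ∈ Z)
    (α : Fin e.r) (β : Fin e'.r) : H.trans p V e e' α β ∈ L.degZ V (e'.lev β - e.lev α) := by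
  have := (h.inf h').pull_mem hp (transMat_mem e e' α β) ∅
  rwa [Finset.card_empty, Nat.cast_zero, sub_zero] at this

theorem MapsInto.trans₁_mem (h : H.MapsInto Z V e.U) (h' : H.MapsInto Z V e'.U) (hp : p ∈ Z)
    (j : Fin d) (α : Fin e.r) (β : Fin e'.r) :
    H.trans₁ j p V e e' α β ∈ L.degZ V (e'.lev β - e.lev α - 1) := by
  have := (h.inf h').pull_mem hp (sgn_mul_mem (l := e.lev) (transMat_mem e e') α β) {j}
  rwa [Finset.card_singleton, Nat.cast_one] at this

theorem MapsInto.trans_self (h : H.MapsInto Z V e.U) (hp : p ∈ Z) : H.trans p V e e = 1 := by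
  have h1 := (h.inf h).pullM_res_left hp le_rfl ∅ (transMat e e)
  rw [transMat_self, (h.inf h).pullM_one hp] at h1
  exact h1.symm

theorem MapsInto.trans_mul_trans (h : H.MapsInto Z V e.U) (h' : H.MapsInto Z V e'.U)
    (h'' : H.MapsInto Z V e''.U) (hp : p ∈ Z) :
    H.trans p V e e' * H.trans p V e' e'' = H.trans p V e e'' := by
  have hh := (h.inf h').inf h''
  have h1 := transMat_mul e e' e'' (U' := e.U ⊓ e'.U ⊓ e''.U) inf_le_left
    (le_inf (inf_le_left.trans inf_le_right) inf_le_right)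
    (le_inf (inf_le_left.trans inf_le_left) inf_le_right)
  have h2 := congrArg (H.pullM p V ∅) h1
  rwa [hh.pullM_mul_empty hp, hh.pullM_res_left hp, hh.pullM_res_left hp, hh.pullM_res_left hp] at h2

theorem MapsInto.agree_Q (h : H.MapsInto Z V U) (hp : p ∈ Z) (A : Matrix m n (M.O U)) :
    Agree (H.pullM p V ∅ (A.map (M.Q U))) 0 := by
  intro κ R hR x hx hκ
  ext q q'
  rw [Coords.rep_apply hx hκ, Coords.rep_zero]
  exact Finset.sum_eq_zero fun I _ => by
    rw [show H.pullM p V ∅ (A.map (M.Q U)) q.1 q'.1 = H.pull p U V (M.Q U (A q.1 q'.1)) ∅ from rfl,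
      h.coeff_pull_Q_empty hR hx hp _ I.2, zero_mul]

theorem MapsInto.agree_trans (h : H.MapsInto Z V e.U) (h' : H.MapsInto Z V e'.U) (hp : p ∈ Z) :
    Agree (H.D₀ p V e * H.trans p V e e') (H.trans p V e e' * H.D₀ p V e') := by
  have h1 := (Agree.of_eq (rfl : sgn e.lev (L.O V) = _)).mul ((h.inf h').agree_Q hp (transMat e e'))
  rw [h.pullM_Q_transMat_empty h' hp, sgn_mul_sgn_mul, Matrix.mul_zero] at h1
  have h2 := h1.add (.of_eq (rfl : H.D₀ p V e * H.trans p V e e' = _))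
  rw [sub_add_cancel, zero_add] at h2
  exact h2.symm

/-- The trivial bundle at a point of the map. -/
def frame (H : SuperMap S L M) (p : Fin d → ℝ) (V : Opens L.B) (e : E.Triv) :
    Frame L V (Fin e.r) := ⟨e.lev, H.D₀ p V e⟩

theorem MapsInto.isMor_trans (h : H.MapsInto Z V e.U) (h' : H.MapsInto Z V e'.U) (hp : p ∈ Z) :
    IsMor (H.frame p V e') (H.frame p V e) (H.trans p V e e') :=
  ⟨h.trans_mem h' hp, h.agree_trans h' hp⟩

/-! #### Transport along a coordinate line -/

variable {γ : ℝ → Fin d → ℝ} {j : Fin d} {a b c : ℝ}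

theorem MapsInto.isSmoothFam_line (hS : IsFat S) (hγ : Continuous γ)
    (h : H.MapsInto (γ '' Set.Icc a b) V U) (K : Finset (Fin d)) (A : Matrix m n (M.O U)) (α : m)
    (β : n) : IsSmoothFam fun t : Set.Icc a b => H.pullM (γ t) V K A α β :=
  MapsInto.isSmoothFam (γ := fun t : Set.Icc a b => γ t) hS (by fun_prop)
    (h.mono (by rintro _ ⟨t, rfl⟩; exact ⟨t, t.2, rfl⟩)) (A α β) K

theorem MapsInto.continuousOn_rep_line (hS : IsFat S) (hγ : Continuous γ)
    (h : H.MapsInto (γ '' Set.Icc a b) V U) (K : Finset (Fin d)) (A : Matrix m n (M.O U))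
    {κ : L.Coords} {R : ℕ} {x : L.B} (hx : x ∈ V) (hκ : x ∈ κ.V) (q : m × κ.Idx R)
    (q' : n × κ.Idx R) :
    ContinuousOn (fun t => κ.rep R x (H.pullM (γ t) V K A) q q') (Set.Icc a b) := by
  rw [continuousOn_iff_continuous_domRestrict]
  exact IsSmoothFam.continuous_rep (A := fun t : Set.Icc a b => H.pullM (γ t) V K A)
    (h.isSmoothFam_line hS hγ K A) hx hκ q q'

variable {R : ℕ} {κ : L.Coords} {x : L.B}

theorem MapsInto.mderiv_pullM (hγ : ∀ τ, HasDerivAt γ (Pi.single j 1) τ)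
    (h : H.MapsInto (γ '' Set.Icc a b) V U) (hR : L.Admissible R) (hx : x ∈ V) (hκ : x ∈ κ.V)
    (A : Matrix m n (M.O U)) {t : ℝ} (ht : t ∈ Set.Icc a b) :
    MDeriv (fun τ => κ.rep R x (H.pullM (γ τ) V ∅ A))
      (κ.rep R x (H.pullM (γ t) V {j} (A.map (M.Q U)))) (Set.Icc a b) t := by
  intro q q'
  simp only [Coords.rep_apply hx hκ]
  exact HasDerivWithinAt.fun_sum fun I _ =>
    (h.hasDerivWithinAt hγ hR hx hκ (A q.1 q'.1) I.2 ht).mul_const _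

theorem MapsInto.mderiv_D₀ (hγ : ∀ τ, HasDerivAt γ (Pi.single j 1) τ)
    (h : H.MapsInto (γ '' Set.Icc a b) V e.U) (hR : L.Admissible R) (hx : x ∈ V) (hκ : x ∈ κ.V)
    {t : ℝ} (ht : t ∈ Set.Icc a b) :
    MDeriv (fun τ => κ.rep R x (H.D₀ (γ τ) V e))
      (κ.rep R x (H.D₀ (γ t) V e) * κ.rep R x (H.conn j (γ t) V e) -
        κ.rep R x (H.conn j (γ t) V e) * κ.rep R x (H.D₀ (γ t) V e)) (Set.Icc a b) t := by
  refine (h.mderiv_pullM hγ hR hx hκ (qmat e) ht).congr_deriv ?_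
  rw [h.pullM_Q_qmat_singleton ⟨t, ht, rfl⟩ j, Coords.rep_sub, Coords.rep_mul hx hκ,
    Coords.rep_mul hx hκ]

theorem MapsInto.mderiv_trans (hγ : ∀ τ, HasDerivAt γ (Pi.single j 1) τ)
    (h : H.MapsInto (γ '' Set.Icc a b) V e.U) (h' : H.MapsInto (γ '' Set.Icc a b) V e'.U)
    (hR : L.Admissible R) (hx : x ∈ V) (hκ : x ∈ κ.V) {t : ℝ} (ht : t ∈ Set.Icc a b) :
    MDeriv (fun τ => κ.rep R x (H.trans (γ τ) V e e'))
      (κ.rep R x (H.trans (γ t) V e e') * κ.rep R x (H.conn j (γ t) V e') -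
        κ.rep R x (H.conn j (γ t) V e) * κ.rep R x (H.trans (γ t) V e e') +
        κ.rep R x (H.D₀ (γ t) V e) * κ.rep R x (H.trans₁ j (γ t) V e e') +
        κ.rep R x (H.trans₁ j (γ t) V e e') * κ.rep R x (H.D₀ (γ t) V e')) (Set.Icc a b) t := by
  refine ((h.inf h').mderiv_pullM hγ hR hx hκ (transMat e e') ht).congr_deriv ?_
  rw [h.pullM_Q_transMat_singleton h' ⟨t, ht, rfl⟩ j]
  simp only [Coords.rep_sub, Coords.rep_add, Coords.rep_mul hx hκ]

/-- `W` is the parallel transport along a coordinate line in the trivialization `e`. -/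
def IsTransport (H : SuperMap S L M) (γ : ℝ → Fin d → ℝ) (j : Fin d) (V : Opens L.B) (e : E.Triv)
    (a b : ℝ) (W : Matrix (Fin e.r) (Fin e.r) (L.O V)) : Prop :=
  IsPOE (fun τ => H.conn j (γ τ) V e) a b W

variable {W : Matrix (Fin e.r) (Fin e.r) (L.O V)}

theorem MapsInto.exists_transport (hS : IsFat S) (hγ : Continuous γ) (hab : a ≤ b)
    (h : H.MapsInto (γ '' Set.Icc a b) V e.U) :
    ∃ W, H.IsTransport γ j V e a b W ∧ ∀ α β, W α β ∈ L.degZ V (e.lev β - e.lev α) :=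
  exists_isPOE_single hab e.lev (fun τ => H.conn j (γ τ) V e) (h.isSmoothFam_line hS hγ {j} _)
    fun τ hτ => h.conn_mem ⟨τ, hτ, rfl⟩ j

theorem IsTransport.exists_solution (hW : H.IsTransport γ j V e a b W) (hS : IsFat S)
    (hγ : Continuous γ) (hab : a ≤ b) (h : H.MapsInto (γ '' Set.Icc a b) V e.U) (hx : x ∈ V)
    (hκ : x ∈ κ.V) : ∃ u : ℝ → Matrix (Fin e.r × κ.Idx R) (Fin e.r × κ.Idx R) 𝕜,
      u a = 1 ∧ u b = κ.rep R x W ∧ ∀ t ∈ Set.Icc a b,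
        MDeriv u (-(κ.rep R x (H.conn j (γ t) V e) * u t)) (Set.Icc a b) t := by
  obtain ⟨u, h1, h2, h3⟩ := IsPOE.exists_solution hab hW hx hκ (h.continuousOn_rep_line hS hγ {j} _ hx hκ)
  exact ⟨u, h1, h2, fun t ht p q => h3 t ht p q⟩

theorem IsTransport.mem (hW : H.IsTransport γ j V e a b W) (hS : IsFat S) (hγ : Continuous γ)
    (hab : a ≤ b) (h : H.MapsInto (γ '' Set.Icc a b) V e.U) (α β : Fin e.r) :
    W α β ∈ L.degZ V (e.lev β - e.lev α) := by
  obtain ⟨W', hW', hd⟩ := h.exists_transport (j := j) hS hγ hab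
  rw [IsPOE.unique hab hW hW']
  exact hd α β

theorem IsTransport.isMor (hW : H.IsTransport γ j V e a b W) (hS : IsFat S)
    (hγ : ∀ τ, HasDerivAt γ (Pi.single j 1) τ) (hγc : Continuous γ) (hab : a ≤ b)
    (h : H.MapsInto (γ '' Set.Icc a b) V e.U) :
    IsMor (H.frame (γ a) V e) (H.frame (γ b) V e) W := by
  refine ⟨hW.mem hS hγc hab h, fun κ R hR x hx hκ => ?_⟩
  obtain ⟨u, hu0, hub, hu⟩ := hW.exists_solution (R := R) hS hγc hab h hx hκ
  have := mul_transport (h.continuousOn_rep_line hS hγc {j} _ hx hκ)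
    (fun t ht => h.mderiv_D₀ hγ hR hx hκ ht) hu0 hu b ⟨hab, le_rfl⟩
  rw [hub] at this
  rw [Coords.rep_mul hx hκ, Coords.rep_mul hx hκ]
  exact this

theorem IsTransport.res (hW : H.IsTransport γ j V e a b W)
    (h : H.MapsInto (γ '' Set.Icc a b) V e.U) {V' : Opens L.B} (hV : V' ≤ V) :
    H.IsTransport γ j V' e a b (W.map (L.res hV)) :=
  (IsPOE.res hW hV).congr fun t ht => h.pullM_res_right ⟨t, ht, rfl⟩ hV {j} _

theorem IsTransport.eq_one (hW : H.IsTransport γ j V e a a W) (hS : IsFat S)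
    (hγ : Continuous γ) (h : H.MapsInto (γ '' Set.Icc a a) V e.U) : W = 1 := by
  ext α β
  refine ext_coeff fun κ I x hx hκ => ?_
  obtain ⟨u, hu0, hub, -⟩ := hW.exists_solution (R := I.total) hS hγ le_rfl h hx hκ
  rw [hu0, ← Coords.rep_one hx hκ] at hub
  have h1 := congrFun (congrFun hub (α, ⟨I, le_rfl⟩)) (β, κ.zeroIdx _)
  rw [Coords.rep_apply_zero hx hκ, Coords.rep_apply_zero hx hκ] at h1
  exact h1.symm

/-- Uniqueness for the linear equation, first on `[a, b]`, then on `[b, c]` with the initial value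
reached at `b`. -/
theorem IsTransport.eq_mul (hW : H.IsTransport γ j V e a c W)
    {W₁ W₂ : Matrix (Fin e.r) (Fin e.r) (L.O V)} (hW₁ : H.IsTransport γ j V e a b W₁)
    (hW₂ : H.IsTransport γ j V e b c W₂) (hS : IsFat S) (hγ : Continuous γ) (hab : a ≤ b)
    (hbc : b ≤ c) (h : H.MapsInto (γ '' Set.Icc a c) V e.U) : W = W₂ * W₁ := by
  have hi₁ : Set.Icc a b ⊆ Set.Icc a c := Set.Icc_subset_Icc_right hbc
  have hi₂ : Set.Icc b c ⊆ Set.Icc a c := Set.Icc_subset_Icc_left hab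
  have h₁ := h.mono (Set.image_mono hi₁)
  have h₂ := h.mono (Set.image_mono hi₂)
  ext α β
  refine ext_coeff fun κ I x hx hκ => ?_
  obtain ⟨u, hu0, hub, hu⟩ := hW.exists_solution (R := I.total) hS hγ (hab.trans hbc) h hx hκ
  obtain ⟨u₁, hu0₁, hub₁, hu₁⟩ := hW₁.exists_solution (R := I.total) hS hγ hab h₁ hx hκ
  obtain ⟨u₂, hu0₂, hub₂, hu₂⟩ := hW₂.exists_solution (R := I.total) hS hγ hbc h₂ hx hκ
  have e₁ := eq_zero_of_MDeriv (h₁.continuousOn_rep_line hS hγ {j} _ hx hκ)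
    (y := fun t => u t - u₁ t) (by rw [hu0, hu0₁, sub_self]) (fun t ht =>
      (MDeriv.sub (fun p q => (hu t (hi₁ ht) p q).mono hi₁) (hu₁ t ht)).congr_deriv
        (by rw [Matrix.mul_sub]; abel)) b ⟨hab, le_rfl⟩
  have e₂ := eq_zero_of_MDeriv (h₂.continuousOn_rep_line hS hγ {j} _ hx hκ)
    (y := fun t => u t - u₂ t * u₁ b) (by rw [hu0₂, Matrix.one_mul]; exact e₁) (fun t ht =>
      (MDeriv.sub (fun p q => (hu t (hi₂ ht) p q).mono hi₂) ((hu₂ t ht).mul (.const (u₁ b)))).congr_deriv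
        (by simp only [Matrix.mul_sub, Matrix.neg_mul, Matrix.mul_assoc, Matrix.mul_zero]; abel))
    c ⟨hbc, le_rfl⟩
  have e₃ : κ.rep I.total x W = κ.rep I.total x (W₂ * W₁) := by
    rw [Coords.rep_mul hx hκ, ← hub, ← hub₁, ← hub₂]
    exact sub_eq_zero.1 e₂
  have h1 := congrFun (congrFun e₃ (α, ⟨I, le_rfl⟩)) (β, κ.zeroIdx _)
  rwa [Coords.rep_apply_zero hx hκ, Coords.rep_apply_zero hx hκ] at h1

/-- The transports in two trivializations are homotopic. -/
theorem IsTransport.htpy (hW : H.IsTransport γ j V e a b W)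
    {W' : Matrix (Fin e'.r) (Fin e'.r) (L.O V)} (hW' : H.IsTransport γ j V e' a b W') (hS : IsFat S)
    (hγ : ∀ τ, HasDerivAt γ (Pi.single j 1) τ) (hγc : Continuous γ) (hab : a ≤ b)
    (h : H.MapsInto (γ '' Set.Icc a b) V e.U) (h' : H.MapsInto (γ '' Set.Icc a b) V e'.U) :
    Htpy (H.frame (γ a) V e') (H.frame (γ b) V e) (H.trans (γ b) V e e' * W')
      (W * H.trans (γ a) V e e') := by
  -- `X` is the homotopy: the solution driven by `trans₁`, the failure of the transition matrix to
  -- be covariantly constant.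
  obtain ⟨X, W'', hW'', dX, hX⟩ := exists_block_single hab e.lev e'.lev
    (fun τ => H.conn j (γ τ) V e) (fun τ => H.conn j (γ τ) V e')
    (fun τ => H.trans₁ j (γ τ) V e e') (h.isSmoothFam_line hS hγc {j} _)
    (h'.isSmoothFam_line hS hγc {j} _) ((h.inf h').isSmoothFam_line hS hγc {j} _)
    (fun τ hτ => h.conn_mem ⟨τ, hτ, rfl⟩ j) (fun τ hτ => h'.conn_mem ⟨τ, hτ, rfl⟩ j)
    (fun τ hτ => h.trans₁_mem h' ⟨τ, hτ, rfl⟩ j)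
  have hWW : W'' = W' := IsPOE.unique hab hW'' hW'
  refine ⟨X, dX, fun κ R hR x hx hκ => ?_⟩
  obtain ⟨y, u', hy0, hyb, hu0', hub', hy, hu'⟩ := hX κ R x hx hκ
  obtain ⟨u, hu0, hub, hu⟩ := hW.exists_solution (R := R) hS hγc hab h hx hκ
  have := transport_homotopy hab (h.continuousOn_rep_line hS hγc {j} _ hx hκ)
    (h'.continuousOn_rep_line hS hγc {j} _ hx hκ) (fun t ht => h.mderiv_D₀ hγ hR hx hκ ht)
    (fun t ht => h'.mderiv_D₀ hγ hR hx hκ ht) (fun t ht => h.mderiv_trans hγ h' hR hx hκ ht)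
    hu0 hu hu0' hu' hy0 hy
  rw [hub, hub', hyb, hWW] at this
  simp only [Coords.rep_sub, Coords.rep_add, Coords.rep_mul hx hκ]
  exact this

end SuperMap

/-! ### Dependence of the transport on parameters -/

section Variation

variable {𝕜 : Type*} [RCLike 𝕜] {ι : Type*} [Fintype ι] {s₀ s₁ t₀ t₁ : ℝ}

open CFun

theorem hasDerivWithinAt_volt (hab : t₀ ≤ t₁) (r : ι → ι → CFun (Unit × Set.Icc t₀ t₁) 𝕜)
    (w : CFun (Unit × Set.Icc t₀ t₁) (ι → 𝕜)) {t : ℝ} (ht : t ∈ Set.Icc t₀ t₁) (p : ι) :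
    HasDerivWithinAt (fun t => volt hab (opOf r) w ((), Set.projIcc t₀ t₁ hab t) p)
      (-∑ q, r p q ((), ⟨t, ht⟩) * w ((), ⟨t, ht⟩) q) (Set.Icc t₀ t₁) t := by
  simp only [volt_opOf_apply]
  have hcont : Continuous fun σ => ∑ q, r p q ((), Set.projIcc t₀ t₁ hab σ) *
      w ((), Set.projIcc t₀ t₁ hab σ) q := by
    refine continuous_finsetSum _ fun q _ => ?_
    have hr : Continuous fun σ => r p q ((), Set.projIcc t₀ t₁ hab σ) := by fun_prop
    exact Continuous.mul hr (by fun_prop)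
  have h2 := ((hcont.integral_hasStrictDerivAt t₀ t).hasDerivAt.neg).hasDerivWithinAt
    (s := Set.Icc t₀ t₁)
  refine (h2.congr (fun τ hτ => ?_) ?_).congr_deriv ?_
  · simp only [Set.projIcc_of_mem hab hτ]
    rfl
  · simp only [Set.projIcc_of_mem hab ht]
    rfl
  · simp only [Set.projIcc_of_mem hab ht]

variable [DecidableEq ι]

/-- The transport is a smooth function of its generator in the Banach space of continuous functions
of `t`, hence differentiable in `s` uniformly in `t`. Differentiating its Volterra equation gives
the linearized equation for `v`. -/
theorem exists_deriv_transport (hs₀ : s₀ < s₁) (ht₀ : t₀ < t₁) {A : ℝ → ℝ → Matrix ι ι 𝕜}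
    (hA : ∀ p q, ContDiffOn ℝ ∞ (fun z : ℝ × ℝ => A z.2 z.1 p q) (Set.Icc t₀ t₁ ×ˢ Set.Icc s₀ s₁))
    {u : ℝ → ℝ → Matrix ι ι 𝕜} (hu0 : ∀ s ∈ Set.Icc s₀ s₁, u s t₀ = 1)
    (hu : ∀ s ∈ Set.Icc s₀ s₁, ∀ t ∈ Set.Icc t₀ t₁,
      MDeriv (u s) (-(A s t * u s t)) (Set.Icc t₀ t₁) t)
    {s : ℝ} (hs : s ∈ Set.Icc s₀ s₁) {c : ℝ → Matrix ι ι 𝕜}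
    (hc : ∀ t ∈ Set.Icc t₀ t₁, MDeriv (fun s => A s t) (c t) (Set.Icc s₀ s₁) s) :
    ∃ v : ℝ → Matrix ι ι 𝕜, v t₀ = 0 ∧
      (∀ t ∈ Set.Icc t₀ t₁, MDeriv v (-(c t * u s t + A s t * v t)) (Set.Icc t₀ t₁) t) ∧
      ∀ t ∈ Set.Icc t₀ t₁, MDeriv (fun s => u s t) (v t) (Set.Icc s₀ s₁) s := by
  have hab := ht₀.le
  let pr : ℝ → Set.Icc t₀ t₁ := Set.projIcc t₀ t₁ hab
  have hpr : ∀ t (ht : t ∈ Set.Icc t₀ t₁), pr t = ⟨t, ht⟩ := fun t ht => Set.projIcc_of_mem hab ht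
  have hAc : ∀ s ∈ Set.Icc s₀ s₁, ∀ p q,
      Continuous fun z : Unit × Set.Icc t₀ t₁ => A s z.2 p q := fun s hs p q =>
    (hA p q).continuousOn.comp_continuous (f := fun z : Unit × Set.Icc t₀ t₁ => ((z.2 : ℝ), s))
      (by fun_prop) fun z => ⟨z.2.2, hs⟩
  let a : ℝ → ι → ι → CFun (Unit × Set.Icc t₀ t₁) 𝕜 := fun s p q =>
    CFun.mk (fun z => A (Set.projIcc s₀ s₁ hs₀.le s) z.2 p q) (hAc _ (Subtype.coe_prop _) p q)
  have haA : ∀ s ∈ Set.Icc s₀ s₁, ∀ p q z, a s p q z = A s z.2 p q := fun s hs p q z => by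
    simp only [a, Set.projIcc_of_mem hs₀.le hs]
    rfl
  have ha : ∀ p q, ContDiffOn ℝ ∞ (fun s => a s p q) (Set.Icc s₀ s₁) := fun p q =>
    contDiffOn_curry (uniqueDiffOn_Icc ht₀) (convex_Icc _ _) (uniqueDiffOn_Icc hs₀)
      ⟨fun z : Unit × Set.Icc t₀ t₁ => (z.2 : ℝ), by fun_prop⟩ (fun z => z.2.2) (hA p q)
      fun s hs z => haA s hs p q z
  let e : ι → CFun (Unit × Set.Icc t₀ t₁) (ι → 𝕜) := fun q =>
    constL (fun p => (1 : Matrix ι ι 𝕜) p q)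
  let φ : ℝ → ι → CFun (Unit × Set.Icc t₀ t₁) (ι → 𝕜) := fun s q => voltSol hab (e q) (opOf (a s))
  have hφe : ∀ s q, φ s q = e q + volt hab (opOf (a s)) (φ s q) := fun s q =>
    voltSol_eq hab (e q) (opOf (a s))
  have hvolt0 : ∀ (r : ι → ι → CFun (Unit × Set.Icc t₀ t₁) 𝕜) w p,
      volt hab (opOf r) w ((), pr t₀) p = 0 := fun r w p => by
    rw [volt_opOf_apply]
    simp [pr]
  have hsd : ∀ q, ContDiffOn ℝ ∞ (fun s => φ s q) (Set.Icc s₀ s₁) := fun q =>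
    (contDiff_voltSol hab (e q)).comp_contDiffOn
      ((ContinuousLinearMap.contDiff (opOf (T := Unit × Set.Icc t₀ t₁) (ι := ι) (𝕜 := 𝕜))).comp_contDiffOn
        (contDiffOn_pi.2 fun p => contDiffOn_pi.2 fun q => ha p q))
  -- The given `u` is only known to solve the equation for each `s`; uniqueness identifies it with
  -- the Volterra solution, whose dependence on `s` is smooth.
  have hφu : ∀ s ∈ Set.Icc s₀ s₁, ∀ t (ht : t ∈ Set.Icc t₀ t₁) p q,
      φ s q ((), ⟨t, ht⟩) p = u s t p q := by
    intro s hs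
    have hd : ∀ t ∈ Set.Icc t₀ t₁, MDeriv (fun t => Matrix.of fun p q => φ s q ((), pr t) p)
        (-(A s t * Matrix.of fun p q => φ s q ((), pr t) p)) (Set.Icc t₀ t₁) t := by
      intro t ht p q
      have h1 := (hasDerivWithinAt_volt hab (a s) (φ s q) ht p).const_add ((1 : Matrix ι ι 𝕜) p q)
      refine (h1.congr_of_eventuallyEq (Filter.Eventually.of_forall fun τ => ?_) ?_).congr_deriv ?_
      · exact congrArg (fun w : CFun _ (ι → 𝕜) => w ((), pr τ) p) (hφe s q)
      · exact congrArg (fun w : CFun _ (ι → 𝕜) => w ((), pr t) p) (hφe s q)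
      · rw [Matrix.neg_apply, Matrix.mul_apply]
        simp only [haA s hs, hpr t ht, Matrix.of_apply]
    have hz := eq_zero_of_MDeriv (A := A s) (fun p q => (hA p q).continuousOn.comp
        (f := fun t => (t, s)) (by fun_prop) fun t ht => ⟨ht, hs⟩)
      (y := fun t => (Matrix.of fun p q => φ s q ((), pr t) p) - u s t) (by
        ext p q
        have h1 := congrArg (fun w : CFun _ (ι → 𝕜) => w ((), pr t₀) p) (hφe s q)
        simp only [CFun.add_apply, Pi.add_apply, hvolt0, add_zero] at h1
        rw [Matrix.sub_apply, Matrix.of_apply, h1, hu0 s hs]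
        exact sub_self _) (fun t ht => ((hd t ht).sub (hu s hs t ht)).congr_deriv (by
          rw [Matrix.mul_sub]; abel))
    intro t ht p q
    have h2 := congrFun (congrFun (sub_eq_zero.1 (hz t ht)) p) q
    rw [← hpr t ht]
    exact h2
  have hua := uniqueDiffOn_Icc hs₀ s hs
  let a' : ι → ι → CFun (Unit × Set.Icc t₀ t₁) 𝕜 := fun p q =>
    derivWithin (fun s => a s p q) (Set.Icc s₀ s₁) s
  have ha' : ∀ p q, HasDerivWithinAt (fun s => a s p q) (a' p q) (Set.Icc s₀ s₁) s := fun p q =>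
    ((ha p q).differentiableOn (by simp) s hs).hasDerivWithinAt
  let φ' : ι → CFun (Unit × Set.Icc t₀ t₁) (ι → 𝕜) := fun q =>
    derivWithin (fun s => φ s q) (Set.Icc s₀ s₁) s
  have hφ' : ∀ q, HasDerivWithinAt (fun s => φ s q) (φ' q) (Set.Icc s₀ s₁) s := fun q =>
    ((hsd q).differentiableOn (by simp) s hs).hasDerivWithinAt
  have hop : HasDerivWithinAt (fun s => volt hab (opOf (a s))) (volt hab (opOf a'))
      (Set.Icc s₀ s₁) s :=
    ((volt hab).comp (opOf (T := Unit × Set.Icc t₀ t₁) (ι := ι) (𝕜 := 𝕜))).hasFDerivAt.comp_hasDerivWithinAt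
      s (hasDerivWithinAt_pi.2 fun p => hasDerivWithinAt_pi.2 fun q => ha' p q)
  have hφ'e : ∀ q, φ' q = volt hab (opOf a') (φ s q) + volt hab (opOf (a s)) (φ' q) := by
    intro q
    have h1 := (hop.clm_apply (hφ' q)).const_add (e q)
    refine hua.eq_deriv _ (hφ' q) (h1.congr_of_eventuallyEq
      (Filter.Eventually.of_forall fun s => hφe s q) (hφe s q))
  have ha'c : ∀ t (ht : t ∈ Set.Icc t₀ t₁) p q, a' p q ((), ⟨t, ht⟩) = c t p q := by
    intro t ht p q
    have h1 := ((evalL (F := 𝕜) ((), (⟨t, ht⟩ : Set.Icc t₀ t₁))).hasFDerivAt.comp_hasDerivWithinAt s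
      (ha' p q))
    refine hua.eq_deriv _ h1 ((hc t ht p q).congr (fun s hs => ?_) ?_)
    · exact haA s hs p q ((), ⟨t, ht⟩)
    · exact haA s hs p q ((), ⟨t, ht⟩)
  refine ⟨fun t => Matrix.of fun p q => φ' q ((), pr t) p, ?_, fun t ht p q => ?_,
    fun t ht p q => ?_⟩
  · ext p q
    have h1 := congrArg (fun w : CFun _ (ι → 𝕜) => w ((), pr t₀) p) (hφ'e q)
    simp only [CFun.add_apply, Pi.add_apply, hvolt0, add_zero] at h1
    exact h1
  · have h1 := (hasDerivWithinAt_volt hab a' (φ s q) ht p).add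
      (hasDerivWithinAt_volt hab (a s) (φ' q) ht p)
    refine (h1.congr_of_eventuallyEq (Filter.Eventually.of_forall fun τ => ?_) ?_).congr_deriv ?_
    · exact congrArg (fun w : CFun _ (ι → 𝕜) => w ((), pr τ) p) (hφ'e q)
    · exact congrArg (fun w : CFun _ (ι → 𝕜) => w ((), pr t) p) (hφ'e q)
    · rw [Matrix.neg_apply, Matrix.add_apply, Matrix.mul_apply, Matrix.mul_apply]
      simp only [haA s hs, hpr t ht, Matrix.of_apply, ha'c t ht, hφu s hs t ht, neg_add]
  · have h1 := ((ContinuousLinearMap.proj (R := ℝ) (φ := fun _ : ι => 𝕜) p).comp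
      (evalL (F := ι → 𝕜) ((), (⟨t, ht⟩ : Set.Icc t₀ t₁)))).hasFDerivAt.comp_hasDerivWithinAt s (hφ' q)
    refine (h1.congr (fun s hs => ?_) ?_).congr_deriv ?_
    · exact (hφu s hs t ht p q).symm
    · exact (hφu s hs t ht p q).symm
    · simp only [hpr t ht, Matrix.of_apply]
      rfl

/-- The derivative of the transport with respect to a parameter, in terms of the curvature. -/
theorem transport_variation (hs₀ : s₀ < s₁) (ht₀ : t₀ < t₁) {A B D C : ℝ → ℝ → Matrix ι ι 𝕜}
    (hA : ∀ p q, ContDiffOn ℝ ∞ (fun z : ℝ × ℝ => A z.2 z.1 p q) (Set.Icc t₀ t₁ ×ˢ Set.Icc s₀ s₁))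
    {u y : ℝ → ℝ → Matrix ι ι 𝕜} (hu0 : ∀ s ∈ Set.Icc s₀ s₁, u s t₀ = 1)
    (hu : ∀ s ∈ Set.Icc s₀ s₁, ∀ t ∈ Set.Icc t₀ t₁,
      MDeriv (u s) (-(A s t * u s t)) (Set.Icc t₀ t₁) t)
    {s : ℝ} (hs : s ∈ Set.Icc s₀ s₁) (hy0 : y s t₀ = 0)
    (hy : ∀ t ∈ Set.Icc t₀ t₁, MDeriv (y s) (C s t * u s t - A s t * y s t) (Set.Icc t₀ t₁) t)
    (hD : ∀ t ∈ Set.Icc t₀ t₁, MDeriv (D s) (D s t * A s t - A s t * D s t) (Set.Icc t₀ t₁) t)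
    (hcurl : ∀ t ∈ Set.Icc t₀ t₁, ∃ c c', MDeriv (fun s => A s t) c (Set.Icc s₀ s₁) s ∧
      MDeriv (B s) c' (Set.Icc t₀ t₁) t ∧ c - c' = A s t * B s t - B s t * A s t -
        (D s t * C s t + C s t * D s t)) :
    MDeriv (fun s => u s t₁) (u s t₁ * B s t₀ - B s t₁ * u s t₁ + D s t₁ * y s t₁ +
      y s t₁ * D s t₀) (Set.Icc s₀ s₁) s := by
  have hcurl' : ∀ t, ∃ c c', t ∈ Set.Icc t₀ t₁ → MDeriv (fun s => A s t) c (Set.Icc s₀ s₁) s ∧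
      MDeriv (B s) c' (Set.Icc t₀ t₁) t ∧ c - c' = A s t * B s t - B s t * A s t -
        (D s t * C s t + C s t * D s t) := by
    intro t
    by_cases ht : t ∈ Set.Icc t₀ t₁
    · obtain ⟨c, c', h⟩ := hcurl t ht
      exact ⟨c, c', fun _ => h⟩
    · exact ⟨0, 0, fun h => absurd h ht⟩
  choose c c' hcc using hcurl'
  have hAc : ∀ p q, ContinuousOn (fun t => A s t p q) (Set.Icc t₀ t₁) := fun p q =>
    (hA p q).continuousOn.comp (f := fun t => (t, s)) (by fun_prop) fun t ht => ⟨ht, hs⟩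
  obtain ⟨v, hv0, hv, hvd⟩ := exists_deriv_transport hs₀ ht₀ hA hu0 hu hs (c := c)
    fun t ht => (hcc t ht).1
  have hz := mul_transport hAc hD (hu0 s hs) (hu s hs)
  -- The covariant variation of the transport minus the expected null-homotopic term. Its equation
  -- has no source: the curl hypothesis turns the curvature into `D C + C D`, and `hz` cancels the
  -- rest.
  have key := eq_zero_of_MDeriv hAc (y := fun t => v t + B s t * u s t - u s t * B s t₀ -
      (D s t * y s t + y s t * D s t₀)) ?_ (fun t ht => ?_) t₁ ⟨ht₀.le, le_rfl⟩
  · refine (hvd t₁ ⟨ht₀.le, le_rfl⟩).congr_deriv ?_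
    rw [← sub_eq_zero, ← key]
    abel
  · simp only [hv0, hu0 s hs, hy0, Matrix.mul_one, Matrix.one_mul, Matrix.mul_zero, Matrix.zero_mul,
      zero_add, sub_self]
  · obtain ⟨h1, h2, h3⟩ := hcc t ht
    refine ((((hv t ht).add (h2.mul (hu s hs t ht))).sub ((hu s hs t ht).mul (.const (B s t₀)))).sub
      (((hD t ht).mul (hy t ht)).add ((hy t ht).mul (.const (D s t₀))))).congr_deriv ?_
    rw [sub_eq_iff_eq_add.1 h3]
    simp only [Matrix.mul_zero, Matrix.sub_mul, Matrix.mul_sub, Matrix.mul_neg, Matrix.neg_mul,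
      Matrix.mul_assoc, Matrix.add_mul, Matrix.mul_add, hz t ht]
    abel

end Variation

/-! ### Transport around a rectangle in one patch -/

open NQManifold GradedSpace QBundle

namespace SuperMap

variable {𝕜 : Type k} [RCLike 𝕜] {L : NQManifold.{v} 𝕜} {M : NQManifold.{u} 𝕜}
variable {S : Set (Fin 2 → ℝ)} {H : SuperMap S L M}
variable {V : Opens L.B} {E : QBundle.{u, w} M} {e : E.Triv} {s₀ s₁ t₀ t₁ : ℝ}

theorem continuous_pt_left (t : ℝ) : Continuous fun s => pt s t :=
  continuous_pt.comp (Continuous.prodMk continuous_id continuous_const)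

theorem continuous_pt_right (s : ℝ) : Continuous fun t => pt s t :=
  continuous_pt.comp (Continuous.prodMk continuous_const continuous_id)

theorem image_pt_left {t : ℝ} (ht : t ∈ Set.Icc t₀ t₁) :
    (fun s => pt s t) '' Set.Icc s₀ s₁ ⊆ rect s₀ s₁ t₀ t₁ := by
  rintro _ ⟨s, hs, rfl⟩
  exact pt_mem_rect hs ht

theorem image_pt_right {s : ℝ} (hs : s ∈ Set.Icc s₀ s₁) :
    (fun t => pt s t) '' Set.Icc t₀ t₁ ⊆ rect s₀ s₁ t₀ t₁ := by
  rintro _ ⟨t, ht, rfl⟩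
  exact pt_mem_rect hs ht

theorem MapsInto.contDiffOn_rep {m n : Type*} {U : Opens M.B}
    (h : H.MapsInto (rect s₀ s₁ t₀ t₁) V U) (K : Finset (Fin 2)) (A : Matrix m n (M.O U))
    {κ : L.Coords} {R : ℕ} {x : L.B} (hx : x ∈ V) (hκ : x ∈ κ.V) (p : m × κ.Idx R)
    (q : n × κ.Idx R) :
    ContDiffOn ℝ ∞ (fun z : ℝ × ℝ => κ.rep R x (H.pullM (pt z.2 z.1) V K A) p q)
      (Set.Icc t₀ t₁ ×ˢ Set.Icc s₀ s₁) := by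
  simp only [Coords.rep_apply hx hκ]
  refine ContDiffOn.sum fun I _ => ContDiffOn.mul ?_ contDiffOn_const
  have hpt : ContDiff ℝ ∞ fun z : ℝ × ℝ => pt z.2 z.1 :=
    contDiff_pi.2 fun i => by fin_cases i <;> simp [pt] <;> fun_prop
  exact (h.contDiffOn isCompact_rect (A p.1 q.1) K I.1 hx hκ).comp hpt.contDiffOn
    fun z hz => pt_mem_rect hz.2 hz.1

/-- A non-abelian Stokes theorem. By `transport_variation` the transport in `t`, as a function of
`s`, satisfies the hypothesis of `transport_homotopy` for a transition matrix between the
connections along the edges `t₀` and `t₁`; integrating once more over `s` compares the two ways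
around. -/
theorem MapsInto.square (hS : IsFat S) (hs₀ : s₀ ≤ s₁) (ht₀ : t₀ ≤ t₁)
    (h : H.MapsInto (rect s₀ s₁ t₀ t₁) V e.U) {W₀ W₁ P₀ P₁ : Matrix (Fin e.r) (Fin e.r) (L.O V)}
    (hW₀ : H.IsTransport (fun t => pt s₀ t) 1 V e t₀ t₁ W₀)
    (hW₁ : H.IsTransport (fun t => pt s₁ t) 1 V e t₀ t₁ W₁)
    (hP₀ : H.IsTransport (fun s => pt s t₀) 0 V e s₀ s₁ P₀)
    (hP₁ : H.IsTransport (fun s => pt s t₁) 0 V e s₀ s₁ P₁) :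
    Htpy (H.frame (pt s₀ t₀) V e) (H.frame (pt s₁ t₁) V e) (W₁ * P₀) (P₁ * W₀) := by
  have hs0 : s₀ ∈ Set.Icc s₀ s₁ := ⟨le_rfl, hs₀⟩
  have hs1 : s₁ ∈ Set.Icc s₀ s₁ := ⟨hs₀, le_rfl⟩
  have ht0 : t₀ ∈ Set.Icc t₀ t₁ := ⟨le_rfl, ht₀⟩
  have ht1 : t₁ ∈ Set.Icc t₀ t₁ := ⟨ht₀, le_rfl⟩
  have hl : ∀ {t}, t ∈ Set.Icc t₀ t₁ → H.MapsInto ((fun s => pt s t) '' Set.Icc s₀ s₁) V e.U :=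
    fun ht => h.mono (image_pt_left ht)
  have hr : ∀ {s}, s ∈ Set.Icc s₀ s₁ → H.MapsInto ((fun t => pt s t) '' Set.Icc t₀ t₁) V e.U :=
    fun hs => h.mono (image_pt_right hs)
  -- Degenerate rectangles are separated because derivatives within an interval determine nothing
  -- when it is a point.
  rcases hs₀.eq_or_lt with rfl | hs
  · rw [hP₀.eq_one hS (continuous_pt_left _) (hl ht0), hP₁.eq_one hS (continuous_pt_left _) (hl ht1),
      mul_one, one_mul, IsPOE.unique ht₀ hW₀ hW₁]
    exact .refl _
  rcases ht₀.eq_or_lt with rfl | ht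
  · rw [hW₀.eq_one hS (continuous_pt_right _) (hr hs0), hW₁.eq_one hS (continuous_pt_right _) (hr hs1),
      mul_one, one_mul, IsPOE.unique hs₀ hP₀ hP₁]
    exact .refl _
  have sm : ∀ (K : Finset (Fin 2)) (A : Matrix (Fin e.r) (Fin e.r) (M.O e.U)) (α β : Fin e.r),
      IsSmoothFam fun q : Set.Icc s₀ s₁ × Set.Icc t₀ t₁ => H.pullM (pt q.1 q.2) V K A α β :=
    fun K A α β => MapsInto.isSmoothFam
      (γ := fun q : Set.Icc s₀ s₁ × Set.Icc t₀ t₁ => pt q.1 q.2) hS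
      (continuous_pt.comp (f := fun q : Set.Icc s₀ s₁ × Set.Icc t₀ t₁ => ((q.1 : ℝ), (q.2 : ℝ)))
        (by fun_prop))
      (h.mono (by rintro _ ⟨q, rfl⟩; exact pt_mem_rect q.1.2 q.2.2)) (A α β) K
  obtain ⟨X, W, sX, hW, dX, hX⟩ := exists_block (K := Set.Icc s₀ s₁) ht₀ e.lev e.lev
    (fun s t => H.conn 1 (pt s t) V e) (fun s t => H.conn 1 (pt s t) V e)
    (fun s t => H.pullM (pt s t) V {0, 1} (qmat e)) (sm _ _) (sm _ _) (sm _ _)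
    (fun s t ht => h.conn_mem (pt_mem_rect s.2 ht) 1) (fun s t ht => h.conn_mem (pt_mem_rect s.2 ht) 1)
    (fun s t ht α β => by
      have := h.pull_mem (pt_mem_rect s.2 ht) (qmat_mem' e α β) {0, 1}
      rw [show ({0, 1} : Finset (Fin 2)).card = 2 by decide] at this
      rwa [show e.lev β - e.lev α + 1 - (2 : ℕ) = e.lev β - e.lev α - 1 by push_cast; ring] at this)
  have eW₀ : W ⟨s₀, hs0⟩ = W₀ := IsPOE.unique ht₀ (hW _) hW₀
  have eW₁ : W ⟨s₁, hs1⟩ = W₁ := IsPOE.unique ht₀ (hW _) hW₁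
  let pr : ℝ → Set.Icc s₀ s₁ := Set.projIcc s₀ s₁ hs₀
  have hpr : ∀ s (hs : s ∈ Set.Icc s₀ s₁), pr s = ⟨s, hs⟩ := fun s hs => Set.projIcc_of_mem hs₀ hs
  -- The homotopy for the rectangle is the solution in `s` driven by `X`, which already contains the
  -- integral over `t` of the curvature potential.
  obtain ⟨N, P, hP, dN, hN⟩ := exists_block_single hs₀ e.lev e.lev
    (fun s => H.conn 0 (pt s t₁) V e) (fun s => H.conn 0 (pt s t₀) V e) (fun s => X (pr s))
    ((hl ht1).isSmoothFam_line hS (continuous_pt_left _) {0} _)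
    ((hl ht0).isSmoothFam_line hS (continuous_pt_left _) {0} _)
    (fun α β => (sX α β).comp (g := fun s : Set.Icc s₀ s₁ => pr s) (by fun_prop))
    (fun s hs => h.conn_mem (pt_mem_rect hs ht1) 0) (fun s hs => h.conn_mem (pt_mem_rect hs ht0) 0)
    (fun s hs => dX _)
  have eP : P = P₀ := IsPOE.unique hs₀ hP hP₀
  refine ⟨N, dN, fun κ R hR x hx hκ => ?_⟩
  obtain ⟨y, u', hy0, hyb, hu0', hub', hy, hu'⟩ := hN κ R x hx hκ
  obtain ⟨u, hu0, hub, hu⟩ := hP₁.exists_solution (R := R) hS (continuous_pt_left _) hs₀ (hl ht1)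
    hx hκ
  choose Y Ω hY0 hYb hΩ0 hΩb hY hΩ using fun s => hX s κ R x hx hκ
  have hvar : ∀ s ∈ Set.Icc s₀ s₁, MDeriv (fun s => κ.rep R x (W (pr s)))
      (κ.rep R x (W (pr s)) * κ.rep R x (H.conn 0 (pt s t₀) V e) -
        κ.rep R x (H.conn 0 (pt s t₁) V e) * κ.rep R x (W (pr s)) +
        κ.rep R x (H.D₀ (pt s t₁) V e) * κ.rep R x (X (pr s)) +
        κ.rep R x (X (pr s)) * κ.rep R x (H.D₀ (pt s t₀) V e)) (Set.Icc s₀ s₁) s := by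
    intro s hs'
    simp only [← hΩb, ← hYb]
    refine transport_variation (A := fun s t => κ.rep R x (H.conn 1 (pt s t) V e))
      (B := fun s t => κ.rep R x (H.conn 0 (pt s t) V e))
      (D := fun s t => κ.rep R x (H.D₀ (pt s t) V e))
      (C := fun s t => κ.rep R x (H.pullM (pt s t) V {0, 1} (qmat e)))
      (u := fun s t => Ω (pr s) t) (y := fun s t => Y (pr s) t) hs ht
      (fun p q => h.contDiffOn_rep {1} (repMat e) hx hκ p q) (fun s _ => hΩ0 (pr s))
      (fun s hs' t ht' => ?_) hs' (hY0 (pr s)) (fun t ht' => ?_) (fun t ht' => ?_) (fun t ht' => ?_)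
    · have := hΩ (pr s) t ht'
      simp only [hpr s hs'] at this ⊢
      exact this
    · have := hY (pr s) t ht'
      simp only [hpr s hs'] at this ⊢
      exact this
    · exact (hr hs').mderiv_D₀ (hasDerivAt_pt_right s) hR hx hκ ht'
    · choose c c' h1 h2 h3 using fun (a : M.O e.U) (I : κ.Idx R) =>
        h.exists_curl hR hx hκ a I.2 hs' ht'
      refine ⟨fun p q => ∑ I : κ.Idx R, c (repMat e p.1 q.1) I * κ.structConst I.1 q.2.1 p.2.1 x,
        fun p q => ∑ I : κ.Idx R, c' (repMat e p.1 q.1) I * κ.structConst I.1 q.2.1 p.2.1 x,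
        fun p q => ?_, fun p q => ?_, ?_⟩
      · simp only [Coords.rep_apply hx hκ]
        exact HasDerivWithinAt.fun_sum fun I _ => (h1 _ I).mul_const _
      · simp only [Coords.rep_apply hx hκ]
        exact HasDerivWithinAt.fun_sum fun I _ => (h2 _ I).mul_const _
      · have h4 := congrArg (κ.rep R x) (h.pullM_Q_repMat_pair (pt_mem_rect hs' ht'))
        simp only [Coords.rep_sub, Coords.rep_add, Coords.rep_mul hx hκ] at h4
        rw [← h4]
        ext p q
        rw [Coords.rep_apply hx hκ]
        refine Finset.sum_sub_distrib _ _ |>.symm.trans ?_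
        refine Finset.sum_congr rfl fun I _ => ?_
        rw [← sub_mul, ← h3]
        rfl
  have := transport_homotopy hs₀ ((hl ht1).continuousOn_rep_line hS (continuous_pt_left _) {0} _ hx hκ)
    ((hl ht0).continuousOn_rep_line hS (continuous_pt_left _) {0} _ hx hκ)
    (fun s hs => (hl ht1).mderiv_D₀ (hasDerivAt_pt_left t₁) hR hx hκ hs)
    (fun s hs => (hl ht0).mderiv_D₀ (hasDerivAt_pt_left t₀) hR hx hκ hs) hvar
    hu0 hu hu0' hu' hy0 hy
  rw [hub, hub', hyb, hpr s₀ hs0, hpr s₁ hs1, eW₀, eW₁, eP] at this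
  simp only [Coords.rep_sub, Coords.rep_add, Coords.rep_mul hx hκ]
  exact this

end SuperMap

/-! ### Wilson lines along coordinate lines -/

open NQManifold GradedSpace QBundle

/-- A line in the direction of the `j`-th coordinate. -/
def IsLine {d : ℕ} (γ : ℝ → Fin d → ℝ) (j : Fin d) : Prop := ∀ τ, HasDerivAt γ (Pi.single j 1) τ

theorem IsLine.continuous {d : ℕ} {γ : ℝ → Fin d → ℝ} {j : Fin d} (h : IsLine γ j) :
    Continuous γ := continuous_iff_continuousAt.2 fun τ => (h τ).continuousAt

namespace SuperMap

variable {𝕜 : Type k} [RCLike 𝕜] {L : NQManifold.{v} 𝕜} {M : NQManifold.{u} 𝕜} {d : ℕ}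
variable {S : Set (Fin d → ℝ)} {H : SuperMap S L M} {E : QBundle.{u, w} M}
variable {γ : ℝ → Fin d → ℝ} {j : Fin d} {V : Opens L.B} {a b c : ℝ}

/-- The Wilson lines along a coordinate line. -/
inductive IsLineWL (H : SuperMap S L M) (γ : ℝ → Fin d → ℝ) (j : Fin d) (V : Opens L.B) :
    ∀ (_ _ : ℝ) (e e' : E.Triv), Matrix (Fin e'.r) (Fin e.r) (L.O V) → Prop
  | piece (a b : ℝ) (e : E.Triv) (W : Matrix (Fin e.r) (Fin e.r) (L.O V)) :
      a ≤ b → H.MapsInto (γ '' Set.Icc a b) V e.U → H.IsTransport γ j V e a b W →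
      IsLineWL H γ j V a b e e W
  | splice (a b c : ℝ) (e₀ e₁ e₂ e₃ : E.Triv) (W₁ : Matrix (Fin e₁.r) (Fin e₀.r) (L.O V))
      (W₂ : Matrix (Fin e₃.r) (Fin e₂.r) (L.O V)) :
      IsLineWL H γ j V a b e₀ e₁ W₁ → IsLineWL H γ j V b c e₂ e₃ W₂ →
      IsLineWL H γ j V a c e₀ e₃ (W₂ * H.trans (γ b) V e₂ e₁ * W₁)

namespace IsLineWL

variable {e e' e₀ e₁ e₂ : E.Triv} {W : Matrix (Fin e'.r) (Fin e.r) (L.O V)}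

theorem le (h : IsLineWL H γ j V a b e e' W) : a ≤ b := by
  induction h with
  | piece a b e W hab _ _ => exact hab
  | splice a b c e₀ e₁ e₂ e₃ W₁ W₂ _ _ h₁ h₂ => exact h₁.trans h₂

theorem mapsInto_left (h : IsLineWL H γ j V a b e e' W) : H.MapsInto {γ a} V e.U := by
  induction h with
  | piece a b e W hab h _ => exact h.mono (Set.singleton_subset_iff.2 ⟨a, ⟨le_rfl, hab⟩, rfl⟩)
  | splice a b c e₀ e₁ e₂ e₃ W₁ W₂ _ _ h₁ h₂ => exact h₁

theorem mapsInto_right (h : IsLineWL H γ j V a b e e' W) : H.MapsInto {γ b} V e'.U := by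
  induction h with
  | piece a b e W hab h _ => exact h.mono (Set.singleton_subset_iff.2 ⟨b, ⟨hab, le_rfl⟩, rfl⟩)
  | splice a b c e₀ e₁ e₂ e₃ W₁ W₂ _ _ h₁ h₂ => exact h₂

theorem isMor (h : IsLineWL H γ j V a b e e' W) (hS : IsFat S) (hγ : IsLine γ j) :
    IsMor (H.frame (γ a) V e) (H.frame (γ b) V e') W := by
  induction h with
  | piece a b e W hab h hW => exact hW.isMor hS hγ hγ.continuous hab h
  | splice a b c e₀ e₁ e₂ e₃ W₁ W₂ h₁ h₂ ih₁ ih₂ =>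
    exact (ih₂.mul (h₂.mapsInto_left.isMor_trans h₁.mapsInto_right rfl)).mul ih₁

theorem res (h : IsLineWL H γ j V a b e e' W) {V' : Opens L.B} (hV : V' ≤ V) :
    IsLineWL H γ j V' a b e e' (W.map (L.res hV)) := by
  induction h with
  | piece a b e W hab h hW => exact .piece a b e _ hab (h.res hV) (hW.res h hV)
  | splice a b c e₀ e₁ e₂ e₃ W₁ W₂ h₁ h₂ ih₁ ih₂ =>
    rw [Matrix.map_mul, Matrix.map_mul,
      (h₂.mapsInto_left.inf h₁.mapsInto_right).pullM_res_right rfl hV]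
    exact .splice a b c e₀ e₁ e₂ e₃ _ _ ih₁ ih₂

theorem mul {W₁ : Matrix (Fin e₁.r) (Fin e₀.r) (L.O V)} {W₂ : Matrix (Fin e₂.r) (Fin e₁.r) (L.O V)}
    (h₁ : IsLineWL H γ j V a b e₀ e₁ W₁) (h₂ : IsLineWL H γ j V b c e₁ e₂ W₂) :
    IsLineWL H γ j V a c e₀ e₂ (W₂ * W₁) := by
  have := IsLineWL.splice _ _ _ _ _ _ _ _ _ h₁ h₂
  rwa [h₂.mapsInto_left.trans_self rfl, Matrix.mul_one] at this

/-- A Wilson line can be cut at any time: inside a piece the transport is multiplicative, and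
otherwise the cut is made in one of the two factors. This gives common refinements of subdivisions.
-/
theorem exists_mul_eq (h : IsLineWL H γ j V a c e e' W) (hS : IsFat S) (hγ : IsLine γ j)
    (hab : a ≤ b) (hbc : b ≤ c) : ∃ (e₁ : E.Triv) (W₁ : Matrix (Fin e₁.r) (Fin e.r) (L.O V))
      (W₂ : Matrix (Fin e'.r) (Fin e₁.r) (L.O V)), IsLineWL H γ j V a b e e₁ W₁ ∧
      IsLineWL H γ j V b c e₁ e' W₂ ∧ W = W₂ * W₁ := by
  induction h with
  | piece a c e W hac h hW =>
    have h₁ := h.mono (Set.image_mono (Set.Icc_subset_Icc_right hbc))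
    have h₂ := h.mono (Set.image_mono (Set.Icc_subset_Icc_left hab))
    obtain ⟨W₁, hW₁, -⟩ := h₁.exists_transport (j := j) hS hγ.continuous hab
    obtain ⟨W₂, hW₂, -⟩ := h₂.exists_transport (j := j) hS hγ.continuous hbc
    exact ⟨e, W₁, W₂, .piece _ _ _ _ hab h₁ hW₁, .piece _ _ _ _ hbc h₂ hW₂,
      hW.eq_mul hW₁ hW₂ hS hγ.continuous hab hbc h⟩
  | splice a b' c e₀ e₁ e₂ e₃ W₁ W₂ h₁ h₂ ih₁ ih₂ =>
    rcases le_total b b' with hb | hb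
    · obtain ⟨e', X₁, X₂, hX₁, hX₂, rfl⟩ := ih₁ hab hb
      exact ⟨e', X₁, _, hX₁, .splice _ _ _ _ _ _ _ _ _ hX₂ h₂, (Matrix.mul_assoc _ _ _).symm⟩
    · obtain ⟨e', X₁, X₂, hX₁, hX₂, rfl⟩ := ih₂ hb hbc
      exact ⟨e', _, X₂, .splice _ _ _ _ _ _ _ _ _ h₁ hX₁, hX₂, by simp only [Matrix.mul_assoc]⟩

/-- Comparison of an arbitrary Wilson line with the transport in a single patch: the latter is cut
wherever the former is spliced, each piece is `IsTransport.htpy`, and the cocycle rule joins the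
pieces. -/
theorem piece_htpy {e₀' e₁' : E.Triv} {W' : Matrix (Fin e₁'.r) (Fin e₀'.r) (L.O V)}
    (h' : IsLineWL H γ j V a b e₀' e₁' W') {W : Matrix (Fin e.r) (Fin e.r) (L.O V)} (hS : IsFat S)
    (hγ : IsLine γ j) (h : H.MapsInto (γ '' Set.Icc a b) V e.U) (hW : H.IsTransport γ j V e a b W) :
    Htpy (H.frame (γ a) V e₀') (H.frame (γ b) V e) (H.trans (γ b) V e e₁' * W')
      (W * H.trans (γ a) V e e₀') := by
  induction h' generalizing W with
  | piece a b e' W' hab h' hW' => exact hW.htpy hW' hS hγ hγ.continuous hab h h'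
  | splice a b c e₀' e₁' e₂' e₃' W₁' W₂' h₁' h₂' ih₁ ih₂ =>
    have hab := h₁'.le
    have hbc := h₂'.le
    have h₁ := h.mono (Set.image_mono (Set.Icc_subset_Icc_right hbc))
    have h₂ := h.mono (Set.image_mono (Set.Icc_subset_Icc_left hab))
    have hb : H.MapsInto {γ b} V e.U :=
      h.mono (Set.singleton_subset_iff.2 ⟨b, ⟨hab, hbc⟩, rfl⟩)
    obtain ⟨X₁, hX₁, -⟩ := h₁.exists_transport (j := j) hS hγ.continuous hab
    obtain ⟨X₂, hX₂, -⟩ := h₂.exists_transport (j := j) hS hγ.continuous hbc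
    rw [hW.eq_mul hX₁ hX₂ hS hγ.continuous hab hbc h]
    have q₁ := (ih₁ h₁ hX₁).mul_left (hX₂.isMor hS hγ hγ.continuous hbc h₂)
    have q₂ := (ih₂ h₂ hX₂).mul_right
      ((h₂'.mapsInto_left.isMor_trans h₁'.mapsInto_right rfl).mul (h₁'.isMor hS hγ))
    have q₃ : X₂ * H.trans (γ b) V e e₂' * (H.trans (γ b) V e₂' e₁' * W₁') =
        X₂ * (H.trans (γ b) V e e₁' * W₁') := by
      rw [Matrix.mul_assoc, ← Matrix.mul_assoc (H.trans (γ b) V e e₂'),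
        hb.trans_mul_trans h₂'.mapsInto_left h₁'.mapsInto_right rfl]
    rw [q₃] at q₂
    have := q₂.trans q₁
    simp only [Matrix.mul_assoc] at this ⊢
    exact this

/-- Wilson lines formed with different subdivisions and trivializations are homotopic. -/
theorem htpy {e₁ e₀' e₁' : E.Triv} {W : Matrix (Fin e₁.r) (Fin e₀.r) (L.O V)}
    {W' : Matrix (Fin e₁'.r) (Fin e₀'.r) (L.O V)} (h : IsLineWL H γ j V a b e₀ e₁ W)
    (h' : IsLineWL H γ j V a b e₀' e₁' W') (hS : IsFat S) (hγ : IsLine γ j) :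
    Htpy (H.frame (γ a) V e₀') (H.frame (γ b) V e₁) (H.trans (γ b) V e₁ e₁' * W')
      (W * H.trans (γ a) V e₀ e₀') := by
  induction h generalizing e₀' e₁' with
  | piece a b e W hab h hW => exact h'.piece_htpy hS hγ h hW
  | splice a b c e₀ e₁ e₂ e₃ W₁ W₂ h₁ h₂ ih₁ ih₂ =>
    -- The second line is cut at the splicing point of the first; the cocycle rule at that point
    -- matches the two homotopies.
    obtain ⟨e', W₁', W₂', h₁', h₂', rfl⟩ := h'.exists_mul_eq hS hγ h₁.le h₂.le
    have q₁ := (ih₁ h₁').mul_left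
      ((h₂.isMor hS hγ).mul (h₂.mapsInto_left.isMor_trans h₁.mapsInto_right rfl))
    have q₂ := (ih₂ h₂').mul_right (h₁'.isMor hS hγ)
    have q₃ : W₂ * H.trans (γ b) V e₂ e₁ * (H.trans (γ b) V e₁ e' * W₁') =
        W₂ * H.trans (γ b) V e₂ e' * W₁' := by
      rw [Matrix.mul_assoc, ← Matrix.mul_assoc (H.trans (γ b) V e₂ e₁),
        h₂.mapsInto_left.trans_mul_trans h₁.mapsInto_right h₂'.mapsInto_left rfl, Matrix.mul_assoc]
    rw [q₃] at q₁
    have := q₂.trans q₁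
    simp only [Matrix.mul_assoc] at this ⊢
    exact this

end IsLineWL

/-! #### Existence -/

/-- Wilson lines exist between any two trivializations at the end points. -/
def Connects (H : SuperMap S L M) (E : QBundle.{u, w} M) (γ : ℝ → Fin d → ℝ) (j : Fin d)
    (V : Opens L.B) (a b : ℝ) : Prop :=
  ∀ e₀ e₁ : E.Triv, H.MapsInto {γ a} V e₀.U → H.MapsInto {γ b} V e₁.U →
    ∃ W, IsLineWL H γ j V a b e₀ e₁ W

theorem MapsInto.exists_piece {e : E.Triv} (h : H.MapsInto (γ '' Set.Icc a b) V e.U) (hS : IsFat S)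
    (hγ : IsLine γ j) (hab : a ≤ b) : ∃ W, IsLineWL H γ j V a b e e W := by
  obtain ⟨W, hW, -⟩ := h.exists_transport (j := j) hS hγ.continuous hab
  exact ⟨W, .piece a b e W hab h hW⟩

/-- Pieces of length zero in the prescribed trivializations are spliced on at both ends, which
inserts the changes of trivialization. -/
theorem MapsInto.connects {e : E.Triv} (h : H.MapsInto (γ '' Set.Icc a b) V e.U) (hS : IsFat S)
    (hγ : IsLine γ j) (hab : a ≤ b) : H.Connects E γ j V a b := by
  intro e₀ e₁ h₀ h₁
  have hi : ∀ {c} {e : E.Triv}, H.MapsInto {γ c} V e.U → ∃ W, IsLineWL H γ j V c c e e W :=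
    fun h => MapsInto.exists_piece (by rwa [Set.Icc_self, Set.image_singleton]) hS hγ le_rfl
  obtain ⟨W, hW⟩ := h.exists_piece hS hγ hab
  obtain ⟨W₀, hW₀⟩ := hi h₀
  obtain ⟨W₁, hW₁⟩ := hi h₁
  exact ⟨_, (hW₀.splice _ _ _ _ _ _ _ _ _ hW).splice _ _ _ _ _ _ _ _ _ hW₁⟩

theorem Connects.trans (h₁ : H.Connects E γ j V a b) (h₂ : H.Connects E γ j V b c) {e : E.Triv}
    (h : H.MapsInto {γ b} V e.U) : H.Connects E γ j V a c := by
  intro e₀ e₁ he₀ he₁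
  obtain ⟨W₁, hW₁⟩ := h₁ e₀ e he₀ h
  obtain ⟨W₂, hW₂⟩ := h₂ e e₁ h he₁
  exact ⟨_, hW₁.mul hW₂⟩

theorem connects_of_cover (hS : IsFat S) (hγ : IsLine γ j) {t : ℕ → ℝ} (ht : Monotone t) {m : ℕ}
    (h : ∀ i ≤ m, ∃ e : E.Triv, H.MapsInto (γ '' Set.Icc (t i) (t (i + 1))) V e.U) :
    ∀ i ≤ m, H.Connects E γ j V (t 0) (t i) := by
  intro i
  induction i with
  | zero =>
    intro hi
    obtain ⟨e, he⟩ := h 0 hi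
    exact (he.mono (Set.image_mono (Set.Icc_subset_Icc_right (ht (Nat.zero_le 1))))).connects hS hγ
      le_rfl
  | succ i ih =>
    intro hi
    obtain ⟨e, he⟩ := h i (Nat.le_of_succ_le hi)
    exact (ih (Nat.le_of_succ_le hi)).trans (he.connects hS hγ (ht i.le_succ)) (e := e)
      (he.mono (Set.singleton_subset_iff.2 ⟨_, ⟨le_rfl, ht i.le_succ⟩, rfl⟩))

theorem _root_.exists_nhds_forall_finset {B : Type*} [TopologicalSpace B] {ι : Type*} (s : Finset ι)
    {P : ι → Opens B → Prop} (hP : ∀ i U U', U' ≤ U → P i U → P i U') {x : B}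
    (h : ∀ i ∈ s, ∃ U : Opens B, x ∈ U ∧ P i U) : ∃ U : Opens B, x ∈ U ∧ ∀ i ∈ s, P i U := by
  classical
  induction s using Finset.induction_on with
  | empty => exact ⟨⊤, trivial, fun i hi => absurd hi (Finset.notMem_empty i)⟩
  | insert i s _ ih =>
    obtain ⟨U, hxU, hU⟩ := ih fun i hi => h i (Finset.mem_insert_of_mem hi)
    obtain ⟨U', hxU', hU'⟩ := h i (Finset.mem_insert_self i s)
    refine ⟨U ⊓ U', ⟨hxU, hxU'⟩, fun k hk => ?_⟩
    rcases Finset.mem_insert.1 hk with rfl | hk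
    · exact hP _ _ _ inf_le_right hU'
    · exact hP _ _ _ inf_le_left (hU k hk)

theorem exists_mapsInto {Z : Set (Fin d → ℝ)} (hZ : IsCompact Z) (hZS : Z ⊆ S) {U : Opens M.B}
    {x : L.B} (h : ∀ t ∈ Z, H.f t x ∈ U) : ∃ V' : Opens L.B, x ∈ V' ∧ H.MapsInto Z V' U := by
  obtain ⟨J, -, hZJ, V', hx, hV'⟩ := H.exists_tube hZ hZS h
  exact ⟨V', hx, fun t ht => ⟨hZS ht, fun y hy => hV' t ⟨hZJ ht, hZS ht⟩ y hy⟩⟩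

theorem continuous_comp_f {X : Type*} [TopologicalSpace X] {g : X → Fin d → ℝ} (hg : Continuous g)
    (h : ∀ t, g t ∈ S) (x : L.B) : Continuous fun t => H.f (g t) x :=
  H.f_smooth.continuousOn.comp_continuous (f := fun t => (g t, x)) (by fun_prop)
    fun t => ⟨h t, trivial⟩

/-- Over one point a finite subdivision has its pieces in trivialization patches. By the tube lemma
each piece stays there over a neighbourhood, and finitely many neighbourhoods are intersected. -/
theorem exists_connects (E : QBundle.{u, w} M) (hS : IsFat S) (hγ : IsLine γ j)
    (h : ∀ t ∈ Set.Icc (0 : ℝ) 1, γ t ∈ S) {x : L.B} (hx : x ∈ V) :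
    ∃ V' ≤ V, x ∈ V' ∧ H.Connects E γ j V' 0 1 := by
  have hf : Continuous fun t : Set.Icc (0 : ℝ) 1 => H.f (γ t) x :=
    continuous_comp_f (hγ.continuous.comp continuous_subtype_val) (fun t => h t t.2) x
  obtain ⟨t, ht0, ht, ⟨m, hm⟩, hc⟩ := exists_monotone_Icc_subset_open_cover_unitInterval
    (c := fun e : E.Triv => (fun t : Set.Icc (0 : ℝ) 1 => H.f (γ t) x) ⁻¹' e.U)
    (fun e => e.U.isOpen.preimage hf)
    fun t _ => Set.mem_iUnion.2 (E.locally_trivial (H.f (γ t) x))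
  have hcov : ∀ i ∈ Finset.range (m + 1), ∃ V : Opens L.B, x ∈ V ∧
      ∃ e : E.Triv, H.MapsInto (γ '' Set.Icc (t i) (t (i + 1))) V e.U := by
    intro i _
    obtain ⟨e, he⟩ := hc i
    obtain ⟨V, hxV, hV⟩ := H.exists_mapsInto (Z := γ '' Set.Icc (t i) (t (i + 1))) (U := e.U) (x := x)
      (isCompact_Icc.image hγ.continuous)
      (by rintro _ ⟨τ, hτ, rfl⟩; exact h τ ⟨(t i).2.1.trans hτ.1, hτ.2.trans (t (i + 1)).2.2⟩)
      (by
        rintro _ ⟨τ, hτ, rfl⟩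
        exact he (a := ⟨τ, (t i).2.1.trans hτ.1, hτ.2.trans (t (i + 1)).2.2⟩) ⟨hτ.1, hτ.2⟩)
    exact ⟨V, hxV, e, hV⟩
  obtain ⟨V', hxV, hV⟩ := exists_nhds_forall_finset _
    (fun i U U' hU ⟨e, he⟩ => ⟨e, he.res hU⟩) hcov
  have := connects_of_cover (V := V' ⊓ V) (t := fun i => (t i : ℝ)) hS hγ (fun i k h => ht h)
    (fun i hi => (hV i (Finset.mem_range_succ_iff.2 hi)).imp fun e he => he.res inf_le_left) m le_rfl
  rw [ht0, hm m le_rfl] at this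
  exact ⟨V' ⊓ V, inf_le_right, ⟨hxV, hx⟩, this⟩

end SuperMap

/-! ### Wilson lines around a rectangle -/

open NQManifold GradedSpace QBundle

theorem isLine_pt_left (t : ℝ) : IsLine (fun s => pt s t) 0 := hasDerivAt_pt_left t

theorem isLine_pt_right (s : ℝ) : IsLine (fun t => pt s t) 1 := hasDerivAt_pt_right s

namespace SuperMap

variable {𝕜 : Type k} [RCLike 𝕜] {L : NQManifold.{v} 𝕜} {M : NQManifold.{u} 𝕜}
variable {S : Set (Fin 2 → ℝ)} {H : SuperMap S L M} {E : QBundle.{u, w} M}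
variable {V : Opens L.B} {s₀ s₁ s₂ t₀ t₁ t₂ : ℝ}

/-- The Wilson lines along the two ways around a rectangle are homotopic. -/
def Commutes (H : SuperMap S L M) (E : QBundle.{u, w} M) (V : Opens L.B) (s₀ s₁ t₀ t₁ : ℝ) : Prop :=
  ∀ (e₀ e₁ e₀' e₁' : E.Triv)
    (W₀ : Matrix (Fin e₁.r) (Fin e₀.r) (L.O V)) (W₁ : Matrix (Fin e₁'.r) (Fin e₀'.r) (L.O V))
    (P₀ : Matrix (Fin e₀'.r) (Fin e₀.r) (L.O V)) (P₁ : Matrix (Fin e₁'.r) (Fin e₁.r) (L.O V)),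
    IsLineWL H (fun t => pt s₀ t) 1 V t₀ t₁ e₀ e₁ W₀ →
    IsLineWL H (fun t => pt s₁ t) 1 V t₀ t₁ e₀' e₁' W₁ →
    IsLineWL H (fun s => pt s t₀) 0 V s₀ s₁ e₀ e₀' P₀ →
    IsLineWL H (fun s => pt s t₁) 0 V s₀ s₁ e₁ e₁' P₁ →
    Htpy (H.frame (pt s₀ t₀) V e₀) (H.frame (pt s₁ t₁) V e₁') (W₁ * P₀) (P₁ * W₀)

/-- The edges may carry other trivializations than `e`. Each is compared with the transport in `e`,
for which `square` applies; this proves the claim up to a transition matrix at the final corner. -/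
theorem MapsInto.commutes {e : E.Triv} (h : H.MapsInto (rect s₀ s₁ t₀ t₁) V e.U) (hS : IsFat S) :
    H.Commutes E V s₀ s₁ t₀ t₁ := by
  intro e₀ e₁ e₀' e₁' W₀ W₁ P₀ P₁ hW₀ hW₁ hP₀ hP₁
  have hs := hP₀.le
  have ht := hW₀.le
  have hl : ∀ {t}, t ∈ Set.Icc t₀ t₁ → H.MapsInto ((fun s => pt s t) '' Set.Icc s₀ s₁) V e.U :=
    fun ht => h.mono (image_pt_left ht)
  have hr : ∀ {s}, s ∈ Set.Icc s₀ s₁ → H.MapsInto ((fun t => pt s t) '' Set.Icc t₀ t₁) V e.U :=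
    fun hs => h.mono (image_pt_right hs)
  have hs0 : s₀ ∈ Set.Icc s₀ s₁ := ⟨le_rfl, hs⟩
  have hs1 : s₁ ∈ Set.Icc s₀ s₁ := ⟨hs, le_rfl⟩
  have ht0 : t₀ ∈ Set.Icc t₀ t₁ := ⟨le_rfl, ht⟩
  have ht1 : t₁ ∈ Set.Icc t₀ t₁ := ⟨ht, le_rfl⟩
  obtain ⟨w₀, hw₀, -⟩ := (hr hs0).exists_transport (j := 1) hS (continuous_pt_right _) ht
  obtain ⟨w₁, hw₁, -⟩ := (hr hs1).exists_transport (j := 1) hS (continuous_pt_right _) ht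
  obtain ⟨p₀, hp₀, -⟩ := (hl ht0).exists_transport (j := 0) hS (continuous_pt_left _) hs
  obtain ⟨p₁, hp₁, -⟩ := (hl ht1).exists_transport (j := 0) hS (continuous_pt_left _) hs
  have h11 : H.MapsInto {pt s₁ t₁} V e.U := h.mono (Set.singleton_subset_iff.2 (pt_mem_rect hs1 ht1))
  have q := (h.square hS hs ht hw₀ hw₁ hp₀ hp₁).mul_right
    ((h.mono (Set.singleton_subset_iff.2 (pt_mem_rect hs0 ht0))).isMor_trans hW₀.mapsInto_left rfl)
  have r₀ := (hW₀.piece_htpy hS (isLine_pt_right _) (hr hs0) hw₀).mul_left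
    (hp₁.isMor hS (isLine_pt_left _) (continuous_pt_left _) hs (hl ht1))
  have r₁ := (hW₁.piece_htpy hS (isLine_pt_right _) (hr hs1) hw₁).mul_right
    (hP₀.isMor hS (isLine_pt_left _))
  have l₀ := (hP₀.piece_htpy hS (isLine_pt_left _) (hl ht0) hp₀).mul_left
    (hw₁.isMor hS (isLine_pt_right _) (continuous_pt_right _) ht (hr hs1))
  have l₁ := (hP₁.piece_htpy hS (isLine_pt_left _) (hl ht1) hp₁).mul_right
    (hW₀.isMor hS (isLine_pt_right _))
  simp only [Matrix.mul_assoc] at q r₀ r₁ l₀ l₁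
  -- Multiplication by the inverse transition matrix at the final corner removes the factor in
  -- front.
  have := ((r₁.trans l₀).trans (q.trans (r₀.symm.trans l₁.symm))).mul_left
    (hW₁.mapsInto_right.isMor_trans h11 rfl)
  simpa only [← Matrix.mul_assoc, hW₁.mapsInto_right.trans_mul_trans h11 hW₁.mapsInto_right rfl,
    hW₁.mapsInto_right.trans_self rfl, Matrix.one_mul] using this

/-- Pasting two rectangles requires a Wilson line along the common edge with matching
trivializations at its ends; this is the role of `Connects`. -/
theorem Commutes.trans_right (h : H.Commutes E V s₀ s₁ t₀ t₁) (h' : H.Commutes E V s₀ s₁ t₁ t₂)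
    (hc : H.Connects E (fun s => pt s t₁) 0 V s₀ s₁) (hS : IsFat S) (ht : t₀ ≤ t₁) (ht' : t₁ ≤ t₂) :
    H.Commutes E V s₀ s₁ t₀ t₂ := by
  intro e₀ e₁ e₀' e₁' W₀ W₁ P₀ P₁ hW₀ hW₁ hP₀ hP₁
  obtain ⟨e, X, Y, hX, hY, rfl⟩ := hW₀.exists_mul_eq hS (isLine_pt_right _) ht ht'
  obtain ⟨e', X', Y', hX', hY', rfl⟩ := hW₁.exists_mul_eq hS (isLine_pt_right _) ht ht'
  obtain ⟨P, hP⟩ := hc e e' hX.mapsInto_right hX'.mapsInto_right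
  have q := (h _ _ _ _ _ _ _ _ hX hX' hP₀ hP).mul_left (hY'.isMor hS (isLine_pt_right _))
  have q' := (h' _ _ _ _ _ _ _ _ hY hY' hP hP₁).mul_right (hX.isMor hS (isLine_pt_right _))
  simp only [Matrix.mul_assoc] at q q' ⊢
  exact q.trans q'

theorem Commutes.trans_left (h : H.Commutes E V s₀ s₁ t₀ t₁) (h' : H.Commutes E V s₁ s₂ t₀ t₁)
    (hc : H.Connects E (fun t => pt s₁ t) 1 V t₀ t₁) (hS : IsFat S) (hs : s₀ ≤ s₁) (hs' : s₁ ≤ s₂) :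
    H.Commutes E V s₀ s₂ t₀ t₁ := by
  intro e₀ e₁ e₀' e₁' W₀ W₁ P₀ P₁ hW₀ hW₁ hP₀ hP₁
  obtain ⟨e, X, Y, hX, hY, rfl⟩ := hP₀.exists_mul_eq hS (isLine_pt_left _) hs hs'
  obtain ⟨e', X', Y', hX', hY', rfl⟩ := hP₁.exists_mul_eq hS (isLine_pt_left _) hs hs'
  obtain ⟨W, hW⟩ := hc e e' hX.mapsInto_right hX'.mapsInto_right
  have q := (h _ _ _ _ _ _ _ _ hW₀ hW hX hX').mul_left (hY'.isMor hS (isLine_pt_left _))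
  have q' := (h' _ _ _ _ _ _ _ _ hW hW₁ hY hY').mul_right (hX.isMor hS (isLine_pt_left _))
  simp only [Matrix.mul_assoc] at q q' ⊢
  exact q'.trans q

theorem commutes_of_cover_right (hS : IsFat S) {t : ℕ → ℝ} (ht : Monotone t) {m : ℕ} (hs : s₀ ≤ s₁)
    (h : ∀ i ≤ m, ∃ e : E.Triv, H.MapsInto (rect s₀ s₁ (t i) (t (i + 1))) V e.U) :
    ∀ i ≤ m, H.Commutes E V s₀ s₁ (t 0) (t i) := by
  intro i
  induction i with
  | zero =>
    intro hi
    obtain ⟨e, he⟩ := h 0 hi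
    exact (he.mono (Set.image_mono (Set.prod_mono le_rfl
      (Set.Icc_subset_Icc_right (ht (Nat.zero_le 1)))))).commutes hS
  | succ i ih =>
    intro hi
    obtain ⟨e, he⟩ := h i (Nat.le_of_succ_le hi)
    exact (ih (Nat.le_of_succ_le hi)).trans_right (he.commutes hS)
      ((he.mono (image_pt_left ⟨le_rfl, ht i.le_succ⟩)).connects hS (isLine_pt_left _) hs) hS
      (ht i.zero_le) (ht i.le_succ)

/-- Small rectangles are pasted in the direction `t` into strips, and the strips in the direction
`s`. The strip of index 0 is degenerate and starts the induction. -/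
theorem commutes_of_cover (hS : IsFat S) {t : ℕ → ℝ} (ht : Monotone t) {m : ℕ}
    (h : ∀ i ≤ m, ∀ k ≤ m, ∃ e : E.Triv,
      H.MapsInto (rect (t i) (t (i + 1)) (t k) (t (k + 1))) V e.U) :
    ∀ i ≤ m, H.Commutes E V (t 0) (t i) (t 0) (t m) := by
  intro i
  induction i with
  | zero =>
    intro hi
    refine commutes_of_cover_right hS ht le_rfl (fun k hk => ?_) m le_rfl
    obtain ⟨e, he⟩ := h 0 hi k hk
    exact ⟨e, he.mono (Set.image_mono (Set.prod_mono
      (Set.Icc_subset_Icc_right (ht (Nat.zero_le 1))) le_rfl))⟩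
  | succ i ih =>
    intro hi
    have hi' := Nat.le_of_succ_le hi
    refine (ih hi').trans_left (commutes_of_cover_right hS ht (ht i.le_succ) (h i hi') m le_rfl)
      (connects_of_cover hS (isLine_pt_right _) ht (fun k hk => ?_) m le_rfl) hS (ht i.zero_le)
      (ht i.le_succ)
    obtain ⟨e, he⟩ := h i hi' k hk
    exact ⟨e, he.mono (image_pt_right ⟨le_rfl, ht i.le_succ⟩)⟩

/-- The Wilson lines around the unit square are locally homotopic. -/
theorem exists_commutes (E : QBundle.{u, w} M) (hS : IsFat S) (hSr : rect 0 1 0 1 ⊆ S) {x : L.B}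
    (hx : x ∈ V) : ∃ V' ≤ V, x ∈ V' ∧ H.Commutes E V' 0 1 0 1 := by
  have hS' : ∀ {s t : ℝ}, s ∈ Set.Icc (0 : ℝ) 1 → t ∈ Set.Icc (0 : ℝ) 1 → pt s t ∈ S :=
    fun hs ht => hSr (pt_mem_rect hs ht)
  have hf : Continuous fun q : Set.Icc (0 : ℝ) 1 × Set.Icc (0 : ℝ) 1 => H.f (pt q.1 q.2) x :=
    continuous_comp_f (continuous_pt.comp
      (f := fun q : Set.Icc (0 : ℝ) 1 × Set.Icc (0 : ℝ) 1 => ((q.1 : ℝ), (q.2 : ℝ))) (by fun_prop))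
      (fun q => hS' q.1.2 q.2.2) x
  obtain ⟨t, ht0, ht, ⟨m, hm⟩, hc⟩ := exists_monotone_Icc_subset_open_cover_unitInterval_prod_self
    (c := fun e : E.Triv =>
      (fun q : Set.Icc (0 : ℝ) 1 × Set.Icc (0 : ℝ) 1 => H.f (pt q.1 q.2) x) ⁻¹' e.U)
    (fun e => e.U.isOpen.preimage hf)
    fun q _ => Set.mem_iUnion.2 (E.locally_trivial (H.f (pt q.1 q.2) x))
  have hI : ∀ {i : ℕ} {τ : ℝ}, τ ∈ Set.Icc (t i : ℝ) (t (i + 1)) → τ ∈ Set.Icc (0 : ℝ) 1 :=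
    fun {i τ} hτ => ⟨(t i).2.1.trans hτ.1, hτ.2.trans (t (i + 1)).2.2⟩
  have hcov : ∀ q ∈ Finset.range (m + 1) ×ˢ Finset.range (m + 1), ∃ V : Opens L.B, x ∈ V ∧
      ∃ e : E.Triv, H.MapsInto (rect (t q.1) (t (q.1 + 1)) (t q.2) (t (q.2 + 1))) V e.U := by
    rintro ⟨i, k⟩ -
    obtain ⟨e, he⟩ := hc i k
    obtain ⟨V, hxV, hV⟩ := H.exists_mapsInto
      (Z := rect (t i) (t (i + 1)) (t k) (t (k + 1))) (U := e.U) (x := x) isCompact_rect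
      (by rintro _ ⟨q, hq, rfl⟩; exact hS' (hI hq.1) (hI hq.2))
      (by
        rintro _ ⟨q, hq, rfl⟩
        exact he (a := (⟨q.1, hI hq.1⟩, ⟨q.2, hI hq.2⟩)) ⟨hq.1, hq.2⟩)
    exact ⟨V, hxV, e, hV⟩
  obtain ⟨V', hxV, hV⟩ := exists_nhds_forall_finset _
    (fun i U U' hU ⟨e, he⟩ => ⟨e, he.res hU⟩) hcov
  have := commutes_of_cover (V := V' ⊓ V) (t := fun i => (t i : ℝ)) hS (fun i k h => ht h)
    (fun i hi k hk => (hV (i, k) (Finset.mem_product.2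
      ⟨Finset.mem_range_succ_iff.2 hi, Finset.mem_range_succ_iff.2 hk⟩)).imp
      fun e he => he.res inf_le_left) m le_rfl
  rw [ht0, hm m le_rfl] at this
  exact ⟨V' ⊓ V, inf_le_right, ⟨hxV, hx⟩, this⟩

end SuperMap

/-! ### Wilson lines of super-curves -/

open NQManifold GradedSpace QBundle

theorem IsFat.of_subset {d : ℕ} {S : Set (Fin d → ℝ)} (hS : Convex ℝ S)
    (h : ∀ p : Fin d → ℝ, (∀ i, p i ∈ Set.Ioo (0 : ℝ) 1) → p ∈ S) : IsFat S := by
  refine ⟨hS, fun _ => 1 / 2, interior_mono (s := Set.univ.pi fun _ => Set.Ioo (0 : ℝ) 1)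
    (fun p hp => h p fun i => hp i trivial) ?_⟩
  rw [(isOpen_set_pi Set.finite_univ fun _ _ => isOpen_Ioo).interior_eq]
  exact fun _ _ => ⟨by norm_num, by norm_num⟩

theorem isFat_Icc {d : ℕ} : IsFat (Set.Icc (0 : Fin d → ℝ) 1) :=
  .of_subset (convex_Icc _ _) fun _ hp => ⟨fun i => (hp i).1.le, fun i => (hp i).2.le⟩

theorem isFat_univ {d : ℕ} : IsFat (Set.univ : Set (Fin d → ℝ)) :=
  .of_subset convex_univ fun _ _ => trivial

theorem isFat_strip : IsFat {p : Fin 2 → ℝ | p 0 ∈ Set.Icc (0 : ℝ) 1} :=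
  .of_subset ((convex_Icc (0 : ℝ) 1).linear_preimage (LinearMap.proj (R := ℝ) (φ := fun _ : Fin 2 => ℝ) 0))
    fun _ hp => ⟨(hp 0).1.le, (hp 0).2.le⟩

theorem rect_subset_strip : rect 0 1 0 1 ⊆ {p : Fin 2 → ℝ | p 0 ∈ Set.Icc (0 : ℝ) 1} := by
  rintro _ ⟨q, hq, rfl⟩
  exact hq.1

theorem rect_subset_Icc : rect 0 1 0 1 ⊆ Set.Icc (0 : Fin 2 → ℝ) 1 := by
  rintro _ ⟨q, hq, rfl⟩
  refine ⟨fun i => ?_, fun i => ?_⟩ <;> fin_cases i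
  exacts [hq.1.1, hq.2.1, hq.1.2, hq.2.2]

theorem isLine_diag : IsLine (fun t (_ : Fin 1) => t) 0 := by
  intro τ
  rw [hasDerivAt_pi]
  intro i
  rw [Subsingleton.elim i 0, Pi.single_eq_same]
  exact hasDerivAt_id τ

section

variable {𝕜 : Type k} [RCLike 𝕜] {L : NQManifold.{v} 𝕜} {M : NQManifold.{u} 𝕜} {V : Opens L.B}

/-- A null-homotopic matrix vanishes between a row and a column annihilated by the differentials. -/
theorem NQManifold.Htpy.dotProduct_eq {m n : Type*} [Fintype m] [Fintype n] {F : Frame L V m}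
    {G : Frame L V n} {X Y : Matrix n m (L.O V)} (h : Htpy F G X Y) (hQ : ∀ U, L.Q U = 0)
    {z : n → L.O V} {z' : m → L.O V} (hz : Matrix.vecMul z G.D = 0)
    (hz' : Matrix.mulVec F.D z' = 0) :
    z ⬝ᵥ Matrix.mulVec X z' = z ⬝ᵥ Matrix.mulVec Y z' := by
  obtain ⟨N, -, hN⟩ := h
  rw [← sub_eq_zero, ← dotProduct_sub, ← Matrix.sub_mulVec, hN.eq hQ, Matrix.add_mulVec,
    dotProduct_add, ← Matrix.mulVec_mulVec, ← Matrix.mulVec_mulVec, hz', Matrix.mulVec_zero,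
    dotProduct_zero, add_zero, Matrix.dotProduct_mulVec, hz, zero_dotProduct]

namespace SuperMap

variable {d : ℕ} {S : Set (Fin d → ℝ)} {H : SuperMap S L M} {E : QBundle.{u, w} M}
variable {γ : ℝ → Fin d → ℝ} {j : Fin d} {a b : ℝ} {e e' : E.Triv}
variable {S₁ : Set (Fin 1 → ℝ)} {C : SuperMap S₁ L M} {W : Matrix (Fin e'.r) (Fin e.r) (L.O V)}

/-- `C` is the restriction of `H` to the coordinate line `γ`. -/
def RestrictsTo (H : SuperMap S L M) (γ : ℝ → Fin d → ℝ) (j : Fin d) (C : SuperMap S₁ L M) : Prop :=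
  ∀ t : ℝ, (fun _ => t) ∈ S₁ → γ t ∈ S ∧ (∀ y, C.f (fun _ => t) y = H.f (γ t) y) ∧
    ∀ U V (a : M.O U), C.pull (fun _ => t) U V a ∅ = H.pull (γ t) U V a ∅ ∧
      C.pull (fun _ => t) U V a {0} = H.pull (γ t) U V a {j}

theorem restrictsTo_self (C : SuperMap S₁ L M) : C.RestrictsTo (fun t _ => t) 0 C :=
  fun _ ht => ⟨ht, fun _ => rfl, fun _ _ _ => ⟨rfl, rfl⟩⟩

theorem IsEdge.restrictsTo_right {S : Set (Fin 2 → ℝ)} {H : SuperMap S L M} {c : ℝ}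
    (h : H.IsEdge 1 c C) (hS : ∀ t : ℝ, (fun _ => t) ∈ S₁ → pt c t ∈ S) :
    H.RestrictsTo (fun t => pt c t) 1 C := by
  intro t ht
  have hp : (fun i : Fin 2 => if i = 1 then t else c) = pt c t := by
    ext i; fin_cases i <;> simp [pt]
  obtain ⟨h1, h2⟩ := h _ ht
  simp only [hp] at h1 h2
  exact ⟨hS t ht, h1, fun U V a => ⟨h2 U V a ∅, h2 U V a {0}⟩⟩

theorem IsEdge.restrictsTo_left {S : Set (Fin 2 → ℝ)} {H : SuperMap S L M} {c : ℝ}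
    (h : H.IsEdge 0 c C) (hS : ∀ t : ℝ, (fun _ => t) ∈ S₁ → pt t c ∈ S) :
    H.RestrictsTo (fun t => pt t c) 0 C := by
  intro t ht
  have hp : (fun i : Fin 2 => if i = 0 then t else c) = pt t c := by
    ext i; fin_cases i <;> simp [pt]
  obtain ⟨h1, h2⟩ := h _ ht
  simp only [hp] at h1 h2
  exact ⟨hS t ht, h1, fun U V a => ⟨h2 U V a ∅, h2 U V a {0}⟩⟩

theorem RestrictsTo.at_eq (h : H.RestrictsTo γ j C) {t : ℝ} (ht : (fun _ => t) ∈ S₁) (V : Opens L.B)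
    {U : Opens M.B} {m n : ℕ} (A : Matrix (Fin m) (Fin n) (M.O U)) :
    C.at V t A = H.pullM (γ t) V ∅ A := by
  ext α β
  exact ((h t ht).2.2 U V (A α β)).1

theorem RestrictsTo.dtheta_eq (h : H.RestrictsTo γ j C) {t : ℝ} (ht : (fun _ => t) ∈ S₁)
    (V : Opens L.B) {U : Opens M.B} {m n : ℕ} (A : Matrix (Fin m) (Fin n) (M.O U)) :
    C.dtheta V t A = H.pullM (γ t) V {j} A := by
  ext α β
  exact ((h t ht).2.2 U V (A α β)).2

theorem mem_of_isWilsonLine_left (h : IsWilsonLine C V a b e e' W) : a ≤ b ∧ (fun _ => a) ∈ S₁ := by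
  induction h with
  | piece a b e W hab h _ => exact ⟨hab, (h a ⟨le_rfl, hab⟩).1⟩
  | splice a b c e₀ e₁ e₂ e₃ W₁ W₂ _ _ h₁ h₂ => exact ⟨h₁.1.trans h₂.1, h₁.2⟩

/-- Moves the Wilson lines of the boundary curves into the homotopy `H`, where the statements about
rectangles are proved. With `restrictsTo_self` it also covers a single curve. -/
theorem RestrictsTo.isLineWL (h : H.RestrictsTo γ j C) (hW : IsWilsonLine C V a b e e' W) :
    IsLineWL H γ j V a b e e' W := by
  induction hW with
  | piece a b e W hab hC hW =>
    refine .piece a b e W hab ?_ (IsPOE.congr hW fun t ht => h.dtheta_eq (hC t ht).1 V _)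
    rintro _ ⟨t, ht, rfl⟩
    exact ⟨(h t (hC t ht).1).1, fun y hy => (h t (hC t ht).1).2.1 y ▸ (hC t ht).2 y hy⟩
  | splice a b c e₀ e₁ e₂ e₃ W₁ W₂ _ hW₂ h₁ h₂ =>
    rw [h.at_eq (mem_of_isWilsonLine_left hW₂).2]
    exact .splice a b c e₀ e₁ e₂ e₃ W₁ W₂ h₁ h₂

theorem IsLineWL.isWilsonLine (h : IsLineWL C (fun t _ => t) 0 V a b e e' W) :
    IsWilsonLine C V a b e e' W := by
  induction h with
  | piece a b e W hab hC hW => exact .piece a b e W hab (fun t ht => hC _ ⟨t, ht, rfl⟩) hW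
  | splice a b c e₀ e₁ e₂ e₃ W₁ W₂ _ _ h₁ h₂ => exact .splice a b c e₀ e₁ e₂ e₃ W₁ W₂ h₁ h₂

theorem existsUnique_isPathOrderedExp (hS : IsFat S₁) (hab : a ≤ b) (h : C.LiesIn V a b e.U) :
    ∃! W, IsPathOrderedExp C V e a b W := by
  have h' : C.MapsInto ((fun t _ => t) '' Set.Icc a b) V e.U := by
    rintro _ ⟨t, ht, rfl⟩
    exact h t ht
  obtain ⟨W, hW, -⟩ := h'.exists_transport (j := 0) hS isLine_diag.continuous hab
  exact ⟨W, hW, fun W' hW' => IsPOE.unique hab hW' hW⟩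

theorem exists_isWilsonLine (hS : IsFat S₁) (h01 : ∀ t ∈ Set.Icc (0 : ℝ) 1, (fun _ => t) ∈ S₁)
    {y : L.B} (hy : y ∈ V) (e₀ e₁ : E.Triv) (h₀ : C.f (fun _ => 0) y ∈ e₀.U)
    (h₁ : C.f (fun _ => 1) y ∈ e₁.U) : ∃ V' ≤ V, y ∈ V' ∧ ∃ W, IsWilsonLine C V' 0 1 e₀ e₁ W := by
  have hend : ∀ t ∈ Set.Icc (0 : ℝ) 1, ∀ e : E.Triv, C.f (fun _ => t) y ∈ e.U →
      ∃ V' : Opens L.B, y ∈ V' ∧ C.MapsInto {fun _ => t} V' e.U := fun t ht e he =>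
    C.exists_mapsInto isCompact_singleton (Set.singleton_subset_iff.2 (h01 t ht)) (by
      rintro _ rfl
      exact he)
  obtain ⟨V₀, hy₀, hV₀⟩ := hend 0 ⟨le_rfl, zero_le_one⟩ e₀ h₀
  obtain ⟨V₁, hy₁, hV₁⟩ := hend 1 ⟨zero_le_one, le_rfl⟩ e₁ h₁
  obtain ⟨V', hV', hy', hc⟩ := exists_connects (H := C) (V := V₀ ⊓ V₁ ⊓ V) E hS isLine_diag h01
    (x := y) ⟨⟨hy₀, hy₁⟩, hy⟩
  obtain ⟨W, hW⟩ := hc e₀ e₁ (hV₀.res (hV'.trans (inf_le_left.trans inf_le_left)))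
    (hV₁.res (hV'.trans (inf_le_left.trans inf_le_right)))
  exact ⟨V', hV'.trans inf_le_right, hy', W, hW.isWilsonLine⟩

end SuperMap

end

open NQManifold GradedSpace QBundle SuperMap

section

variable {𝕜 : Type k} [RCLike 𝕜] {L : NQManifold.{v} 𝕜} {M : NQManifold.{u} 𝕜} {V : Opens L.B}
variable {E : QBundle.{u, w} M}

theorem NQManifold.Htpy.isQExact {e₀ e₁ : E.Triv} {D₀ D₁} {X Y : Matrix (Fin e₁.r) (Fin e₀.r) (L.O V)}
    (h : Htpy (⟨e₀.lev, D₀⟩ : Frame L V _) ⟨e₁.lev, D₁⟩ X Y) (hQ : ∀ U, L.Q U = 0) :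
    IsQExact e₀ e₁ D₁ D₀ (X - Y) := by
  obtain ⟨N, hN, h⟩ := h
  exact ⟨N, hN, h.eq hQ⟩

theorem NQManifold.res_dotProduct_mulVec {V' : Opens L.B} (h : V' ≤ V) {m n : Type*} [Fintype m]
    [Fintype n] (z : m → L.O V) (A : Matrix m n (L.O V)) (z' : n → L.O V) :
    L.res h (z ⬝ᵥ Matrix.mulVec A z') =
      (fun i => L.res h (z i)) ⬝ᵥ Matrix.mulVec (A.map (L.res h)) fun i => L.res h (z' i) := by
  simp only [dotProduct, Matrix.mulVec, map_sum, map_mul, Matrix.map_apply]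

variable {S₁ : Set (Fin 1 → ℝ)} {C : SuperMap S₁ L M} {e₀ e₁ e₀' e₁' : E.Triv} {a b : ℝ}
  {W : Matrix (Fin e₁.r) (Fin e₀.r) (L.O V)} {W' : Matrix (Fin e₁'.r) (Fin e₀'.r) (L.O V)}

theorem wilsonLine_isQExact (hS : IsFat S₁) (hQ : ∀ U, L.Q U = 0)
    (h : IsWilsonLine C V a b e₀ e₁ W) (h' : IsWilsonLine C V a b e₀' e₁' W') :
    IsQExact e₀' e₁ (C.at V b (qmat e₁)) (C.at V a (qmat e₀'))
      (C.at V b (transMat e₁ e₁') * W' - W * C.at V a (transMat e₀ e₀')) :=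
  (IsLineWL.htpy ((restrictsTo_self C).isLineWL h) ((restrictsTo_self C).isLineWL h') hS
    isLine_diag).isQExact hQ

theorem wilsonLine_covariant (hS : IsFat S₁) (hQ : ∀ U, L.Q U = 0)
    (h : IsWilsonLine C V a b e₀ e₁ W) (h' : IsWilsonLine C V a b e₀' e₁' W') (z : Fin e₁.r → L.O V)
    (z' : Fin e₀.r → L.O V) (hz : Matrix.vecMul z (C.at V b (qmat e₁)) = 0)
    (hz' : Matrix.mulVec (C.at V a (qmat e₀)) z' = 0) :
    z ⬝ᵥ Matrix.mulVec W z' = Matrix.vecMul z (C.at V b (transMat e₁ e₁')) ⬝ᵥ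
      Matrix.mulVec W' (Matrix.mulVec (C.at V a (transMat e₀' e₀)) z') := by
  have g := (restrictsTo_self C).isLineWL h
  have g' := (restrictsTo_self C).isLineWL h'
  -- Composing with the opposite transition matrix at the initial end isolates `W`, by the cocycle
  -- rule.
  have h1 := (g.htpy g' hS isLine_diag).mul_right
    (g'.mapsInto_left.isMor_trans g.mapsInto_left rfl)
  rw [Matrix.mul_assoc W, g.mapsInto_left.trans_mul_trans g'.mapsInto_left g.mapsInto_left rfl,
    g.mapsInto_left.trans_self rfl, Matrix.mul_one] at h1
  rw [← h1.dotProduct_eq hQ hz hz', ← Matrix.dotProduct_mulVec, Matrix.mulVec_mulVec,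
    Matrix.mulVec_mulVec]
  simp only [Matrix.mul_assoc]
  rfl

theorem Commutes.restrict_htpy {S : Set (Fin 2 → ℝ)} {H : SuperMap S L M} {V' : Opens L.B}
    (hV : V' ≤ V) (hc : H.Commutes E V' 0 1 0 1) {C₀ C₁ B₀ B₁ : SuperMap S₁ L M}
    (hC₀ : H.RestrictsTo (fun t => pt 0 t) 1 C₀) (hC₁ : H.RestrictsTo (fun t => pt 1 t) 1 C₁)
    (hB₀ : H.RestrictsTo (fun s => pt s 0) 0 B₀) (hB₁ : H.RestrictsTo (fun s => pt s 1) 0 B₁)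
    {W₀ : Matrix (Fin e₁.r) (Fin e₀.r) (L.O V)} {W₁ : Matrix (Fin e₁'.r) (Fin e₀'.r) (L.O V)}
    {P₀ : Matrix (Fin e₀'.r) (Fin e₀.r) (L.O V)} {P₁ : Matrix (Fin e₁'.r) (Fin e₁.r) (L.O V)}
    (hW₀ : IsWilsonLine C₀ V 0 1 e₀ e₁ W₀) (hW₁ : IsWilsonLine C₁ V 0 1 e₀' e₁' W₁)
    (hP₀ : IsWilsonLine B₀ V 0 1 e₀ e₀' P₀) (hP₁ : IsWilsonLine B₁ V 0 1 e₁ e₁' P₁) :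
    Htpy (H.frame (pt 0 0) V' e₀) (H.frame (pt 1 1) V' e₁') ((W₁ * P₀).map (L.res hV))
      ((P₁ * W₀).map (L.res hV)) := by
  rw [Matrix.map_mul, Matrix.map_mul]
  exact hc _ _ _ _ _ _ _ _ ((hC₀.isLineWL hW₀).res hV) ((hC₁.isLineWL hW₁).res hV)
    ((hB₀.isLineWL hP₀).res hV) ((hB₁.isLineWL hP₁).res hV)

theorem wilsonLine_homotopy (hQ : ∀ U, L.Q U = 0) {H : SuperCurveHomotopy L M}
    {C₀ C₁ B₀ B₁ : SuperCurve L M} (hC₀ : H.IsEdge 1 0 C₀) (hC₁ : H.IsEdge 1 1 C₁)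
    (hB₀ : H.IsEdge 0 0 B₀) (hB₁ : H.IsEdge 0 1 B₁)
    {W₀ : Matrix (Fin e₁.r) (Fin e₀.r) (L.O V)} {W₁ : Matrix (Fin e₁'.r) (Fin e₀'.r) (L.O V)}
    {P₀ : Matrix (Fin e₀'.r) (Fin e₀.r) (L.O V)} {P₁ : Matrix (Fin e₁'.r) (Fin e₁.r) (L.O V)}
    (hW₀ : IsWilsonLine C₀ V 0 1 e₀ e₁ W₀) (hW₁ : IsWilsonLine C₁ V 0 1 e₀' e₁' W₁)
    (hP₀ : IsWilsonLine B₀ V 0 1 e₀ e₀' P₀) (hP₁ : IsWilsonLine B₁ V 0 1 e₁ e₁' P₁) :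
    (∀ y ∈ V, ∃ (V' : Opens L.B) (h : V' ≤ V), y ∈ V' ∧
      IsQExact e₀ e₁' (C₁.at V' 1 (qmat e₁')) (C₀.at V' 0 (qmat e₀))
        ((W₁ * P₀ - P₁ * W₀).map (L.res h))) ∧
    ∀ (z : Fin e₁'.r → L.O V) (z' : Fin e₀.r → L.O V),
      Matrix.vecMul z (C₁.at V 1 (qmat e₁')) = 0 → Matrix.mulVec (C₀.at V 0 (qmat e₀)) z' = 0 →
      z ⬝ᵥ Matrix.mulVec W₁ (Matrix.mulVec P₀ z') = Matrix.vecMul z P₁ ⬝ᵥ Matrix.mulVec W₀ z' := by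
  have hI : ∀ t : ℝ, (fun _ => t) ∈ Set.Icc (0 : Fin 1 → ℝ) 1 → t ∈ Set.Icc (0 : ℝ) 1 :=
    fun t ht => ⟨ht.1 0, ht.2 0⟩
  have h0 : (0 : ℝ) ∈ Set.Icc (0 : ℝ) 1 := ⟨le_rfl, zero_le_one⟩
  have h1 : (1 : ℝ) ∈ Set.Icc (0 : ℝ) 1 := ⟨zero_le_one, le_rfl⟩
  have rC₀ := hC₀.restrictsTo_right fun t ht => rect_subset_Icc (pt_mem_rect h0 (hI t ht))
  have rC₁ := hC₁.restrictsTo_right fun t ht => rect_subset_Icc (pt_mem_rect h1 (hI t ht))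
  have rB₀ := hB₀.restrictsTo_left fun t ht => rect_subset_Icc (pt_mem_rect (hI t ht) h0)
  have rB₁ := hB₁.restrictsTo_left fun t ht => rect_subset_Icc (pt_mem_rect (hI t ht) h1)
  have m0 : (fun _ => (0 : ℝ)) ∈ Set.Icc (0 : Fin 1 → ℝ) 1 := ⟨fun _ => le_rfl, fun _ => zero_le_one⟩
  have m1 : (fun _ => (1 : ℝ)) ∈ Set.Icc (0 : Fin 1 → ℝ) 1 := ⟨fun _ => zero_le_one, fun _ => le_rfl⟩
  have key : ∀ y ∈ V, ∃ (V' : Opens L.B) (h : V' ≤ V), y ∈ V' ∧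
      Htpy (H.frame (pt 0 0) V' e₀) (H.frame (pt 1 1) V' e₁') ((W₁ * P₀).map (L.res h))
        ((P₁ * W₀).map (L.res h)) := by
    intro y hy
    obtain ⟨V', hV, hyV, hc⟩ := exists_commutes (H := H) E isFat_Icc rect_subset_Icc hy
    exact ⟨V', hV, hyV, Commutes.restrict_htpy hV hc rC₀ rC₁ rB₀ rB₁ hW₀ hW₁ hP₀ hP₁⟩
  refine ⟨fun y hy => ?_, fun z z' hz hz' => ?_⟩
  · obtain ⟨V', hV, hyV, h⟩ := key y hy
    refine ⟨V', hV, hyV, ?_⟩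
    rw [Matrix.map_sub _ (map_sub _), rC₀.at_eq m0, rC₁.at_eq m1]
    exact h.isQExact hQ
  · rw [Matrix.mulVec_mulVec, ← Matrix.dotProduct_mulVec, Matrix.mulVec_mulVec]
    -- The homotopy exists only locally, since the subdivision of the square depends on the point;
    -- the equality of the contracted functions can nevertheless be checked locally.
    refine ext_local fun y hy => ?_
    obtain ⟨V', hV, hyV, h⟩ := key y hy
    refine ⟨V', hV, hyV, ?_⟩
    rw [res_dotProduct_mulVec, res_dotProduct_mulVec]
    refine h.dotProduct_eq hQ ?_ ?_
    · rw [rC₁.at_eq m1] at hz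
      have := congrArg (fun f i => L.res hV (f i)) hz
      simp only [Matrix.vecMul, dotProduct, map_sum, map_mul, Pi.zero_apply, map_zero] at this
      rw [frame, D₀, ← (rC₁.isLineWL hW₁).mapsInto_right.pullM_res_right rfl hV]
      exact this
    · rw [rC₀.at_eq m0] at hz'
      have := congrArg (fun f i => L.res hV (f i)) hz'
      simp only [Matrix.mulVec, dotProduct, map_sum, map_mul, Pi.zero_apply, map_zero] at this
      rw [frame, D₀, ← (rC₀.isLineWL hW₀).mapsInto_left.pullM_res_right rfl hV]
      exact this

end

/-! ### Supertraces -/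

open NQManifold GradedSpace QBundle SuperMap

section

variable {𝕜 : Type k} [RCLike 𝕜]

/-- The transpose `q` of the fundamental solution for `-Aᵀ` satisfies `q' = q A`, so `q u` is
constant. -/
theorem exists_left_inverse_of_ode {ι : Type*} [Fintype ι] [DecidableEq ι] {a b : ℝ} (hab : a ≤ b)
    {A u : ℝ → Matrix ι ι 𝕜} (hA : ∀ p q, ContinuousOn (fun t => A t p q) (Set.Icc a b))
    (hu0 : u a = 1) (hu : ∀ t ∈ Set.Icc a b, MDeriv u (-(A t * u t)) (Set.Icc a b) t) :
    ∃ q, q * u b = 1 := by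
  obtain ⟨v, hv0, hv, -⟩ := exists_fundamental_solution hab (A := fun t => -(A t).transpose)
    fun p q => (hA q p).neg
  have hvt : ∀ t ∈ Set.Icc a b, MDeriv (fun t => (v t).transpose) ((v t).transpose * A t)
      (Set.Icc a b) t := by
    intro t ht p q
    have h1 : -(-(A t).transpose * v t) = ((v t).transpose * A t).transpose := by
      rw [Matrix.neg_mul, neg_neg, Matrix.transpose_mul, Matrix.transpose_transpose]
    exact (hv t ht q p).congr_deriv (congrFun (congrFun h1 q) p)
  have h := eq_zero_of_MDeriv (A := fun _ => (0 : Matrix ι ι 𝕜)) (fun p q => continuousOn_const)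
    (y := fun t => (v t).transpose * u t - 1)
    (by simp only [hv0, hu0, Matrix.transpose_one, Matrix.one_mul, sub_self])
    (fun t ht => (((hvt t ht).mul (hu t ht)).sub (.const 1)).congr_deriv
      (by simp only [Matrix.mul_neg, Matrix.mul_assoc, Matrix.zero_mul, neg_zero, add_neg_cancel, sub_zero]))
    b ⟨hab, le_rfl⟩
  exact ⟨_, sub_eq_zero.1 h⟩

variable {L : NQManifold.{v} 𝕜} {V : Opens L.B} {x : L.B} {m n o : Type*}

/-- The value at a point. -/
def NQManifold.valAt (hx : x ∈ V) : L.O V →+* 𝕜 :=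
  (Pi.evalRingHom (fun _ : V => 𝕜) ⟨x, hx⟩).comp (L.val V : L.O V →+* (V → 𝕜))

theorem NQManifold.valAt_apply (hx : x ∈ V) (a : L.O V) : valAt hx a = L.val V a ⟨x, hx⟩ := rfl

theorem NQManifold.valAt_res {V' : Opens L.B} (h : V' ≤ V) (hx : x ∈ V') (a : L.O V) :
    valAt hx (L.res h a) = valAt (h hx) a := L.val_res h a ⟨x, hx⟩

theorem NQManifold.valAt_eq_zero (hx : x ∈ V) {i : ℤ} {a : L.O V} (ha : a ∈ L.degZ V i)
    (hi : i ≠ 0) : valAt hx a = 0 := by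
  rcases mem_degZ_cases ha with rfl | ⟨n, rfl, ha⟩
  · exact map_zero _
  · rw [valAt_apply, L.val_pos V n a (Nat.pos_of_ne_zero fun h => hi (by exact_mod_cast h)) ha]
    rfl

theorem NQManifold.Agree.map_valAt {X Y : Matrix m n (L.O V)} (h : Agree X Y) (hx : x ∈ V) :
    X.map (valAt hx) = Y.map (valAt hx) := by
  ext α β
  exact h.val hx α β

/-- The graded supertrace. -/
def str [Fintype m] {A : Type*} [Ring A] (lev : m → ℤ) (X : Matrix m m A) : A :=
  ∑ α, (lev α).negOnePow • X α α

theorem map_str [Fintype m] {A B : Type*} [Ring A] [Ring B] (f : A →+* B) (lev : m → ℤ)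
    (X : Matrix m m A) : f (str lev X) = str lev (X.map f) := by
  simp only [str, map_sum, Units.smul_def, map_zsmul, Matrix.map_apply]

variable [Fintype m] [DecidableEq m] [Fintype n] [DecidableEq n]

theorem trace_sgn_mul (lev : m → ℤ) (X : Matrix m m 𝕜) :
    Matrix.trace (sgn lev 𝕜 * X) = str lev X := by
  simp only [Matrix.trace, Matrix.diag_apply, sgn, Matrix.diagonal_mul, str, Units.smul_def,
    zsmul_eq_mul]

/-- Values at points vanish in nonzero degree, so a degree-preserving matrix reduces to blocks
between equal levels; in the odd case below it shifts levels by one and anticommutes with the sign.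
-/
theorem sgn_mul_map_valAt (hx : x ∈ V) {l : m → ℤ} {l' : n → ℤ} {A : Matrix m n (L.O V)}
    (hA : ∀ α β, A α β ∈ L.degZ V (l' β - l α)) :
    sgn l 𝕜 * A.map (valAt hx) = A.map (valAt hx) * sgn l' 𝕜 := by
  ext α β
  rw [sgn, sgn, Matrix.diagonal_mul, Matrix.mul_diagonal, Matrix.map_apply]
  by_cases h : l' β = l α
  · rw [h, mul_comm]
  · rw [valAt_eq_zero hx (hA α β) (sub_ne_zero.2 h), mul_zero, zero_mul]

theorem sgn_mul_map_valAt_odd (hx : x ∈ V) {l : m → ℤ} {A : Matrix m m (L.O V)}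
    (hA : ∀ α β, A α β ∈ L.degZ V (l β - l α + 1)) :
    sgn l 𝕜 * A.map (valAt hx) = -(A.map (valAt hx) * sgn l 𝕜) := by
  ext α β
  rw [Matrix.neg_apply, sgn, Matrix.diagonal_mul, Matrix.mul_diagonal, Matrix.map_apply]
  by_cases h : l α = l β + 1
  · rw [h, Int.negOnePow_succ, mul_comm]
    push_cast
    ring
  · rw [valAt_eq_zero hx (hA α β) (fun h' => h (by linarith)), mul_zero, zero_mul, neg_zero]

/-- Matrices which are homotopic up to an invertible morphism have the same supertrace. -/
theorem NQManifold.Htpy.str_eq {F : Frame L V m} {G : Frame L V n} {P : Matrix n m (L.O V)}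
    {X : Matrix m m (L.O V)} {Y : Matrix n n (L.O V)} (h : Htpy F G (Y * P) (P * X))
    (hP : IsMor F G P) (hD : ∀ α β, G.D α β ∈ L.degZ V (G.lev β - G.lev α + 1)) (hx : x ∈ V)
    {q : Matrix m n 𝕜} (hq : q * P.map (valAt hx) = 1) (hq' : P.map (valAt hx) * q = 1) :
    str G.lev (Y.map (valAt hx)) = str F.lev (X.map (valAt hx)) := by
  obtain ⟨N, -, hN⟩ := h
  have h1 := hN.map_valAt hx
  have h2 := hP.2.map_valAt hx
  have h3 := sgn_mul_map_valAt hx hP.1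
  have h4 := sgn_mul_map_valAt_odd hx hD
  simp only [Matrix.map_sub _ (map_sub _), Matrix.map_add _ (map_add _), Matrix.map_mul] at h1 h2
  generalize P.map (valAt hx) = p at *
  generalize X.map (valAt hx) = X at *
  generalize Y.map (valAt hx) = Y at *
  generalize N.map (valAt hx) = N at *
  generalize F.D.map (valAt hx) = d at *
  generalize G.D.map (valAt hx) = d' at *
  -- `q` is only an inverse of the values of `P`; it is a chain map because `P` is.
  have hdq : d * q = q * d' := by
    calc d * q = q * (p * d) * q := by rw [← Matrix.mul_assoc q, hq, Matrix.one_mul]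
      _ = q * d' := by rw [← h2, Matrix.mul_assoc, Matrix.mul_assoc, hq', Matrix.mul_one]
  have hY : Y = p * X * q + (d' * (N * q) + N * q * d') := by
    have h5 := congrArg (· * q) (sub_eq_iff_eq_add.1 h1)
    simp only [Matrix.mul_assoc, hq', Matrix.mul_one, Matrix.add_mul, hdq] at h5
    rw [h5, add_comm]
    simp only [Matrix.mul_assoc]
  -- The sign matrix passes through `p`, so cyclicity removes the conjugation. It anticommutes with
  -- `d'`, so by cyclicity the traces of `sgn * (d' * (N * q))` and `sgn * (N * q * d')` cancel.
  rw [← trace_sgn_mul, ← trace_sgn_mul, hY, Matrix.mul_add, Matrix.mul_add, Matrix.trace_add,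
    Matrix.trace_add, ← Matrix.mul_assoc, ← Matrix.mul_assoc, h3, Matrix.trace_mul_comm _ q,
    Matrix.mul_assoc p, ← Matrix.mul_assoc q, hq, Matrix.one_mul, ← Matrix.mul_assoc (sgn _ _) d', h4,
    Matrix.neg_mul, Matrix.trace_neg, Matrix.mul_assoc d', Matrix.trace_mul_comm d',
    Matrix.mul_assoc (sgn _ _), neg_add_cancel, add_zero]

end

theorem mul_mul_mul_eq_one {A l m n : Type*} [Ring A] [Fintype m] [DecidableEq m] [Fintype n]
    [DecidableEq l] {q : Matrix l m A} {q' : Matrix m n A} {p' : Matrix n m A} {p : Matrix m l A}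
    (h' : q' * p' = 1) (h : q * p = 1) : q * q' * (p' * p) = 1 := by
  rw [Matrix.mul_assoc, ← Matrix.mul_assoc q', h', Matrix.one_mul, h]

/-! ### Invertibility of the Wilson lines at the points -/

namespace SuperMap

variable {𝕜 : Type k} [RCLike 𝕜] {L : NQManifold.{v} 𝕜} {M : NQManifold.{u} 𝕜} {d : ℕ}
variable {S : Set (Fin d → ℝ)} {H : SuperMap S L M} {E : QBundle.{u, w} M}
variable {γ : ℝ → Fin d → ℝ} {j : Fin d} {V : Opens L.B} {a b : ℝ} {e e' : E.Triv} {x : L.B}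

theorem MapsInto.map_trans_mul_trans {p : Fin d → ℝ} (h : H.MapsInto {p} V e.U)
    (h' : H.MapsInto {p} V e'.U) (hx : x ∈ V) :
    (H.trans p V e e').map (valAt hx) * (H.trans p V e' e).map (valAt hx) = 1 := by
  rw [← Matrix.map_mul, h.trans_mul_trans h' h rfl, h.trans_self rfl,
    Matrix.map_one _ (map_zero _) (map_one _)]

theorem IsTransport.exists_left_inverse {W : Matrix (Fin e.r) (Fin e.r) (L.O V)}
    (hW : H.IsTransport γ j V e a b W) (hS : IsFat S) (hγ : IsLine γ j) (hab : a ≤ b)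
    (h : H.MapsInto (γ '' Set.Icc a b) V e.U) (hx : x ∈ V) :
    ∃ q : Matrix (Fin e.r) (Fin e.r) 𝕜, q * W.map (valAt hx) = 1 := by
  obtain ⟨κ, hκ⟩ := L.locally_free x
  obtain ⟨u, hu0, hub, hu⟩ := hW.exists_solution (R := 0) hS hγ.continuous hab h hx hκ
  obtain ⟨q, hq⟩ := exists_left_inverse_of_ode hab
    (h.continuousOn_rep_line hS hγ.continuous {j} _ hx hκ) hu0 hu
  -- In truncation 0 the constant monomial is the only one, and the representation is the matrix of
  -- values.
  have hI : ∀ K : κ.Idx 0, K = κ.zeroIdx 0 := fun K =>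
    Subtype.ext (κ.eq_zero_of_total (Nat.le_zero.1 K.2))
  let _ : Unique (κ.Idx 0) := ⟨⟨κ.zeroIdx 0⟩, hI⟩
  refine ⟨Matrix.of fun α β => q (α, κ.zeroIdx 0) (β, κ.zeroIdx 0), ?_⟩
  ext α β
  have h1 := congrFun (congrFun hq (α, κ.zeroIdx 0)) (β, κ.zeroIdx 0)
  rw [hub, Matrix.mul_apply, Fintype.sum_prod_type] at h1
  simp only [Fintype.sum_unique, Coords.rep_apply_zero hx hκ] at h1
  rw [Matrix.mul_apply]
  refine (Finset.sum_congr rfl fun γ _ => ?_).trans (h1.trans ?_)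
  · rw [Matrix.of_apply, Matrix.map_apply, valAt_apply, κ.val_eq_coeff _ hx hκ]
    rfl
  · simp only [Matrix.one_apply, Prod.mk.injEq, and_true]

theorem IsLineWL.exists_inverse {W : Matrix (Fin e'.r) (Fin e.r) (L.O V)}
    (h : IsLineWL H γ j V a b e e' W) (hS : IsFat S) (hγ : IsLine γ j) (hx : x ∈ V) :
    ∃ q : Matrix (Fin e.r) (Fin e'.r) 𝕜, q * W.map (valAt hx) = 1 ∧ W.map (valAt hx) * q = 1 := by
  induction h with
  | piece a b e W hab h hW =>
    obtain ⟨q, hq⟩ := hW.exists_left_inverse hS hγ hab h hx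
    exact ⟨q, hq, mul_eq_one_comm.1 hq⟩
  | splice a b c e₀ e₁ e₂ e₃ W₁ W₂ h₁ h₂ ih₁ ih₂ =>
    obtain ⟨q₁, hq₁, hq₁'⟩ := ih₁
    obtain ⟨q₂, hq₂, hq₂'⟩ := ih₂
    have t := h₂.mapsInto_left.map_trans_mul_trans h₁.mapsInto_right hx
    have t' := h₁.mapsInto_right.map_trans_mul_trans h₂.mapsInto_left hx
    simp only [Matrix.map_mul]
    exact ⟨q₁ * ((H.trans (γ b) V e₁ e₂).map (valAt hx) * q₂),
      mul_mul_mul_eq_one (mul_mul_mul_eq_one hq₂ t') hq₁,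
      mul_mul_mul_eq_one hq₁' (mul_mul_mul_eq_one t hq₂')⟩

/-- For a periodic homotopy this identifies the Wilson lines along the two edges that are glued in
the cylinder. -/
theorem IsLineWL.congr_line {γ' : ℝ → Fin d → ℝ} {W : Matrix (Fin e'.r) (Fin e.r) (L.O V)}
    (h : IsLineWL H γ j V a b e e' W) (hS : ∀ τ, γ τ ∈ S → γ' τ ∈ S)
    (hf : ∀ τ, H.f (γ τ) = H.f (γ' τ)) (hp : ∀ τ, H.pull (γ τ) = H.pull (γ' τ)) :
    IsLineWL H γ' j V a b e e' W := by
  induction h with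
  | piece a b e W hab h hW =>
    refine .piece a b e W hab ?_ (IsPOE.congr hW fun t ht => by simp only [conn, pullM, hp])
    rintro _ ⟨t, ht, rfl⟩
    exact ⟨hS t (h _ ⟨t, ht, rfl⟩).1, hf t ▸ (h _ ⟨t, ht, rfl⟩).2⟩
  | splice a b c e₀ e₁ e₂ e₃ W₁ W₂ h₁ h₂ ih₁ ih₂ =>
    have ht : H.trans (γ b) V e₂ e₁ = H.trans (γ' b) V e₂ e₁ := by simp only [trans, pullM, hp]
    rw [ht]
    exact .splice a b c e₀ e₁ e₂ e₃ W₁ W₂ ih₁ ih₂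

end SuperMap

/-! ### Wilson loops -/

open NQManifold GradedSpace QBundle SuperMap

variable {𝕜 : Type k} [RCLike 𝕜]

namespace SuperMap

variable {L : NQManifold.{v} 𝕜} {M : NQManifold.{u} 𝕜} {E : QBundle.{u, w} M} {d : ℕ}

theorem MapsInto.D₀_mem {S : Set (Fin d → ℝ)} {H : SuperMap S L M} {V : Opens L.B}
    {p : Fin d → ℝ} {e : E.Triv} (h : H.MapsInto {p} V e.U) (α β : Fin e.r) :
    H.D₀ p V e α β ∈ L.degZ V (e.lev β - e.lev α + 1) := by
  have := h.pull_mem (p := p) rfl (qmat_mem' e α β) ∅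
  rwa [Finset.card_empty, Nat.cast_zero, sub_zero] at this

/-- Wilson lines of homotopic closed lines have the same supertrace. -/
theorem IsLineWL.str_eq {S : Set (Fin d → ℝ)} {H : SuperMap S L M} {γ : ℝ → Fin d → ℝ} {j : Fin d}
    {V V' : Opens L.B} {e e' : E.Triv} {W : Matrix (Fin e.r) (Fin e.r) (L.O V)}
    {W' : Matrix (Fin e'.r) (Fin e'.r) (L.O V')} {a b : ℝ} (h : IsLineWL H γ j V a b e e W)
    (h' : IsLineWL H γ j V' a b e' e' W') (hS : IsFat S) (hγ : IsLine γ j)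
    (hp : H.pull (γ b) = H.pull (γ a)) {x : L.B} (hx : x ∈ V) (hx' : x ∈ V') :
    str e.lev (W.map (valAt hx)) = str e'.lev (W'.map (valAt hx')) := by
  have g := h.res (inf_le_left : V ⊓ V' ≤ V)
  have g' := h'.res (inf_le_right : V ⊓ V' ≤ V')
  have hxx : x ∈ V ⊓ V' := ⟨hx, hx'⟩
  have ht := (g.htpy g' hS hγ).symm
  -- Closedness identifies the frames and transition matrices at the two ends, so `htpy` becomes
  -- conjugation by one invertible chain map, up to homotopy.
  have hf : H.frame (γ b) (V ⊓ V') e = H.frame (γ a) (V ⊓ V') e := by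
    simp only [frame, D₀, pullM, hp]
  have hT : H.trans (γ b) (V ⊓ V') e e' = H.trans (γ a) (V ⊓ V') e e' := by
    simp only [trans, pullM, hp]
  rw [hf, hT] at ht
  have := ht.str_eq (g.mapsInto_left.isMor_trans g'.mapsInto_left rfl)
    (fun α β => g.mapsInto_left.D₀_mem α β) hxx
    (g'.mapsInto_left.map_trans_mul_trans g.mapsInto_left hxx)
    (g.mapsInto_left.map_trans_mul_trans g'.mapsInto_left hxx)
  simp only [Matrix.map_map, Function.comp_def, valAt_res] at this
  exact this

end SuperMap

/-! ### Values of Wilson lines under a change of test manifold -/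

section Pullback

variable {L L' : NQManifold.{v} 𝕜} {M : NQManifold.{u} 𝕜} {E : QBundle.{u, w} M}
variable {S₁ : Set (Fin 1 → ℝ)} {C : SuperMap S₁ L M} {C' : SuperMap S₁ L' M} {g : NQHom L' L}
variable {V : Opens L.B} {V' : Opens L'.B}

theorem SuperMap.IsPullback.val_eq (h : C.IsPullback g C') (hg : ∀ y ∈ V', g.f 0 y ∈ V) {t : Fin 1 → ℝ}
    (ht : t ∈ S₁) {U : Opens M.B} (hC : ∀ y ∈ V, C.f t y ∈ U) (a : M.O U) (K : Finset (Fin 1))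
    {y : L'.B} (hy : y ∈ V') :
    valAt hy (C'.pull t U V' a K) = valAt (hg y hy) (C.pull t U V a K) := by
  rw [(h t ht).2 U V V' hg hC, valAt_apply]
  exact g.pull_val 0 trivial V V' hg _ ⟨y, hy⟩

/-- Evaluation at a point is multiplicative and is the coefficient of the constant monomial, so the
recursion closes on values. Compatibility of the full integrals with pull-back is not needed for a
function of degree 0. -/
theorem NQManifold.IsPOE.valAt_eq {m : Type*} [Fintype m] [DecidableEq m]
    {A : ℝ → Matrix m m (L.O V)} {A' : ℝ → Matrix m m (L'.O V')} {a b : ℝ} (hab : a ≤ b)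
    {W : Matrix m m (L.O V)} {W' : Matrix m m (L'.O V')} (h : IsPOE A a b W) (h' : IsPOE A' a b W')
    {x : L.B} {y : L'.B} (hx : x ∈ V) (hy : y ∈ V')
    (hA : ∀ t ∈ Set.Icc a b, (A' t).map (valAt hy) = (A t).map (valAt hx)) :
    W'.map (valAt hy) = W.map (valAt hx) := by
  obtain ⟨w, h0, h1, h2⟩ := h
  obtain ⟨w', h0', h1', h2'⟩ := h'
  obtain ⟨κ, hκ⟩ := L.locally_free x
  obtain ⟨κ', hκ'⟩ := L'.locally_free y
  have hv : ∀ c : L.O V, κ.coeff c (MonoIdx.zero κ.deg) x = valAt hx c := fun c =>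
    (κ.val_eq_coeff c hx hκ).symm
  have hv' : ∀ c : L'.O V', κ'.coeff c (MonoIdx.zero κ'.deg) y = valAt hy c := fun c =>
    (κ'.val_eq_coeff c hy hκ').symm
  have hw : ∀ q, ∀ t ∈ Set.Icc a b, (w' q t).map (valAt hy) = (w q t).map (valAt hx) := by
    intro q
    induction q with
    | zero =>
      intro t ht
      rw [h0 t ht, h0' t ht, Matrix.map_one _ (map_zero _) (map_one _),
        Matrix.map_one _ (map_zero _) (map_one _)]
    | succ q ih =>
      intro t ht
      ext α β
      rw [Matrix.map_apply, Matrix.map_apply, ← hv, ← hv', h1 q t ht, h1' q t ht]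
      congr 1
      refine intervalIntegral.integral_congr fun τ hτ => ?_
      rw [Set.uIcc_of_le ht.1] at hτ
      have hτ' : τ ∈ Set.Icc a b := ⟨hτ.1, hτ.2.trans ht.2⟩
      have h3 : (A' τ * w' q τ).map (valAt hy) = (A τ * w q τ).map (valAt hx) := by
        rw [Matrix.map_mul, Matrix.map_mul, hA τ hτ', ih τ hτ']
      exact (hv' _).trans ((congrFun (congrFun h3 α) β).trans (hv _).symm)
  ext α β
  have s := h2 α β κ (MonoIdx.zero κ.deg) x
  have s' := h2' α β κ' (MonoIdx.zero κ'.deg) y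
  simp only [hv] at s
  simp only [hv'] at s'
  refine s'.unique (s.congr_fun fun q => ?_)
  exact congrFun (congrFun (hw q b ⟨hab, le_rfl⟩) α) β

theorem IsWilsonLine.exists_pullback (hS : IsFat S₁) (h : C.IsPullback g C')
    (hg : ∀ y ∈ V', g.f 0 y ∈ V) {a b : ℝ} {e e' : E.Triv} {W : Matrix (Fin e'.r) (Fin e.r) (L.O V)}
    (hW : IsWilsonLine C V a b e e' W) : ∃ W' : Matrix (Fin e'.r) (Fin e.r) (L'.O V'),
      IsWilsonLine C' V' a b e e' W' ∧
      ∀ y (hy : y ∈ V'), W'.map (valAt hy) = W.map (valAt (hg y hy)) := by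
  induction hW with
  | piece a b e W hab hC hW =>
    have hC' : C'.LiesIn V' a b e.U := fun t ht => ⟨(hC t ht).1, fun y hy => by
      rw [(h _ (hC t ht).1).1 y]
      exact (hC t ht).2 _ (hg y hy)⟩
    obtain ⟨W', hW', -⟩ := existsUnique_isPathOrderedExp hS hab hC'
    refine ⟨W', .piece a b e W' hab hC' hW', fun y hy =>
      IsPOE.valAt_eq hab hW hW' (hg y hy) hy fun t ht => ?_⟩
    ext α β
    exact h.val_eq hg (hC t ht).1 (hC t ht).2 _ _ hy
  | splice a b c e₀ e₁ e₂ e₃ W₁ W₂ h₁ h₂ ih₁ ih₂ =>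
    obtain ⟨W₁', h₁', q₁⟩ := ih₁
    obtain ⟨W₂', h₂', q₂⟩ := ih₂
    refine ⟨_, .splice a b c e₀ e₁ e₂ e₃ W₁' W₂' h₁' h₂', fun y hy => ?_⟩
    have m₁ := ((restrictsTo_self C).isLineWL h₁).mapsInto_right
    have m₂ := ((restrictsTo_self C).isLineWL h₂).mapsInto_left
    have ht : (C'.at V' b (transMat e₂ e₁)).map (valAt hy) =
        (C.at V b (transMat e₂ e₁)).map (valAt (hg y hy)) := by
      ext α β
      exact h.val_eq hg (m₁ _ rfl).1 ((m₂.inf m₁) _ rfl).2 _ _ hy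
    simp only [Matrix.map_mul, q₁ y hy, q₂ y hy, ht]

end Pullback

/-! ### Existence, naturality and homotopy invariance of the Wilson loop -/

section Loops

variable {L : NQManifold.{v} 𝕜} {M : NQManifold.{u} 𝕜} {E : QBundle.{u, w} M} {C : SuperLoop L M}

theorem SuperLoop.pull_end (C : SuperLoop L M) : C.pull (fun _ => 1) = C.pull fun _ => 0 := by
  have := C.pull_periodic 0
  rwa [zero_add] at this

theorem SuperLoop.f_end (C : SuperLoop L M) : C.f (fun _ => 1) = C.f fun _ => 0 := by
  have := C.f_periodic 0
  rwa [zero_add] at this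

theorem SuperLoop.exists_isWilsonLine (C : SuperLoop L M) (E : QBundle.{u, w} M) {V : Opens L.B}
    {y : L.B} (hy : y ∈ V) : ∃ V' ≤ V, y ∈ V' ∧ ∃ (e : E.Triv) (W : Matrix (Fin e.r) (Fin e.r) (L.O V')),
      IsWilsonLine C.toSuperMap V' 0 1 e e W := by
  obtain ⟨e, he⟩ := E.locally_trivial (C.f (fun _ => 0) y)
  obtain ⟨V', hV, hyV, W, hW⟩ := SuperMap.exists_isWilsonLine (C := C.toSuperMap) isFat_univ
    (fun _ _ => trivial) hy e e he (by rw [C.f_end]; exact he)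
  exact ⟨V', hV, hyV, e, W, hW⟩

theorem str_mem_gr {V : Opens L.B} {m : Type*} [Fintype m] {lev : m → ℤ} {W : Matrix m m (L.O V)}
    (hW : ∀ α β, W α β ∈ L.degZ V (lev β - lev α)) : str lev W ∈ L.gr V 0 := by
  refine Submodule.sum_mem _ fun α _ => ?_
  have := hW α α
  rw [sub_self] at this
  exact zsmul_mem (mem_degZ_natCast (i := 0).1 this) _

theorem eq_of_valAt {V : Opens L.B} {a b : L.O V} (ha : a ∈ L.gr V 0) (hb : b ∈ L.gr V 0)
    (h : ∀ x (hx : x ∈ V), valAt hx a = valAt hx b) : a = b := by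
  refine sub_eq_zero.1 (L.val_inj V _ (sub_mem ha hb) ?_)
  ext x
  rw [map_sub, Pi.sub_apply]
  exact sub_eq_zero.2 (h x x.2)

theorem SuperLoop.str_mem_gr (C : SuperLoop L M) {V : Opens L.B} {e : E.Triv}
    {W : Matrix (Fin e.r) (Fin e.r) (L.O V)} (hW : IsWilsonLine C.toSuperMap V 0 1 e e W) :
    str e.lev W ∈ L.gr V 0 :=
  _root_.str_mem_gr (((restrictsTo_self _).isLineWL hW).isMor isFat_univ isLine_diag).1

theorem IsWilsonLoop.valAt_eq {z : L.O ⊤} (hz : IsWilsonLoop E C z) {V : Opens L.B} {e : E.Triv}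
    {W : Matrix (Fin e.r) (Fin e.r) (L.O V)} (hW : IsWilsonLine C.toSuperMap V 0 1 e e W) {x : L.B}
    (hx : x ∈ V) : valAt (V := ⊤) (x := x) trivial z = str e.lev (W.map (valAt hx)) := by
  rw [← map_str, ← valAt_res le_top hx]
  exact congrArg _ (hz.2 V e W hW)

/-- The local supertraces have degree 0 and, by `IsLineWL.str_eq`, equal values on overlaps; hence
they glue, and the same comparison gives independence of all choices. -/
theorem existsUnique_isWilsonLoop (E : QBundle.{u, w} M) (C : SuperLoop L M) :
    ∃! z, IsWilsonLoop E C z := by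
  choose N hN hyN e W hW using fun y : (⊤ : Opens L.B) => C.exists_isWilsonLine E y.2
  have hstr : ∀ {V V' : Opens L.B} {e e' : E.Triv} {W : Matrix (Fin e.r) (Fin e.r) (L.O V)}
      {W' : Matrix (Fin e'.r) (Fin e'.r) (L.O V')}, IsWilsonLine C.toSuperMap V 0 1 e e W →
      IsWilsonLine C.toSuperMap V' 0 1 e' e' W' → ∀ x (hx : x ∈ V) (hx' : x ∈ V'),
      valAt hx (str e.lev W) = valAt hx' (str e'.lev W') := by
    intro V V' e e' W W' h h' x hx hx'
    rw [map_str, map_str]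
    exact ((restrictsTo_self _).isLineWL h).str_eq ((restrictsTo_self _).isLineWL h') isFat_univ
      isLine_diag C.pull_end hx hx'
  obtain ⟨z, ⟨hz, hzr⟩, -⟩ := exists_glue 0 N hN hyN (fun y => str (e y).lev (W y))
    (fun y => C.str_mem_gr (hW y)) (fun y y' => eq_of_valAt
      (L.res_mem _ _ _ (C.str_mem_gr (hW y))) (L.res_mem _ _ _ (C.str_mem_gr (hW y')))
      fun x hx => by
        rw [valAt_res, valAt_res]
        exact hstr (hW y) (hW y') x hx.1 hx.2)
  refine ⟨z, ⟨hz, fun V e' W' hW' => eq_of_valAt (L.res_mem _ _ _ hz) (C.str_mem_gr hW')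
    fun x hx => ?_⟩, fun z' hz' => eq_of_valAt hz'.1 hz fun x hx => ?_⟩
  · rw [valAt_res le_top hx]
    refine Eq.trans ?_ (hstr (hW ⟨x, trivial⟩) hW' x (hyN ⟨x, trivial⟩) hx)
    rw [← hzr, valAt_res]
  · rw [hz'.valAt_eq (hW ⟨x, trivial⟩) (hyN ⟨x, trivial⟩), ← map_str, ← hzr, valAt_res]

/-- Both sides have degree 0, so values are compared at each point `y`: a Wilson line near `g.f 0 y`
induces one of `C'` near `y`, in the same trivializations and with the same values. -/
theorem IsWilsonLoop.natural {L' : NQManifold.{v} 𝕜} {g : NQHom L' L} {C' : SuperLoop L' M}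
    (h : C.toSuperMap.IsPullback g C'.toSuperMap) {z : L.O ⊤} {z' : L'.O ⊤}
    (hz : IsWilsonLoop E C z) (hz' : IsWilsonLoop E C' z') : z' = g.pull 0 ⊤ ⊤ z ∅ := by
  have hmem : g.pull 0 ⊤ ⊤ z ∅ ∈ L'.gr ⊤ 0 := by
    have := g.pull_mem 0 trivial ⊤ ⊤ (fun _ _ => trivial) 0 z hz.1 ∅
    rw [Finset.card_empty, sub_self] at this
    exact mem_degZ_natCast (i := 0).1 this
  refine eq_of_valAt hz'.1 hmem fun y hy => ?_
  obtain ⟨V, -, hyV, e, W, hW⟩ := C.exists_isWilsonLine E (V := ⊤) (y := g.f 0 y) trivial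
  obtain ⟨V', hyV', hV'⟩ := g.exists_mapsInto (Z := {0}) (U := V) (x := y) isCompact_singleton
    (Set.subset_univ _) (by rintro _ rfl; exact hyV)
  obtain ⟨W', hW', hv⟩ := hW.exists_pullback isFat_univ h (hV' 0 rfl).2
  refine (hz'.valAt_eq hW' hyV').trans ?_
  rw [hv y hyV', ← hz.valAt_eq hW]
  exact (g.pull_val 0 trivial ⊤ ⊤ (fun _ _ => trivial) z ⟨y, trivial⟩).symm

/-- By periodicity the edges `t = 0` and `t = 1` carry the same transport `P`. The square then says
that `W₁ P` is homotopic to `P W₀`, and `P` is invertible at each point, so the supertraces agree.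
-/
theorem IsWilsonLoop.homotopy_invariant {H : SuperLoopHomotopy L M} {C₀ C₁ : SuperLoop L M}
    (h₀ : H.toSuperMap.IsEdge 1 0 C₀.toSuperMap) (h₁ : H.toSuperMap.IsEdge 1 1 C₁.toSuperMap)
    {z₀ z₁ : L.O ⊤} (hz₀ : IsWilsonLoop E C₀ z₀) (hz₁ : IsWilsonLoop E C₁ z₁) : z₀ = z₁ := by
  refine eq_of_valAt hz₀.1 hz₁.1 fun y _ => ?_
  obtain ⟨V₀, -, hy₀, e₀, W₀, hW₀⟩ := C₀.exists_isWilsonLine E (V := ⊤) (y := y) trivial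
  obtain ⟨V₁, hV₁, hy₁, e₁, W₁, hW₁⟩ := C₁.exists_isWilsonLine E (V := V₀) (y := y) hy₀
  obtain ⟨V₂, hV₂, hy₂, hc⟩ := exists_connects (H := H.toSuperMap) E isFat_strip (isLine_pt_left 0)
    (fun t ht => ht) hy₁
  obtain ⟨V₃, hV₃, hy₃, hs⟩ := exists_commutes (H := H.toSuperMap) E isFat_strip rect_subset_strip hy₂
  have hp : ∀ s, pt s 0 + Pi.single 1 1 = pt s 1 := fun s => by
    ext i; fin_cases i <;> simp [pt]
  have hf : ∀ s, H.f (pt s 1) = H.f (pt s 0) := fun s => by rw [← hp, H.f_periodic]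
  have hpull : ∀ s, H.pull (pt s 1) = H.pull (pt s 0) := fun s => by rw [← hp, H.pull_periodic]
  have g₀ := ((h₀.restrictsTo_right fun t _ => show (0 : ℝ) ∈ Set.Icc (0 : ℝ) 1 from
    ⟨le_rfl, zero_le_one⟩).isLineWL hW₀).res (hV₂.trans hV₁)
  have g₁ := ((h₁.restrictsTo_right fun t _ => show (1 : ℝ) ∈ Set.Icc (0 : ℝ) 1 from
    ⟨zero_le_one, le_rfl⟩).isLineWL hW₁).res hV₂
  obtain ⟨P, hP⟩ := hc e₀ e₁ g₀.mapsInto_left g₁.mapsInto_left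
  have k₀ := hP.res hV₃
  -- The same matrix serves as the Wilson line along both sides of the cut cylinder.
  have k₁ := k₀.congr_line (γ' := fun s => pt s 1) (fun _ h => h) (fun s => (hf s).symm)
    fun s => (hpull s).symm
  have key := hs _ _ _ _ _ _ _ _ (g₀.res hV₃) (g₁.res hV₃) k₀ k₁
  have hframe : H.frame (pt 1 1) V₃ e₁ = H.frame (pt 1 0) V₃ e₁ := by
    simp only [frame, D₀, pullM, hpull]
  rw [hframe] at key
  obtain ⟨q, hq, hq'⟩ := k₀.exists_inverse isFat_strip (isLine_pt_left 0) hy₃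
  have := key.str_eq (k₀.isMor isFat_strip (isLine_pt_left 0))
    (fun α β => k₀.mapsInto_right.D₀_mem α β) hy₃ hq hq'
  simp only [Matrix.map_map, Function.comp_def, valAt_res] at this
  exact (hz₀.valAt_eq hW₀ hy₀).trans (this.symm.trans (hz₁.valAt_eq hW₁ hy₁).symm)

end Loops

end

/-! ### The main theorem -/

theorem mainTheorem1 {𝕜 : Type k} [RCLike 𝕜] (M : NQManifold.{u} 𝕜) (E : QBundle.{u, w} M) :
    -- the Wilson line can be formed: uniquely in one patch, and, with splicing, around every point
    (∀ (L : NQManifold.{v} 𝕜) (C : SuperCurve L M),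
      (∀ (V : Opens L.B) (e : E.Triv) (a b : ℝ), a ≤ b → C.LiesIn V a b e.U →
        ∃! W, IsPathOrderedExp C V e a b W) ∧
      (∀ (y : L.B) (e₀ e₁ : E.Triv), C.f 0 y ∈ e₀.U → C.f 1 y ∈ e₁.U →
        ∃ V : Opens L.B, y ∈ V ∧ ∃ W, IsWilsonLine C V 0 1 e₀ e₁ W)) ∧
    -- covariance under a change of trivialization, for test manifolds with zero `Q`
    (∀ (L : NQManifold.{v} 𝕜), (∀ U, L.Q U = 0) → ∀ (C : SuperCurve L M) (V : Opens L.B)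
      (e₀ e₁ e₀' e₁' : E.Triv) (W : Matrix (Fin e₁.r) (Fin e₀.r) (L.O V))
      (W' : Matrix (Fin e₁'.r) (Fin e₀'.r) (L.O V)),
      IsWilsonLine C V 0 1 e₀ e₁ W → IsWilsonLine C V 0 1 e₀' e₁' W' →
      IsQExact e₀' e₁ (C.at V 1 (QBundle.qmat e₁)) (C.at V 0 (QBundle.qmat e₀'))
        (C.at V 1 (QBundle.transMat e₁ e₁') * W' - W * C.at V 0 (QBundle.transMat e₀ e₀')) ∧
      ∀ (z : Fin e₁.r → L.O V) (z' : Fin e₀.r → L.O V),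
        Matrix.vecMul z (C.at V 1 (QBundle.qmat e₁)) = 0 →
        Matrix.mulVec (C.at V 0 (QBundle.qmat e₀)) z' = 0 →
        z ⬝ᵥ Matrix.mulVec W z' =
          Matrix.vecMul z (C.at V 1 (QBundle.transMat e₁ e₁')) ⬝ᵥ
            Matrix.mulVec W' (Matrix.mulVec (C.at V 0 (QBundle.transMat e₀' e₀)) z')) ∧
    -- homotopy invariance of the Wilson line, for test manifolds with zero `Q`
    (∀ (L : NQManifold.{v} 𝕜), (∀ U, L.Q U = 0) → ∀ (H : SuperCurveHomotopy L M)
      (C₀ C₁ B₀ B₁ : SuperCurve L M),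
      H.IsEdge 1 0 C₀ → H.IsEdge 1 1 C₁ → H.IsEdge 0 0 B₀ → H.IsEdge 0 1 B₁ →
      ∀ (V : Opens L.B) (e₀ e₁ e₀' e₁' : E.Triv)
        (W₀ : Matrix (Fin e₁.r) (Fin e₀.r) (L.O V)) (W₁ : Matrix (Fin e₁'.r) (Fin e₀'.r) (L.O V))
        (P₀ : Matrix (Fin e₀'.r) (Fin e₀.r) (L.O V)) (P₁ : Matrix (Fin e₁'.r) (Fin e₁.r) (L.O V)),
      IsWilsonLine C₀ V 0 1 e₀ e₁ W₀ → IsWilsonLine C₁ V 0 1 e₀' e₁' W₁ →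
      IsWilsonLine B₀ V 0 1 e₀ e₀' P₀ → IsWilsonLine B₁ V 0 1 e₁ e₁' P₁ →
      (∀ y ∈ V, ∃ (V' : Opens L.B) (h : V' ≤ V), y ∈ V' ∧
        IsQExact e₀ e₁' (C₁.at V' 1 (QBundle.qmat e₁')) (C₀.at V' 0 (QBundle.qmat e₀))
          ((W₁ * P₀ - P₁ * W₀).map (L.res h))) ∧
      ∀ (z : Fin e₁'.r → L.O V) (z' : Fin e₀.r → L.O V),
        Matrix.vecMul z (C₁.at V 1 (QBundle.qmat e₁')) = 0 →
        Matrix.mulVec (C₀.at V 0 (QBundle.qmat e₀)) z' = 0 →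
        z ⬝ᵥ Matrix.mulVec W₁ (Matrix.mulVec P₀ z') =
          Matrix.vecMul z P₁ ⬝ᵥ Matrix.mulVec W₀ z') ∧
    -- the Wilson loop is a well-defined function on the presheaf of super-loops
    (∀ (L : NQManifold.{v} 𝕜) (C : SuperLoop L M), ∃! z, IsWilsonLoop E C z) ∧
    (∀ (L L' : NQManifold.{v} 𝕜) (g : NQHom L' L) (C : SuperLoop L M) (C' : SuperLoop L' M),
      C.toSuperMap.IsPullback g C'.toSuperMap → ∀ (z : L.O ⊤) (z' : L'.O ⊤),
      IsWilsonLoop E C z → IsWilsonLoop E C' z' → z' = g.pull 0 ⊤ ⊤ z ∅) ∧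
    -- and it is invariant under homotopies
    (∀ (L : NQManifold.{v} 𝕜) (H : SuperLoopHomotopy L M) (C₀ C₁ : SuperLoop L M),
      H.toSuperMap.IsEdge 1 0 C₀.toSuperMap → H.toSuperMap.IsEdge 1 1 C₁.toSuperMap →
      ∀ z₀ z₁ : L.O ⊤, IsWilsonLoop E C₀ z₀ → IsWilsonLoop E C₁ z₁ → z₀ = z₁) := by
  have h01 : ∀ t ∈ Set.Icc (0 : ℝ) 1, (fun _ => t) ∈ Set.Icc (0 : Fin 1 → ℝ) 1 :=
    fun t ht => ⟨fun _ => ht.1, fun _ => ht.2⟩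
  refine ⟨fun L C => ⟨fun V e a b hab h => SuperMap.existsUnique_isPathOrderedExp isFat_Icc hab h,
    fun y e₀ e₁ h₀ h₁ => ?_⟩, fun L hQ C V e₀ e₁ e₀' e₁' W W' h h' =>
      ⟨wilsonLine_isQExact isFat_Icc hQ h h', wilsonLine_covariant isFat_Icc hQ h h'⟩,
    fun L hQ H C₀ C₁ B₀ B₁ hC₀ hC₁ hB₀ hB₁ V e₀ e₁ e₀' e₁' W₀ W₁ P₀ P₁ hW₀ hW₁ hP₀ hP₁ =>
      wilsonLine_homotopy hQ hC₀ hC₁ hB₀ hB₁ hW₀ hW₁ hP₀ hP₁,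
    fun L C => existsUnique_isWilsonLoop E C,
    fun L L' g C C' h z z' hz hz' => hz.natural h hz',
    fun L H C₀ C₁ h₀ h₁ z₀ z₁ hz₀ hz₁ => hz₀.homotopy_invariant h₀ h₁ hz₁⟩
  obtain ⟨V, -, hy, hW⟩ := SuperMap.exists_isWilsonLine (V := ⊤) isFat_Icc h01 trivial e₀ e₁ h₀ h₁
  exact ⟨V, hy, hW⟩
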